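/- Let $E=(E^0,E^1,r,s)$ be a non-empty countable directed graph that is locally finite (every vertex emits and receives only finitely many edges) and has no sources (every vertex receives an edge). Let $A=C^*(E)$ be the universal $C^*$-algebra generated by a Cuntz–Krieger family $\{S_e,p_v\}$ (mutually orthogonal projections $p_v$ and elements $S_e$ with $S_e^*S_e=p_{r(e)}$, and $p_v=\sum_{s(e)=v}S_eS_e^*$ if $v$ is not a sink), with gauge action $\gamma_z(S_e)=zS_e$, $\gamma_z(p_v)=p_v$, and put $A_c=\mathrm{span}\{S_\mu S_\nu^*\}$ ($\mu,\nu$ paths, $S_v=p_v$ for a path of length $0$). Let $\tau:A_+\to[0,\infty]$ be a faithful, semifinite (finite on a norm dense subset of $A_+$), gauge-invariant, norm lower semicontinuous trace. Let $\mathcal H$ be the completion of $A_c$ for $\langle x,y\rangle=\tau(x^*y)$, on which $A_c$ acts by left multiplication; let $\Phi_k$ ($k\in\mathbb Z$) be the projection onto the $k$-th spectral subspace of the gauge action on $\mathcal H$, and let $\mathcal D=\sum_k k\Phi_k$ with domain $\{x:\sum_k k^2\|\Phi_kx\|^2<\infty\}$. Put $\delta(T)=[|\mathcal D|,T]$, and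 let $\mathcal A$ be the completion of $A_c$ for the seminorms $\|\delta^n(a)\|$, $\|\delta^n([\mathcal D,a])\|$, $n\ge 0$ (the $\delta$-topology), regarded as an algebra of operators on $\mathcal H$. Let $\mathcal N\subset\mathcal B(\mathcal H)$ be the double commutant of the operators $\Theta_{x,y}z=x\,\Phi(y^*z)$, $x,y\in A_c$, where $\Phi$ is the expectation onto the gauge-invariant elements. For $T\in\mathcal N_+$ let $\tilde\tau(T)=\sum_\mu\omega_\mu(T)$, the sum over all finite paths, where $\omega_v(T)=\langle p_v,Tp_v\rangle$ for a path of length $0$ and $$\omega_\mu(T)=\langle S_\mu,TS_\mu\rangle+\frac1{|r(\mu)|_{|\mu|}}\langle S_\mu^*,TS_\mu^*\rangle\qquad(|\mu|\ge1),$$ $|v|_k$ being the number of paths of length $k$ with range $v$. Let $\mathcal A_c\supseteq A_c$ be the set of all $a\in\mathcal A$ with $p_Fa=a=ap_F$ for some finite $F\subset E^0$, where $p_F=\sum_{v\in F}p_v$. Then: 1. $(\mathcal A,\mathcal H,\mathcal D)$ is a semifinite spectral triple relative to $(\mathcal N,\tilde\tau)$: $\tilde\tau$ is a faithful normal semifinite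 trace on $\mathcal N$; $\mathcal A\subset\mathcal N$ is a $*$-algebra; $\mathcal D$ is self-adjoint and affiliated to $\mathcal N$; for all $a\in\mathcal A$, $[\mathcal D,a]$ extends to a bounded operator in $\mathcal N$; and for all $a\in\mathcal A$ and $\lambda\in\mathbb C\setminus\mathbb R$, $a(\lambda-\mathcal D)^{-1}$ lies in the norm closed ideal of $\mathcal N$ generated by the projections of finite trace. 2. It is $QC^\infty$: $a$ and $[\mathcal D,a]$ lie in the domain of $\delta^k$ for all $a\in\mathcal A$, $k\ge1$. 3. It is odd: there is no $\Gamma\in\mathcal N$ with $\Gamma=\Gamma^*$, $\Gamma^2=1$ that commutes with $\mathcal A$ and satisfies $\mathcal D\Gamma+\Gamma\mathcal D=0$. 4. It is local: $\mathcal A$ is complete in the $\delta$-topology, $\mathcal A_c$ is a $\delta$-dense $*$-subalgebra with local units, and there is an approximate unit $(\phi_n)\subset\mathcal A_c$ of $\mathcal A$ (for the $\delta$-topology) such that $\Omega(\mathcal A_c)=\bigcup_n\{w\in\Omega(\mathcal A):\phi_nw=w=w\phi_n\}$, where $\Omega(\mathcal B)$ is the algebra generated by $\mathcal B$ and $[\mathcal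 D,\mathcal B]$. 5. It is $(1,\infty)$-summable: $a(\lambda-\mathcal D)^{-1}\in\mathcal L^{(1,\infty)}(\mathcal N,\tilde\tau)$ for all $a\in\mathcal A_c$, $\lambda\in\mathbb C\setminus\mathbb R$. Here $\mathcal L^{(1,\infty)}$ consists of the $T\in\mathcal N$ for which $F_T(t)=\frac1{\log(1+t)}\int_0^t\mu_s(T)\,ds$ is bounded on $(0,\infty)$, with $\mu_s(T)=\inf\{\|TP\|:P\in\mathcal N\text{ a projection},\ \tilde\tau(1-P)\le s\}$. 6. For every non-zero $a\in\mathcal A$, the operator $a(1+\mathcal D^2)^{-1/2}\in\mathcal N$ is not trace class, that is, $\tilde\tau(|a(1+\mathcal D^2)^{-1/2}|)=\infty$. 7. If no vertex downstream of $v\in E^0$ ($v$ included) is a sink, then $p_v(1+\mathcal D^2)^{-1/2}\in\mathcal L^{(1,\infty)}(\mathcal N,\tilde\tau)$ is positive, $\tau(p_v)<\infty$, and $$\tilde\tau_\omega\bigl(p_v(1+\mathcal D^2)^{-1/2}\bigr)=\omega\bigl(F_{p_v(1+\mathcal D^2)^{-1/2}}\bigr)=2\tau(p_v)$$ for every Dixmier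 trace $\tilde\tau_\omega$; more generally, the second equality holds for every state $\omega$ on $L^\infty((0,\infty))$ that vanishes on functions of bounded support. -/

import Mathlib

open scoped ENNReal ComplexOrder

universe u

noncomputable section

namespace GraphAlg

/-! ### Graph C⋆-algebras

A directed graph is a quiver on the vertex type `V`: `e : a ⟶ b` is an edge with source `a` and
range `b`.  `Quiver.Star v` is the type of edges emitted by `v`, `Quiver.Costar v` the type of
edges received by `v`, and `Quiver.Path a b` the type of paths with source `a` and range `b`. -/

/-- Every vertex emits and receives at most finitely many edges. -/
def LocallyFinite (V : Type u) [Quiver.{u + 1} V] : Prop :=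
  (∀ v : V, Finite (Quiver.Star v)) ∧ ∀ v : V, Finite (Quiver.Costar v)

/-- Every vertex receives at least one edge. -/
def NoSources (V : Type u) [Quiver.{u + 1} V] : Prop :=
  ∀ v : V, Nonempty (Quiver.Costar v)

/-- No vertex that can be reached from `v` (including `v` itself) is a sink. -/
def NoSinksDownstream {V : Type u} [Quiver.{u + 1} V] (v : V) : Prop :=
  ∀ w : V, Nonempty (Quiver.Path v w) → Nonempty (Quiver.Star w)

/-- The Cuntz-Krieger relations, for a row-finite graph. -/
structure IsCuntzKrieger {V : Type u} [Quiver.{u + 1} V] {B : Type*} [NonUnitalCStarAlgebra B]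
    (p : V → B) (S : ∀ {a b : V}, (a ⟶ b) → B) : Prop where
  proj : ∀ v, IsStarProjection (p v)
  orth : ∀ v w, v ≠ w → p v * p w = 0
  star_mul : ∀ {a b : V} (e : a ⟶ b), star (S e) * S e = p b
  sum : ∀ v, Nonempty (Quiver.Star v) →
    p v = ∑ᶠ e : Quiver.Star v, S e.2 * star (S e.2)

/-- A Cuntz-Krieger family in some C⋆-algebra. -/
structure CuntzKriegerFamily (V : Type u) [Quiver.{u + 1} V] where
  B : Type u
  [alg : NonUnitalCStarAlgebra B]
  p : V → B
  S : ∀ {a b : V}, (a ⟶ b) → B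
  isCK : IsCuntzKrieger p S

attribute [instance] CuntzKriegerFamily.alg

section Universal

variable (V : Type u) [Quiver.{u + 1} V]

/-- The bounded elements of the product over all Cuntz-Krieger families. -/
abbrev BigProduct : Type (u + 1) := lp (fun F : CuntzKriegerFamily V => F.B) ∞

variable {V}

theorem norm_proj_le_one {B : Type*} [NonUnitalCStarAlgebra B] {p : B} (hp : IsStarProjection p) :
    ‖p‖ ≤ 1 := by
  have h := CStarRing.norm_star_mul_self (x := p)
  rw [hp.isSelfAdjoint.star_eq, hp.isIdempotentElem.eq] at h
  nlinarith [norm_nonneg p, sq_nonneg (‖p‖ - 1)]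

theorem norm_partialIsometry_le_one {B : Type*} [NonUnitalCStarAlgebra B] {s p : B}
    (hp : IsStarProjection p) (h : star s * s = p) : ‖s‖ ≤ 1 := by
  have h1 := CStarRing.norm_star_mul_self (x := s)
  rw [h] at h1
  nlinarith [norm_nonneg s, norm_proj_le_one hp]

/-- The vertex projection `p_v`, as the tuple of the `p_v` of all families. -/
def bigP (v : V) : BigProduct V :=
  ⟨fun F => F.p v, memℓp_infty ⟨1, by
    rintro _ ⟨F, rfl⟩; exact norm_proj_le_one (F.isCK.proj v)⟩⟩

/-- The partial isometry `S_e`, as the tuple of the `S_e` of all families. -/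
def bigS {a b : V} (e : a ⟶ b) : BigProduct V :=
  ⟨fun F => F.S e, memℓp_infty ⟨1, by
    rintro _ ⟨F, rfl⟩
    exact norm_partialIsometry_le_one (F.isCK.proj b) (F.isCK.star_mul e)⟩⟩

variable (V)

/-- The set of the generators `p_v`, `S_e`. -/
def bigGenerators : Set (BigProduct V) :=
  {x | (∃ v : V, x = bigP v) ∨ ∃ (a b : V) (e : a ⟶ b), x = bigS e}

/-- The closed ⋆-subalgebra generated by the tautological family. -/
def graphSubalgebra : NonUnitalStarSubalgebra ℂ (BigProduct V) :=
  (NonUnitalStarAlgebra.adjoin ℂ (bigGenerators V)).topologicalClosure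

/-- The graph C⋆-algebra `C⋆(E)`: the C⋆-algebra generated by the universal Cuntz-Krieger family.
It is realised inside the product over all Cuntz-Krieger families, so that the norm is the supremum
over all families and evaluation at a family is the homomorphism of the universal property
(`exists_lift`). -/
def GraphCStar : Type (u + 1) := graphSubalgebra V

instance : NonUnitalCStarAlgebra (GraphCStar V) :=
  NonUnitalStarSubalgebra.nonUnitalCStarAlgebra (graphSubalgebra V)
    (h_closed := NonUnitalStarSubalgebra.isClosed_topologicalClosure _)

instance : PartialOrder (GraphCStar V) := CStarAlgebra.spectralOrder _

instance : StarOrderedRing (GraphCStar V) := CStarAlgebra.spectralOrderedRing _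

variable {V}

/-- The projection `p_v` in `C⋆(E)`. -/
def P (v : V) : GraphCStar V :=
  ⟨bigP v, subset_closure (NonUnitalStarAlgebra.subset_adjoin ℂ _ (Or.inl ⟨v, rfl⟩))⟩

/-- The partial isometry `S_e` in `C⋆(E)`. -/
def S {a b : V} (e : a ⟶ b) : GraphCStar V :=
  ⟨bigS e, subset_closure (NonUnitalStarAlgebra.subset_adjoin ℂ _ (Or.inr ⟨a, b, e, rfl⟩))⟩

/-- The universal property of `C⋆(E)`. -/
theorem exists_lift (F : CuntzKriegerFamily V) :
    ∃ φ : GraphCStar V →⋆ₙₐ[ℂ] F.B, (∀ v, φ (P v) = F.p v) ∧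
      ∀ (a b : V) (e : a ⟶ b), φ (S e) = F.S e :=
  ⟨{ toFun := fun x => (x.1 : ∀ F : CuntzKriegerFamily V, F.B) F
     map_smul' := fun _ _ => rfl
     map_zero' := rfl
     map_add' := fun _ _ => rfl
     map_mul' := fun _ _ => rfl
     map_star' := fun _ => rfl }, fun _ => rfl, fun _ _ _ => rfl⟩

theorem isStarProjection_P (v : V) : IsStarProjection (P v) where
  isIdempotentElem := Subtype.ext <| Subtype.ext <| funext fun F =>
    (F.isCK.proj v).isIdempotentElem
  isSelfAdjoint := Subtype.ext <| Subtype.ext <| funext fun F => (F.isCK.proj v).isSelfAdjoint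

theorem star_S_mul_S {a b : V} (e : a ⟶ b) : star (S e) * S e = P b :=
  Subtype.ext <| Subtype.ext <| funext fun F => F.isCK.star_mul e

/-! ### The gauge action -/

/-- The family `{z S_e, p_v}`. -/
def CuntzKriegerFamily.twist (z : Circle) (F : CuntzKriegerFamily V) : CuntzKriegerFamily V where
  B := F.B
  p := F.p
  S := fun e => (z : ℂ) • F.S e
  isCK :=
    have key : ∀ x y : F.B, ((z : ℂ) • x) * star ((z : ℂ) • y) = x * star y := fun x y => by
      rw [star_smul, smul_mul_smul_comm, Complex.star_def, Complex.mul_conj]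
      simp
    have key' : ∀ x y : F.B, star ((z : ℂ) • x) * ((z : ℂ) • y) = star x * y := fun x y => by
      rw [star_smul, smul_mul_smul_comm, Complex.star_def, mul_comm _ (z : ℂ), Complex.mul_conj]
      simp
    { proj := F.isCK.proj
      orth := F.isCK.orth
      star_mul := fun e => (key' _ _).trans (F.isCK.star_mul e)
      sum := fun v hv => by
        rw [F.isCK.sum v hv]
        exact finsum_congr fun e => (key _ _).symm }

/-- The action of `z` on the product over all families. -/
def bigGauge (z : Circle) : BigProduct V →⋆ₙₐ[ℂ] BigProduct V where
  toFun x := ⟨fun F => (x : ∀ F : CuntzKriegerFamily V, F.B) (F.twist z), memℓp_infty ⟨‖x‖, by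
    rintro _ ⟨F, rfl⟩; exact lp.norm_apply_le_norm ENNReal.top_ne_zero x (F.twist z)⟩⟩
  map_smul' _ _ := rfl
  map_zero' := rfl
  map_add' _ _ := rfl
  map_mul' _ _ := rfl
  map_star' _ := rfl

theorem bigGauge_P (z : Circle) (v : V) : bigGauge z (bigP v) = bigP v := rfl

theorem bigGauge_S (z : Circle) {a b : V} (e : a ⟶ b) :
    bigGauge z (bigS e) = (z : ℂ) • bigS e := rfl

theorem bigGauge_mem (z : Circle) {x : BigProduct V} (hx : x ∈ graphSubalgebra V) :
    bigGauge z x ∈ graphSubalgebra V := by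
  have hle : graphSubalgebra V ≤ (graphSubalgebra V).comap (bigGauge z) := by
    refine NonUnitalStarSubalgebra.topologicalClosure_minimal _ ?_ ?_
    · refine NonUnitalStarAlgebra.adjoin_le ?_
      rintro _ (⟨v, rfl⟩ | ⟨a, b, e, rfl⟩)
      · exact (P v).2
      · exact SMulMemClass.smul_mem (s := graphSubalgebra V) (z : ℂ) (S e).2
    · have hc : Continuous (bigGauge z : BigProduct V → BigProduct V) :=
        AddMonoidHomClass.continuous_of_bound (bigGauge z) 1 fun x => by
          simpa using NonUnitalStarAlgHom.norm_apply_le (bigGauge z) x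
      exact (NonUnitalStarSubalgebra.isClosed_topologicalClosure _).preimage hc
  exact hle hx

/-- The gauge action: `γ_z(S_e) = z S_e`, `γ_z(p_v) = p_v`. -/
def gauge (z : Circle) : GraphCStar V →⋆ₙₐ[ℂ] GraphCStar V where
  toFun x := ⟨bigGauge z x.1, bigGauge_mem z x.2⟩
  map_smul' _ _ := rfl
  map_zero' := rfl
  map_add' _ _ := rfl
  map_mul' _ _ := rfl
  map_star' _ := rfl

theorem gauge_P (z : Circle) (v : V) : gauge z (P v) = P v := rfl

theorem gauge_S (z : Circle) {a b : V} (e : a ⟶ b) : gauge z (S e) = (z : ℂ) • S e := rfl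

variable (V)

/-- The ⋆-algebra `A_c` generated by the `S_e` and `p_v`, which is the linear span of the
`S_μ S_ν⋆` because words in the generators collapse to such products. -/
def core : NonUnitalStarSubalgebra ℂ (GraphCStar V) :=
  NonUnitalStarAlgebra.adjoin ℂ {x | (∃ v : V, x = P v) ∨ ∃ (a b : V) (e : a ⟶ b), x = S e}

variable {V}

theorem P_mem_core (v : V) : P v ∈ core V :=
  NonUnitalStarAlgebra.subset_adjoin ℂ _ (Or.inl ⟨v, rfl⟩)

theorem S_mem_core {a b : V} (e : a ⟶ b) : S e ∈ core V :=
  NonUnitalStarAlgebra.subset_adjoin ℂ _ (Or.inr ⟨a, b, e, rfl⟩)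

theorem gauge_mem_core (z : Circle) {x : GraphCStar V} (hx : x ∈ core V) :
    gauge z x ∈ core V := by
  have hle : core V ≤ (core V).comap (gauge z) := by
    refine NonUnitalStarAlgebra.adjoin_le ?_
    rintro _ (⟨v, rfl⟩ | ⟨a, b, e, rfl⟩)
    · exact P_mem_core v
    · exact SMulMemClass.smul_mem (s := core V) (z : ℂ) (S_mem_core e)
  exact hle hx

end Universal

/-! ### Traces on C⋆-algebras -/

/-- A trace on a C⋆-algebra: a map from the positive cone to `[0, ∞]` (values off the cone are
irrelevant). -/
structure CStarTrace (A : Type*) [NonUnitalCStarAlgebra A] [PartialOrder A] [StarOrderedRing A] where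
  toFun : A → ℝ≥0∞
  map_add : ∀ a b, 0 ≤ a → 0 ≤ b → toFun (a + b) = toFun a + toFun b
  map_smul : ∀ (r : ℝ) (a : A), 0 ≤ r → 0 ≤ a → toFun (r • a) = ENNReal.ofReal r * toFun a
  map_star_mul_self : ∀ a, toFun (star a * a) = toFun (a * star a)

namespace CStarTrace

variable {A : Type*} [NonUnitalCStarAlgebra A] [PartialOrder A] [StarOrderedRing A]

instance : CoeFun (CStarTrace A) fun _ => A → ℝ≥0∞ := ⟨CStarTrace.toFun⟩

def Faithful (τ : CStarTrace A) : Prop := ∀ a, 0 ≤ a → τ a = 0 → a = 0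

/-- The positive elements of finite trace are norm dense in the positive cone. -/
def Semifinite (τ : CStarTrace A) : Prop :=
  ∀ a, 0 ≤ a → ∀ ε > 0, ∃ b, 0 ≤ b ∧ τ b < ∞ ∧ ‖a - b‖ < ε

variable (τ : CStarTrace A)

theorem mono {a b : A} (ha : 0 ≤ a) (hab : a ≤ b) : τ a ≤ τ b := by
  have h := τ.map_add a (b - a) ha (sub_nonneg.2 hab)
  rw [add_sub_cancel] at h
  rw [h]; exact le_self_add

theorem smul_lt_top {r : ℝ} (hr : 0 ≤ r) {a : A} (ha : 0 ≤ a) (h : τ a < ∞) : τ (r • a) < ∞ := by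
  rw [τ.map_smul r a hr ha]; exact ENNReal.mul_lt_top ENNReal.ofReal_lt_top h

theorem star_mul_le (a x : A) : τ (star (a * x) * (a * x)) ≤ ENNReal.ofReal (‖a‖ ^ 2) *
    τ (star x * x) := by
  have h : star (a * x) * (a * x) ≤ ‖a‖ ^ 2 • (star x * x) := by
    have := CStarAlgebra.star_left_conjugate_le_norm_smul (a := x) (b := star a * a)
      (IsSelfAdjoint.star_mul_self a)
    rw [CStarRing.norm_star_mul_self, ← sq] at this
    simpa [mul_assoc] using this
  rw [← τ.map_smul _ _ (by positivity) (star_mul_self_nonneg x)]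
  exact τ.mono (star_mul_self_nonneg _) h

/-- Projections have finite trace. -/
theorem proj_lt_top (hτ : τ.Semifinite) {p : A} (hp : IsStarProjection p) : τ p < ∞ := by
  have hp0 : 0 ≤ p := by
    have := star_mul_self_nonneg p
    rwa [hp.isSelfAdjoint.star_eq, hp.isIdempotentElem.eq] at this
  obtain ⟨b, hb, hfin, hlt⟩ := hτ p hp0 (1 / 2) (by norm_num)
  obtain ⟨c, rfl⟩ := CStarAlgebra.nonneg_iff_eq_star_mul_self.1 hb
  have h1 : p * (p - star c * c) * p ≤ (1 / 2 : ℝ) • p := by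
    have := CStarAlgebra.star_left_conjugate_le_norm_smul (a := p) (b := p - star c * c)
      (hp.isSelfAdjoint.sub (IsSelfAdjoint.star_mul_self c))
    rw [hp.isSelfAdjoint.star_eq, hp.isIdempotentElem.eq] at this
    exact this.trans (smul_le_smul_of_nonneg_right hlt.le hp0)
  have h2 : p ≤ (2 : ℝ) • (star (c * p) * (c * p)) := by
    have e : p * (p - star c * c) * p = p - star (c * p) * (c * p) := by
      rw [star_mul, hp.isSelfAdjoint.star_eq, mul_sub, sub_mul, hp.isIdempotentElem.eq,
        hp.isIdempotentElem.eq]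
      simp [mul_assoc]
    rw [e] at h1
    have h3 : (1 / 2 : ℝ) • p ≤ star (c * p) * (c * p) := by
      have h4 : p = (1 / 2 : ℝ) • p + (1 / 2 : ℝ) • p := by rw [← add_smul]; norm_num
      rw [sub_le_iff_le_add] at h1
      nth_rewrite 1 [h4] at h1
      exact le_of_add_le_add_left h1
    have h5 := smul_le_smul_of_nonneg_left h3 (show (0 : ℝ) ≤ 2 by norm_num)
    rwa [smul_smul, show (2 : ℝ) * (1 / 2) = 1 by norm_num, one_smul] at h5
  refine (τ.mono hp0 h2).trans_lt (τ.smul_lt_top (by norm_num) (star_mul_self_nonneg _) ?_)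
  rw [τ.map_star_mul_self, star_mul, hp.isSelfAdjoint.star_eq,
    show c * p * (p * star c) = star (p * star c) * (p * star c) by
      rw [star_mul, star_star, hp.isSelfAdjoint.star_eq]]
  refine (τ.star_mul_le p (star c)).trans_lt (ENNReal.mul_lt_top ENNReal.ofReal_lt_top ?_)
  rwa [star_star, ← τ.map_star_mul_self]

/-- `x ↦ τ(x⋆x)` satisfies the parallelogram law. -/
theorem parallelogram (x y : A) : τ (star (x + y) * (x + y)) + τ (star (x - y) * (x - y)) =
    2 * (τ (star x * x) + τ (star y * y)) := by
  have hx := star_mul_self_nonneg x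
  have hy := star_mul_self_nonneg y
  rw [two_mul, ← τ.map_add _ _ hx hy, ← τ.map_add _ _ (add_nonneg hx hy) (add_nonneg hx hy),
    ← τ.map_add _ _ (star_mul_self_nonneg _) (star_mul_self_nonneg _)]
  congr 1
  simp only [star_add, star_sub]
  noncomm_ring

theorem add_lt_top {x y : A} (hx : τ (star x * x) < ∞) (hy : τ (star y * y) < ∞) :
    τ (star (x + y) * (x + y)) < ∞ := by
  refine lt_of_le_of_lt (le_self_add.trans_eq (τ.parallelogram x y)) ?_
  exact ENNReal.mul_lt_top (by simp) (ENNReal.add_lt_top.2 ⟨hx, hy⟩)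

theorem smul_sq (c : ℂ) (x : A) :
    τ (star (c • x) * (c • x)) = ENNReal.ofReal (‖c‖ ^ 2) * τ (star x * x) := by
  rw [← τ.map_smul _ _ (by positivity) (star_mul_self_nonneg x), star_smul, smul_mul_smul_comm,
    Complex.star_def, mul_comm, Complex.mul_conj, Complex.normSq_eq_norm_sq]
  congr 1

/-- The weighted form of the triangle inequality. -/
theorem weighted {s : ℝ} (hs : 0 < s) (x y : A) : τ (star (x + y) * (x + y)) ≤
    ENNReal.ofReal (1 + s) * τ (star x * x) + ENNReal.ofReal (1 + s⁻¹) * τ (star y * y) := by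
  have hx := star_mul_self_nonneg x
  have hy := star_mul_self_nonneg y
  have h1 : 0 ≤ 1 + s := by positivity
  have h2 : 0 ≤ 1 + s⁻¹ := by positivity
  rw [← τ.map_smul _ _ h1 hx, ← τ.map_smul _ _ h2 hy,
    ← τ.map_add _ _ (smul_nonneg h1 hx) (smul_nonneg h2 hy)]
  refine τ.mono (star_mul_self_nonneg _) (sub_nonneg.1 ?_)
  have h3 : (1 + s) • (star x * x) + (1 + s⁻¹) • (star y * y) - star (x + y) * (x + y)
      = s⁻¹ • (star (s • x - y) * (s • x - y)) := by
    simp only [star_add, star_sub, star_smul, star_trivial, add_mul, mul_add, sub_mul, mul_sub,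
      smul_mul_assoc, mul_smul_comm, smul_sub, add_smul, one_smul, smul_smul]
    rw [← mul_assoc, inv_mul_cancel₀ hs.ne', one_mul, one_smul, one_smul]
    abel
  rw [h3]
  exact smul_nonneg (by positivity) (star_mul_self_nonneg _)

end CStarTrace

/-- A faithful, semifinite, norm lower semicontinuous, gauge invariant trace on `C⋆(E)`. -/
structure GaugeTrace (V : Type u) [Quiver.{u + 1} V] extends CStarTrace (GraphCStar V) where
  faithful : toCStarTrace.Faithful
  semifinite : toCStarTrace.Semifinite
  lowerSemicontinuous : LowerSemicontinuousOn toFun {a | 0 ≤ a}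
  gauge_invariant : ∀ (z : Circle) (a : GraphCStar V), 0 ≤ a → toFun (gauge z a) = toFun a

section HilbertSpace

variable {V : Type u} [Quiver.{u + 1} V]

instance : CoeFun (GaugeTrace V) fun _ => GraphCStar V → ℝ≥0∞ := ⟨fun τ => τ.toFun⟩

theorem GaugeTrace.core_lt_top (τ : GaugeTrace V) {x : GraphCStar V} (hx : x ∈ core V) :
    τ (star x * x) < ∞ := by
  refine NonUnitalStarAlgebra.adjoin_induction ℂ (p := fun x _ => τ (star x * x) < ∞)
    ?_ ?_ ?_ ?_ ?_ ?_ hx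
  · rintro _ (⟨v, rfl⟩ | ⟨a, b, e, rfl⟩)
    · rw [(isStarProjection_P v).isSelfAdjoint.star_eq, (isStarProjection_P v).isIdempotentElem.eq]
      exact τ.proj_lt_top τ.semifinite (isStarProjection_P v)
    · rw [star_S_mul_S]
      exact τ.proj_lt_top τ.semifinite (isStarProjection_P b)
  · intro x y _ _ hx hy
    exact τ.add_lt_top hx hy
  · have h := τ.smul_sq 0 0
    rw [zero_smul] at h
    rw [h]; simp
  · intro x y _ _ _ hy
    exact (τ.star_mul_le x y).trans_lt (ENNReal.mul_lt_top ENNReal.ofReal_lt_top hy)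
  · intro r x _ hx
    rw [τ.smul_sq]
    exact ENNReal.mul_lt_top ENNReal.ofReal_lt_top hx
  · intro x _ hx
    rw [star_star, ← τ.map_star_mul_self]
    exact hx

/-- `X_c`: a copy of `A_c`, to be given the inner product `⟨x, y⟩ = τ(x⋆y)`. -/
def Xc (_τ : GaugeTrace V) : Type (u + 1) := core V

variable (τ : GaugeTrace V)

instance : AddCommGroup (Xc τ) := inferInstanceAs (AddCommGroup (core V))
instance : Module ℂ (Xc τ) := inferInstanceAs (Module ℂ (core V))

variable {τ}

/-- The element of `C⋆(E)` underlying an element of `X_c`. -/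
def Xc.val (x : Xc τ) : GraphCStar V := Subtype.val (p := fun a => a ∈ core V) x

theorem Xc.val_mem (x : Xc τ) : x.val ∈ core V := Subtype.prop (p := fun a => a ∈ core V) x

variable (τ) in
/-- An element of `A_c` as an element of `X_c`. -/
def Xc.mk (x : GraphCStar V) (hx : x ∈ core V) : Xc τ :=
  (⟨x, hx⟩ : core V)

/-- `‖x‖² = τ(x⋆x)`. -/
instance : Norm (Xc τ) := ⟨fun x => √(τ (star x.val * x.val)).toReal⟩

theorem Xc.norm_sq (x : Xc τ) : ‖x‖ ^ 2 = (τ (star x.val * x.val)).toReal :=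
  Real.sq_sqrt ENNReal.toReal_nonneg

theorem Xc.ne_top (x : Xc τ) : τ (star x.val * x.val) ≠ ∞ := (τ.core_lt_top x.val_mem).ne

theorem Xc.norm_nonneg' (x : Xc τ) : 0 ≤ ‖x‖ := Real.sqrt_nonneg _

theorem Xc.norm_eq_zero_iff' (x : Xc τ) : ‖x‖ = 0 ↔ x = 0 := by
  constructor
  · intro h
    have h1 := x.norm_sq
    rw [h, zero_pow two_ne_zero, eq_comm, ENNReal.toReal_eq_zero_iff, or_iff_left x.ne_top] at h1
    have h2 := τ.faithful _ (star_mul_self_nonneg _) h1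
    rw [CStarRing.star_mul_self_eq_zero_iff] at h2
    exact Subtype.ext (p := fun a => a ∈ core V) h2
  · rintro rfl
    have h := τ.smul_sq 0 0
    rw [zero_smul] at h
    change √(τ (star (0 : GraphCStar V) * 0)).toReal = 0
    rw [h]; simp

theorem Xc.norm_smul' (c : ℂ) (x : Xc τ) : ‖c • x‖ = ‖c‖ * ‖x‖ := by
  rw [← sq_eq_sq₀ (Xc.norm_nonneg' _) (mul_nonneg (norm_nonneg _) (Xc.norm_nonneg' _)), mul_pow,
    Xc.norm_sq, Xc.norm_sq]
  change (τ (star (c • x.val) * (c • x.val))).toReal = _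
  rw [τ.smul_sq, ENNReal.toReal_mul, ENNReal.toReal_ofReal (by positivity)]

theorem Xc.norm_add_le' (x y : Xc τ) : ‖x + y‖ ≤ ‖x‖ + ‖y‖ := by
  rcases eq_or_ne x 0 with rfl | hx
  · rw [zero_add]; linarith [Xc.norm_nonneg' (0 : Xc τ)]
  rcases eq_or_ne y 0 with rfl | hy
  · rw [add_zero]; linarith [Xc.norm_nonneg' (0 : Xc τ)]
  have hx' : 0 < ‖x‖ := lt_of_le_of_ne (Xc.norm_nonneg' x) fun h => hx (x.norm_eq_zero_iff'.1 h.symm)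
  have hy' : 0 < ‖y‖ := lt_of_le_of_ne (Xc.norm_nonneg' y) fun h => hy (y.norm_eq_zero_iff'.1 h.symm)
  have hs : 0 < ‖y‖ / ‖x‖ := by positivity
  have h := τ.weighted hs x.val y.val
  have h1 := ENNReal.toReal_mono (ENNReal.add_ne_top.2
    ⟨ENNReal.mul_ne_top ENNReal.ofReal_ne_top x.ne_top,
      ENNReal.mul_ne_top ENNReal.ofReal_ne_top y.ne_top⟩) h
  rw [ENNReal.toReal_add (ENNReal.mul_ne_top ENNReal.ofReal_ne_top x.ne_top)
      (ENNReal.mul_ne_top ENNReal.ofReal_ne_top y.ne_top), ENNReal.toReal_mul, ENNReal.toReal_mul,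
    ENNReal.toReal_ofReal (by positivity), ENNReal.toReal_ofReal (by positivity)] at h1
  change (τ (star (x + y).val * (x + y).val)).toReal ≤ _ at h1
  rw [← Xc.norm_sq, ← Xc.norm_sq, ← Xc.norm_sq] at h1
  have h2 : (1 + ‖y‖ / ‖x‖) * ‖x‖ ^ 2 + (1 + (‖y‖ / ‖x‖)⁻¹) * ‖y‖ ^ 2 = (‖x‖ + ‖y‖) ^ 2 := by
    field_simp
    ring
  rw [h2] at h1
  exact (sq_le_sq₀ (Xc.norm_nonneg' _) (by positivity)).1 h1

theorem Xc.normedSpaceCore (τ : GaugeTrace V) : NormedSpace.Core ℂ (Xc τ) where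
  norm_nonneg := Xc.norm_nonneg'
  norm_smul := Xc.norm_smul'
  norm_triangle := Xc.norm_add_le'
  norm_eq_zero_iff := Xc.norm_eq_zero_iff'

instance : NormedAddCommGroup (Xc τ) := NormedAddCommGroup.ofCore (Xc.normedSpaceCore τ)

instance : NormedSpace ℂ (Xc τ) := NormedSpace.ofCore (Xc.normedSpaceCore τ)

/-- The inner product of `X_c`, obtained by polarisation from `‖x‖² = τ(x⋆x)`; it is
`⟨x, y⟩ = τ(x⋆y)` for the linear extension of `τ`. -/
instance : InnerProductSpace ℂ (Xc τ) := InnerProductSpace.ofNorm ℂ fun x y => by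
  have h := τ.parallelogram x.val y.val
  change τ (star (x + y).val * (x + y).val) + τ (star (x - y).val * (x - y).val) = _ at h
  have h1 := congrArg ENNReal.toReal h
  rw [ENNReal.toReal_mul, ENNReal.toReal_add x.ne_top y.ne_top,
    ENNReal.toReal_add (x + y).ne_top (x - y).ne_top] at h1
  rw [← Xc.norm_sq, ← Xc.norm_sq, ← Xc.norm_sq, ← Xc.norm_sq] at h1
  simpa [sq] using h1

variable (τ) in
/-- The Hilbert space `H = L²(X, τ)`. -/
abbrev L2 : Type (u + 1) := UniformSpace.Completion (Xc τ)

variable (τ) in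
/-- An element of `A_c` as a vector of `H`. -/
def vec (x : GraphCStar V) (hx : x ∈ core V) : L2 τ := (Xc.mk τ x hx : Xc τ)

/-- Left multiplication by `a ∈ A_c` on `X_c`. -/
def leftMulXc (a : core V) : Xc τ →L[ℂ] Xc τ :=
  LinearMap.mkContinuous
    { toFun := fun x => Xc.mk τ ((a : GraphCStar V) * x.val) (mul_mem a.2 x.val_mem)
      map_add' := fun x y =>
        Subtype.ext (p := fun a => a ∈ core V) (mul_add (a : GraphCStar V) x.val y.val)
      map_smul' := fun c x =>
        Subtype.ext (p := fun a => a ∈ core V) (mul_smul_comm c (a : GraphCStar V) x.val) }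
    ‖(a : GraphCStar V)‖ fun x => by
      rw [← sq_le_sq₀ (norm_nonneg _) (by positivity), mul_pow, Xc.norm_sq, Xc.norm_sq]
      have h := ENNReal.toReal_mono (ENNReal.mul_ne_top ENNReal.ofReal_ne_top x.ne_top)
        (τ.star_mul_le (a : GraphCStar V) x.val)
      rw [ENNReal.toReal_mul, ENNReal.toReal_ofReal (by positivity)] at h
      exact h

variable (τ) in
/-- The representation of `A_c` on `H` by left multiplication. -/
def rep (a : core V) : L2 τ →L[ℂ] L2 τ := (leftMulXc a).completion

/-- The gauge action on `X_c`. -/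
def gaugeXc (z : Circle) : Xc τ →L[ℂ] Xc τ :=
  LinearMap.mkContinuous
    { toFun := fun x => Xc.mk τ (gauge z x.val) (gauge_mem_core z x.val_mem)
      map_add' := fun x y =>
        Subtype.ext (p := fun a => a ∈ core V) (map_add (gauge z) x.val y.val)
      map_smul' := fun c x =>
        Subtype.ext (p := fun a => a ∈ core V) (map_smul (gauge z) c x.val) }
    1 fun x => by
      rw [one_mul, ← sq_le_sq₀ (norm_nonneg _) (norm_nonneg _), Xc.norm_sq, Xc.norm_sq]
      have h := τ.gauge_invariant z (star x.val * x.val) (star_mul_self_nonneg _)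
      rw [map_mul, map_star] at h
      exact (congrArg ENNReal.toReal h).le

variable (τ) in
/-- The unitary gauge action on `H`. -/
def gaugeL2 (z : Circle) : L2 τ →L[ℂ] L2 τ := (gaugeXc z).completion

variable (τ) in
/-- The `k`-th spectral subspace of the gauge action on `H`. -/
def spectralSubspace (k : ℤ) : Submodule ℂ (L2 τ) :=
  ⨅ z : Circle, LinearMap.ker ((gaugeL2 τ z - ((z : ℂ) ^ k) • ContinuousLinearMap.id ℂ (L2 τ) :
    L2 τ →L[ℂ] L2 τ) : L2 τ →ₗ[ℂ] L2 τ)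

instance (k : ℤ) : (spectralSubspace τ k).HasOrthogonalProjection := by
  have h : IsClosed (spectralSubspace τ k : Set (L2 τ)) := by
    rw [spectralSubspace, Submodule.coe_iInf]
    exact isClosed_iInter fun z => ContinuousLinearMap.isClosed_ker _
  have : CompleteSpace (spectralSubspace τ k) := h.completeSpace_coe
  infer_instance

variable (τ) in
/-- The projection `Φ_k` of `H` onto the `k`-th spectral subspace of the gauge action. -/
def Phi (k : ℤ) : L2 τ →L[ℂ] L2 τ := (spectralSubspace τ k).starProjection

variable (τ) in
/-- The operator `x ↦ ∑_k f(k) Φ_k x`, on the domain of those `x` for which the series converges,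
that is, for which `∑_k |f(k)|² ‖Φ_k x‖² < ∞`. -/
def gaugeOp (f : ℤ → ℝ) : L2 τ →ₗ.[ℂ] L2 τ where
  domain :=
    { carrier := {x | Summable fun k : ℤ => f k • Phi τ k x}
      add_mem' := fun {x y} hx hy => by
        have h := Summable.add hx hy
        simpa only [Set.mem_ofPred_eq, map_add, smul_add] using h
      zero_mem' := by simp [summable_zero]
      smul_mem' := fun c x hx => by
        have h := Summable.const_smul c hx
        simpa only [Set.mem_ofPred_eq, map_smul, smul_comm c] using h }
  toFun :=
    { toFun := fun x => ∑' k : ℤ, f k • Phi τ k (x : L2 τ)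
      map_add' := fun x y => by
        rw [← Summable.tsum_add x.2 y.2]
        simp only [Submodule.coe_add, map_add, smul_add]
      map_smul' := fun c x => by
        rw [RingHom.id_apply, ← Summable.tsum_const_smul c x.2]
        simp only [Submodule.coe_smul, map_smul, smul_comm c] }

variable (τ) in
/-- `D = ∑_k k Φ_k`, the generator of the gauge action; `D(S_μ S_ν⋆) = (|μ| - |ν|) S_μ S_ν⋆`. -/
def dirac : L2 τ →ₗ.[ℂ] L2 τ := gaugeOp τ fun k => (k : ℝ)

variable (τ) in
/-- `|D| = ∑_k |k| Φ_k`. -/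
def absDirac : L2 τ →ₗ.[ℂ] L2 τ := gaugeOp τ fun k => |(k : ℝ)|

end HilbertSpace

/-! ### Semifinite spectral triples -/

section SpectralTriples

variable {H : Type*} [NormedAddCommGroup H] [InnerProductSpace ℂ H] [CompleteSpace H]

/-- `t` restricts to a faithful, normal, semifinite trace on the positive cone of the von Neumann
algebra `N`. -/
structure IsFaithfulNormalSemifiniteTrace (N : VonNeumannAlgebra H) (t : (H →L[ℂ] H) → ℝ≥0∞) :
    Prop where
  map_add : ∀ A ∈ N, ∀ B ∈ N, 0 ≤ A → 0 ≤ B → t (A + B) = t A + t B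
  map_smul : ∀ (r : ℝ), 0 ≤ r → ∀ A ∈ N, 0 ≤ A → t ((r : ℂ) • A) = ENNReal.ofReal r * t A
  tracial : ∀ A ∈ N, t (star A * A) = t (A * star A)
  faithful : ∀ A ∈ N, 0 ≤ A → t A = 0 → A = 0
  normal : ∀ s : Set (H →L[ℂ] H), s ⊆ (N : Set (H →L[ℂ] H)) → (∀ A ∈ s, 0 ≤ A) → s.Nonempty →
    DirectedOn (· ≤ ·) s → ∀ B ∈ N, IsLUB s B → t B = ⨆ A ∈ s, t A
  semifinite : ∀ A ∈ N, 0 ≤ A → A ≠ 0 → ∃ B ∈ N, 0 ≤ B ∧ B ≤ A ∧ B ≠ 0 ∧ t B < ∞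

/-- The norm closed two-sided ideal of `N` generated by the projections of finite trace. -/
def compacts (N : VonNeumannAlgebra H) (t : (H →L[ℂ] H) → ℝ≥0∞) : Set (H →L[ℂ] H) :=
  closure (Submodule.span ℂ {T | ∃ A ∈ N, ∃ B ∈ N, ∃ E ∈ N,
    IsStarProjection E ∧ t E < ∞ ∧ T = A * E * B} : Set (H →L[ℂ] H))

/-- The `r`-th generalized singular value of `T`. -/
def singularValue (N : VonNeumannAlgebra H) (t : (H →L[ℂ] H) → ℝ≥0∞) (T : H →L[ℂ] H) (r : ℝ) : ℝ :=
  sInf {c | ∃ E ∈ N, IsStarProjection E ∧ t (1 - E) ≤ ENNReal.ofReal r ∧ c = ‖T * E‖}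

/-- The trace class operators `L¹(N, t)`. -/
def traceClass (N : VonNeumannAlgebra H) (t : (H →L[ℂ] H) → ℝ≥0∞) : Set (H →L[ℂ] H) :=
  {T | T ∈ N ∧ t (CFC.abs T) < ∞}

/-- The function `F_T(s) = (1 / log(1 + s)) ∫₀ˢ μ_r(T) dr`. -/
def dixmierFun (N : VonNeumannAlgebra H) (t : (H →L[ℂ] H) → ℝ≥0∞) (T : H →L[ℂ] H) (s : ℝ) : ℝ :=
  1 / Real.log (1 + s) * ∫ r in (0 : ℝ)..s, singularValue N t T r

/-- The ideal `L^(1,∞)(N, t)`: the `T ∈ N` with `sup_{s > 0} F_T(s) < ∞`. -/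
def dixmierIdeal (N : VonNeumannAlgebra H) (t : (H →L[ℂ] H) → ℝ≥0∞) : Set (H →L[ℂ] H) :=
  {T | T ∈ N ∧ ∃ C : ℝ, ∀ s > 0, dixmierFun N t T s ≤ C}

/-- A generalized limit at infinity: a state on `L^∞((0, ∞))` that vanishes on the functions of
bounded support.  The functionals `ω` that define the Dixmier traces are of this kind; the additional
invariance which makes `ω ∘ F` additive on the positive cone of `L^(1,∞)` is not required here. -/
structure IsGeneralizedLimit
    (ω : MeasureTheory.Lp ℝ ∞ (MeasureTheory.volume.restrict (Set.Ioi (0 : ℝ))) →L[ℝ] ℝ) :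
    Prop where
  nonneg : ∀ f, 0 ≤ f → 0 ≤ ω f
  one : ∀ f, (∀ᵐ x ∂(MeasureTheory.volume.restrict (Set.Ioi (0 : ℝ))), f x = 1) → ω f = 1
  vanish : ∀ f, (∃ c : ℝ, ∀ᵐ x ∂(MeasureTheory.volume.restrict (Set.Ioi (0 : ℝ))),
    c < x → f x = 0) → ω f = 0

/-- The unbounded operator `D` is affiliated to `N`: it commutes with the unitaries of `N'`. -/
def IsAffiliated (N : VonNeumannAlgebra H) (D : H →ₗ.[ℂ] H) : Prop :=
  ∀ U ∈ N.commutant, U ∈ unitary (H →L[ℂ] H) → ∀ x y, (x, y) ∈ D.graph → (U x, U y) ∈ D.graph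

/-- `R` is the bounded extension of `[D, T]`: `T` preserves the domain of `D` and
`D T x = T D x + R x` on it. -/
def IsCommutator (D : H →ₗ.[ℂ] H) (T R : H →L[ℂ] H) : Prop :=
  ∀ x y, (x, y) ∈ D.graph → (T x, T y + R x) ∈ D.graph

/-- `R` is the bounded extension of the `n`-fold commutator `[D, [D, … [D, T]]]`. -/
def IsIteratedCommutator (D : H →ₗ.[ℂ] H) : ℕ → (H →L[ℂ] H) → (H →L[ℂ] H) → Prop
  | 0, T, R => T = R
  | n + 1, T, R => ∃ T', IsCommutator D T T' ∧ IsIteratedCommutator D n T' R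

/-- `R = (l - D)⁻¹`. -/
def IsResolvent (D : H →ₗ.[ℂ] H) (l : ℂ) (R : H →L[ℂ] H) : Prop :=
  ∀ x y, R x = y ↔ (y, l • y - x) ∈ D.graph

/-- `y = D²x`. -/
def SqRel (D : H →ₗ.[ℂ] H) (x y : H) : Prop := ∃ w, (x, w) ∈ D.graph ∧ (w, y) ∈ D.graph

/-- `Q = |D|`: the positive self-adjoint operator with `Q² = D²`. -/
structure IsAbsoluteValue (D Q : H →ₗ.[ℂ] H) : Prop where
  selfAdjoint : IsSelfAdjoint Q
  nonneg : ∀ x : Q.domain, 0 ≤ inner ℂ (x : H) (Q x)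
  sq : ∀ x y, SqRel Q x y ↔ SqRel D x y

/-- `B = (1 + D²)^(-1/2)`: the positive bounded operator whose square is the inverse of
`1 + D²`. -/
structure IsInvSqrtOneAddSq (D : H →ₗ.[ℂ] H) (B : H →L[ℂ] H) : Prop where
  nonneg : 0 ≤ B
  sq : ∀ x y, B (B x) = y ↔ ∃ z, SqRel D y z ∧ y + z = x

/-- `(𝒜, H, D)` is a semifinite spectral triple relative to `(N, t)`, where `𝒜` is not assumed to
be unital: `a (l - D)⁻¹` is required to be compact for all `a ∈ 𝒜`.  If `1 ∈ 𝒜`, this says that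
`(l - D)⁻¹` is compact. -/
structure IsSemifiniteSpectralTriple (N : VonNeumannAlgebra H) (t : (H →L[ℂ] H) → ℝ≥0∞)
    (𝒜 : Set (H →L[ℂ] H)) (D : H →ₗ.[ℂ] H) : Prop where
  trace : IsFaithfulNormalSemifiniteTrace N t
  starAlgebra : ∃ 𝒮 : NonUnitalStarSubalgebra ℂ (H →L[ℂ] H), (𝒮 : Set (H →L[ℂ] H)) = 𝒜
  subset : 𝒜 ⊆ (N : Set (H →L[ℂ] H))
  selfAdjoint : IsSelfAdjoint D
  affiliated : IsAffiliated N D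
  commutator : ∀ a ∈ 𝒜, ∃ R ∈ N, IsCommutator D a R
  compact : ∀ l : ℂ, l.im ≠ 0 → ∃ R, IsResolvent D l R ∧ ∀ a ∈ 𝒜, a * R ∈ compacts N t

/-- There is no grading: no self-adjoint unitary of `N` that commutes with `𝒜` and anticommutes
with `D`. -/
def IsOdd (N : VonNeumannAlgebra H) (𝒜 : Set (H →L[ℂ] H)) (D : H →ₗ.[ℂ] H) : Prop :=
  ¬ ∃ Γ ∈ N, star Γ = Γ ∧ Γ * Γ = 1 ∧ (∀ a ∈ 𝒜, a * Γ = Γ * a) ∧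
    ∀ x y, (x, y) ∈ D.graph → (Γ x, -Γ y) ∈ D.graph

/-- `QC^k` for all `k ≥ 1`: with `δ = [Q, ·]`, `Q = |D|`, all `a` and `[D, a]`, `a ∈ 𝒜`, are in the
domain of `δ^k`. -/
def IsQCInfty (𝒜 : Set (H →L[ℂ] H)) (D Q : H →ₗ.[ℂ] H) : Prop :=
  ∀ k : ℕ, 1 ≤ k → ∀ a ∈ 𝒜, (∃ R, IsIteratedCommutator Q k a R) ∧
    ∃ da, IsCommutator D a da ∧ ∃ R, IsIteratedCommutator Q k da R

/-- `‖δⁿ(T)‖ ≤ ε` and `‖δⁿ([D, T])‖ ≤ ε`, where `δ = [Q, ·]`, `Q = |D|`. -/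
def DeltaBound (D Q : H →ₗ.[ℂ] H) (n : ℕ) (ε : ℝ) (T : H →L[ℂ] H) : Prop :=
  (∃ R, IsIteratedCommutator Q n T R ∧ ‖R‖ ≤ ε) ∧
    ∃ dT, IsCommutator D T dT ∧ ∃ R, IsIteratedCommutator Q n dT R ∧ ‖R‖ ≤ ε

/-- Cauchy sequences for the `δ`-topology, given by the seminorms `‖δⁿ(T)‖`, `‖δⁿ([D, T])‖`. -/
def DeltaCauchy (D Q : H →ₗ.[ℂ] H) (a : ℕ → H →L[ℂ] H) : Prop :=
  ∀ n : ℕ, ∀ ε > 0, ∃ M : ℕ, ∀ i ≥ M, ∀ j ≥ M, DeltaBound D Q n ε (a i - a j)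

/-- Convergence in the `δ`-topology. -/
def DeltaTendsto (D Q : H →ₗ.[ℂ] H) (a : ℕ → H →L[ℂ] H) (b : H →L[ℂ] H) : Prop :=
  ∀ n : ℕ, ∀ ε > 0, ∃ M : ℕ, ∀ i ≥ M, DeltaBound D Q n ε (a i - b)

/-- The algebra `Ω_D(𝒜)` generated by `𝒜` and `[D, 𝒜]`. -/
def Omega (𝒜 : Set (H →L[ℂ] H)) (D : H →ₗ.[ℂ] H) : NonUnitalSubalgebra ℂ (H →L[ℂ] H) :=
  NonUnitalAlgebra.adjoin ℂ (𝒜 ∪ {R | ∃ a ∈ 𝒜, IsCommutator D a R})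

/-- `(𝒜, H, D)` is local with respect to `𝒜c`: `𝒜` is complete in the `δ`-topology, `𝒜c` is a
dense ⋆-subalgebra with local units (so that `𝒜` is quasi-local), and there is an approximate unit
`(φ_n)` of `𝒜` in `𝒜c` such that `Ω_D(𝒜c)` is the union of the
`{w ∈ Ω_D(𝒜) : φ_n w = w = w φ_n}`. -/
structure IsLocal (𝒜c 𝒜 : Set (H →L[ℂ] H)) (D Q : H →ₗ.[ℂ] H) : Prop where
  complete : ∀ a : ℕ → H →L[ℂ] H, (∀ i, a i ∈ 𝒜) → DeltaCauchy D Q a →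
    ∃ b ∈ 𝒜, DeltaTendsto D Q a b
  starAlgebra : ∃ 𝒮 : NonUnitalStarSubalgebra ℂ (H →L[ℂ] H), (𝒮 : Set (H →L[ℂ] H)) = 𝒜c
  subset : 𝒜c ⊆ 𝒜
  dense : ∀ b ∈ 𝒜, ∃ a : ℕ → H →L[ℂ] H, (∀ i, a i ∈ 𝒜c) ∧ DeltaTendsto D Q a b
  localUnits : ∀ s : Finset (H →L[ℂ] H), (s : Set (H →L[ℂ] H)) ⊆ 𝒜c →
    ∃ φ ∈ 𝒜c, ∀ a ∈ s, φ * a = a ∧ a * φ = a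
  approxUnit : ∃ φ : ℕ → H →L[ℂ] H, (∀ n, φ n ∈ 𝒜c) ∧
    (∀ a ∈ 𝒜, DeltaTendsto D Q (fun n => φ n * a) a ∧ DeltaTendsto D Q (fun n => a * φ n) a) ∧
    (Omega 𝒜c D : Set (H →L[ℂ] H)) = ⋃ n, {w | w ∈ Omega 𝒜 D ∧ φ n * w = w ∧ w * φ n = w}

/-- `(1,∞)`-summability of a local spectral triple: `a (l - D)⁻¹ ∈ L^(1,∞)(N, t)` for all
`a ∈ 𝒜c` and all non-real `l`. -/
def IsOneInftySummable (N : VonNeumannAlgebra H) (t : (H →L[ℂ] H) → ℝ≥0∞)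
    (𝒜c : Set (H →L[ℂ] H)) (D : H →ₗ.[ℂ] H) : Prop :=
  ∀ l : ℂ, l.im ≠ 0 → ∃ R, IsResolvent D l R ∧ ∀ a ∈ 𝒜c, a * R ∈ dixmierIdeal N t

end SpectralTriples

/-! ### The gauge spectral triple -/

section GaugeTriple

variable {V : Type u} [Quiver.{u + 1} V]

/-- `S_μ`, with `S_v = p_v` for a path of length `0`. -/
def pathS {a : V} : ∀ {b : V}, Quiver.Path a b → GraphCStar V
  | _, .nil => P a
  | _, .cons μ e => pathS μ * S e

theorem pathS_mem_core {a b : V} (μ : Quiver.Path a b) : pathS μ ∈ core V := by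
  induction μ with
  | nil => exact P_mem_core a
  | cons μ e ih => exact mul_mem ih (S_mem_core e)

/-- `|v|_k`: the number of paths of length `k` with range `v`. -/
def pathCount (v : V) (k : ℕ) : ℕ := Nat.card {q : Σ a : V, Quiver.Path a v // q.2.length = k}

variable (τ : GaugeTrace V)

/-- The vertex projection `p_v`, acting on `H`. -/
def repP (v : V) : L2 τ →L[ℂ] L2 τ := rep τ ⟨P v, P_mem_core v⟩

/-- The rank one operator `Θ_{x,y} z = x (y|z)_R = x Φ(y⋆z)`, for `x, y ∈ X_c`, acting on `H`; the
expectation `Φ` acts on `H` as the projection `Φ_0` onto the gauge invariant vectors. -/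
def rankOne (x y : core V) : L2 τ →L[ℂ] L2 τ := rep τ x * Phi τ 0 * rep τ (star y)

/-- The von Neumann algebra `N`: the double commutant of the finite rank endomorphisms of `X_c`,
that is, of the linear span of the `Θ_{x,y}`. -/
def gaugeN : VonNeumannAlgebra (L2 τ) where
  toStarSubalgebra := StarSubalgebra.centralizer ℂ (StarSubalgebra.centralizer ℂ
    (Submodule.span ℂ {T | ∃ x y : core V, T = rankOne τ x y} : Set (L2 τ →L[ℂ] L2 τ)) :
      Set (L2 τ →L[ℂ] L2 τ))
  centralizer_centralizer' := by simp

/-- The functional `ω_μ`. -/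
def omegaPath {a b : V} (μ : Quiver.Path a b) (T : L2 τ →L[ℂ] L2 τ) : ℝ :=
  let x := vec τ (pathS μ) (pathS_mem_core μ)
  let y := vec τ (star (pathS μ)) (star_mem (pathS_mem_core μ))
  if μ.length = 0 then (inner ℂ x (T x)).re
  else (inner ℂ x (T x)).re + 1 / (pathCount b μ.length : ℝ) * (inner ℂ y (T y)).re

/-- `τ̃(T) = ∑_μ ω_μ(T)` for positive `T`, the sum being over all paths. -/
def tildeTrace (T : L2 τ →L[ℂ] L2 τ) : ℝ≥0∞ :=
  ∑' μ : (Σ a b : V, Quiver.Path a b), ENNReal.ofReal (omegaPath τ μ.2.2 T)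

/-- The algebra `𝒜`: the completion of `A_c` in the `δ`-topology, realised as the set of the
operator norm limits of the `δ`-Cauchy sequences in `A_c`. -/
def smoothAlgebra : Set (L2 τ →L[ℂ] L2 τ) :=
  {T | ∃ a : ℕ → core V, DeltaCauchy (dirac τ) (absDirac τ) (fun i => rep τ (a i)) ∧
    Filter.Tendsto (fun i => rep τ (a i)) Filter.atTop (nhds T)}

/-- The elements of `𝒜` that are supported on finitely many vertices. -/
def finitelySupported : Set (L2 τ →L[ℂ] L2 τ) :=
  {T | T ∈ smoothAlgebra τ ∧
    ∃ F : Finset V, (∑ v ∈ F, repP τ v) * T = T ∧ T * (∑ v ∈ F, repP τ v) = T}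

end GaugeTriple

end GraphAlg

end

/-! The gauge action splits the Hilbert space into orthogonal degrees, with `S_α S_β⋆` in degree
`|α| - |β|`, and `D` and `|D|` are diagonal for this grading. A commutator with a diagonal operator
multiplies the `(k, j)` matrix entry by `f k - f j` (`IsDiagonal.isCommutator_iff`), so unbounded
commutators become scalar identities. An element of degree `m` shifts degrees by `m`, and `||j + m|
- |j|| ≤ |m|`; hence the core is smooth, and the estimates pass to its `δ`-completion.

The trace is a sum of vector states at a frame: the `S_μ`, and the `S_μ⋆` scaled by the square root
of `1 / |r(μ)|_{|μ|}`. Two facts make it tracial. With `L_i = ξ_i Φ_0`, the operators `L_i L_i⋆` sum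
to `1` (`frame_parseval`), which needs incoming paths of every length at every vertex. And `‖L_j⋆ T
ξ_i‖ = ‖L_i⋆ T⋆ ξ_j‖` for `T ∈ N` (`dual_le`), because right multiplication by degree `0` elements
commutes with `N` and `x ↦ x⋆` is isometric for a trace. Thus `t(A⋆A)` is a double sum symmetric
under `A ↔ A⋆`.

The projection `p_v Φ_k` has trace at most `τ(p_v)`. For `k < 0` there is equality, the weights
being an average over the paths of length `-k` into `v`. For `k ≥ 0` its trace is the sum of
`τ(p_{r(μ)})` over the paths of length `k` out of `v`; the Cuntz-Krieger relation preserves this sum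
from one length to the next unless a sink is met. Since about `2n` degrees satisfy `|k| < n`, an
operator of size `1 / (1 + |k|)` with finite vertex support has singular values `O(1 / r)`. Without
sinks downstream of `v`, those of `p_v (1 + D²)^(-1/2)` are asymptotic to `2 τ(p_v) / r`; their
integral, divided by the logarithm, then tends to `2 τ(p_v)`. The lower bound comes from comparison
of projections (`le_one_sub`).

Trace class fails already in negative degrees. Elements of `𝒜` commute with right multiplication, so
`‖a S_μ⋆‖ = ‖a p_v‖` when `r(μ) = v`, and the diagonal of `a⋆ a (1 + D²)^(-1/2)` dominates a
multiple of the harmonic series. A trace class operator would make this sum finite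
(`sum_norm_inner_le`).

The delicate algebraic point is that `[D, a]` again lies in `𝒜`: the seminorms contain one
commutator with `D`, and a second one is needed. Far down in negative degrees `|D| = -D`, so
commutators with `|D|` see the exact factor `(-m)^n` on the component of degree `m`; without sources
the norm of a homogeneous element is already attained there. Components therefore decay rapidly
(`pow_mul_norm_component_le`), which controls `[D, [D, a]]`. Consequently `Ω(𝒜) = 𝒜`, and locality
reduces to cutting by the degree `0` projections `p_F`. -/

noncomputable section

set_option linter.unusedSectionVars false

namespace GraphAlg

/-! ### Graded Hilbert spaces -/

section Grading

variable {H : Type*} [NormedAddCommGroup H] [InnerProductSpace ℂ H] [CompleteSpace H]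

/-- A family of mutually orthogonal projections with sum `1`. -/
structure IsGrading (Φ : ℤ → H →L[ℂ] H) : Prop where
  proj : ∀ k, IsStarProjection (Φ k)
  orth : ∀ j k, j ≠ k → Φ j * Φ k = 0
  hasSum : ∀ x, HasSum (fun k => Φ k x) x

namespace IsGrading

variable {Φ : ℤ → H →L[ℂ] H}

theorem apply_self (hΦ : IsGrading Φ) (k : ℤ) (x : H) : Φ k (Φ k x) = Φ k x :=
  congrArg (fun T : H →L[ℂ] H => T x) (hΦ.proj k).isIdempotentElem

theorem apply_ne (hΦ : IsGrading Φ) {j k : ℤ} (h : j ≠ k) (x : H) : Φ j (Φ k x) = 0 :=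
  congrArg (fun T : H →L[ℂ] H => T x) (hΦ.orth j k h)

theorem inner_comm (hΦ : IsGrading Φ) (k : ℤ) (x y : H) : inner ℂ (Φ k x) y = inner ℂ x (Φ k y) :=
  (hΦ.proj k).isSelfAdjoint.isSymmetric x y

theorem ext_apply (hΦ : IsGrading Φ) {x y : H} (h : ∀ k, Φ k x = Φ k y) : x = y := by
  have h1 := hΦ.hasSum x
  rw [funext h] at h1
  exact h1.unique (hΦ.hasSum y)

/-- This reduces operator identities, in particular uniqueness of commutators, to matrix entries
between fixed degrees. -/
theorem ext_op (hΦ : IsGrading Φ) {A B : H →L[ℂ] H} (h : ∀ k j, Φ k * A * Φ j = Φ k * B * Φ j) :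
    A = B := by
  ext x
  have h1 := (hΦ.hasSum x).mapL A
  have h2 := (hΦ.hasSum x).mapL B
  have h3 : (fun k => A (Φ k x)) = fun k => B (Φ k x) := by
    funext j
    exact hΦ.ext_apply fun k => congrArg (fun T : H →L[ℂ] H => T x) (h k j)
  rw [h3] at h1
  exact h1.unique h2

theorem inner_self_apply (hΦ : IsGrading Φ) (k : ℤ) (x : H) : inner ℂ x (Φ k x) = ((‖Φ k x‖ ^ 2 :
    ℝ) : ℂ) := by
  rw [← hΦ.apply_self k x, ← hΦ.inner_comm, hΦ.apply_self, inner_self_eq_norm_sq_to_K]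
  norm_cast

theorem hasSum_norm_sq (hΦ : IsGrading Φ) (x : H) : HasSum (fun k => ‖Φ k x‖ ^ 2) (‖x‖ ^ 2) := by
  have h := (hΦ.hasSum x).mapL (innerSL ℂ x)
  simp only [innerSL_apply_apply, hΦ.inner_self_apply, inner_self_eq_norm_sq_to_K] at h
  refine Complex.hasSum_ofReal.1 ?_
  rw [Complex.ofReal_pow]
  exact h

theorem norm_apply_le (hΦ : IsGrading Φ) (k : ℤ) (x : H) : ‖Φ k x‖ ≤ ‖x‖ := by
  rw [← sq_le_sq₀ (norm_nonneg _) (norm_nonneg _)]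
  exact le_hasSum (hΦ.hasSum_norm_sq x) k fun j _ => by positivity

theorem norm_le_of_forall (hΦ : IsGrading Φ) {x y : H} {C : ℝ} (hC : 0 ≤ C) (h : ∀ k, ‖Φ k y‖ ≤ C
    * ‖Φ k x‖) :
    ‖y‖ ≤ C * ‖x‖ := by
  rw [← sq_le_sq₀ (norm_nonneg _) (by positivity), mul_pow]
  refine hasSum_le (fun k => ?_) (hΦ.hasSum_norm_sq y) ((hΦ.hasSum_norm_sq x).mul_left (C ^ 2))
  rw [← mul_pow]
  exact pow_le_pow_left₀ (norm_nonneg _) (h k) 2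

theorem orthogonalFamily (hΦ : IsGrading Φ) : OrthogonalFamily ℂ (fun k => LinearMap.range (Φ k :
    H →ₗ[ℂ] H))
    fun k => (LinearMap.range (Φ k : H →ₗ[ℂ] H)).subtypeₗᵢ := by
  rintro j k hjk ⟨_, x, rfl⟩ ⟨_, y, rfl⟩
  change inner ℂ (Φ j x) (Φ k y) = 0
  rw [hΦ.inner_comm, hΦ.apply_ne hjk, inner_zero_right]

theorem summable_of_norm_sq (hΦ : IsGrading Φ) {g : ℤ → H} (hg : ∀ k, Φ k (g k) = g k)
    (h : Summable fun k => ‖g k‖ ^ 2) : Summable g :=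
  (hΦ.orthogonalFamily.summable_iff_norm_sq_summable fun k => ⟨g k, g k, hg k⟩).2 h

theorem apply_tsum (hΦ : IsGrading Φ) {g : ℤ → H} (hg : ∀ k, Φ k (g k) = g k) (h : Summable g) (k
    : ℤ) :
    Φ k (∑' j, g j) = g k := by
  rw [(Φ k).map_tsum h, tsum_eq_single k fun j hj => ?_, hg]
  rw [← hg j, hΦ.apply_ne hj.symm]

theorem summable_diag (hΦ : IsGrading Φ) {f : ℤ → ℂ} {C : ℝ} (hf : ∀ k, ‖f k‖ ≤ C) (x : H) :
    Summable fun k => f k • Φ k x := by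
  refine hΦ.summable_of_norm_sq (fun k => by rw [map_smul, hΦ.apply_self]) ?_
  refine Summable.of_nonneg_of_le (fun k => by positivity) (fun k => ?_)
    ((hΦ.hasSum_norm_sq x).summable.mul_left (C ^ 2))
  rw [norm_smul, mul_pow]
  gcongr
  exact hf k

theorem exists_diag (hΦ : IsGrading Φ) (f : ℤ → ℂ) (C : ℝ) (hf : ∀ k, ‖f k‖ ≤ C) :
    ∃ T : H →L[ℂ] H, (∀ k x, Φ k (T x) = f k • Φ k x) ∧ ‖T‖ ≤ C := by
  have hC : 0 ≤ C := (norm_nonneg _).trans (hf 0)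
  have hp : ∀ x k, Φ k (∑' j, f j • Φ j x) = f k • Φ k x := fun x k =>
    hΦ.apply_tsum (fun k => by rw [map_smul, hΦ.apply_self]) (hΦ.summable_diag hf x) k
  refine ⟨LinearMap.mkContinuous
    { toFun := fun x => ∑' k, f k • Φ k x
      map_add' := fun x y => hΦ.ext_apply fun k => by rw [map_add, hp, hp, hp, map_add, smul_add]
      map_smul' := fun c x => hΦ.ext_apply fun k => by
        rw [RingHom.id_apply, map_smul, hp, hp, map_smul, smul_comm] } C fun x => ?_,
    fun k x => hp x k, LinearMap.mkContinuous_norm_le _ hC _⟩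
  refine hΦ.norm_le_of_forall hC fun k => ?_
  change ‖Φ k (∑' j, f j • Φ j x)‖ ≤ _
  rw [hp, norm_smul]
  gcongr
  exact hf k

/-- An operator that commutes with the `Φ k` commutes with the diagonal operators. -/
theorem commute_diag (hΦ : IsGrading Φ) {f : ℤ → ℂ} {T U : H →L[ℂ] H} (hT : ∀ k x, Φ k (T x) = f
    k • Φ k x)
    (hU : ∀ k, U * Φ k = Φ k * U) : U * T = T * U := by
  have hU' : ∀ k x, Φ k (U x) = U (Φ k x) := fun k x =>
    congrArg (fun T : H →L[ℂ] H => T x) (hU k).symm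
  ext x
  refine hΦ.ext_apply fun k => ?_
  simp only [mul_apply_eq_comp, hU', hT, map_smul]

theorem diag_apply (hΦ : IsGrading Φ) {f : ℤ → ℂ} {T : H →L[ℂ] H} (hT : ∀ k x, Φ k (T x) = f k •
    Φ k x) (k : ℤ)
    (x : H) : T (Φ k x) = f k • Φ k x := by
  refine hΦ.ext_apply fun j => ?_
  rw [hT, map_smul]
  rcases eq_or_ne j k with rfl | h
  · rfl
  · rw [hΦ.apply_ne h, smul_zero, smul_zero]

theorem diag_nonneg (hΦ : IsGrading Φ) {f : ℤ → ℝ} (hf : ∀ k, 0 ≤ f k) {T : H →L[ℂ] H}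
    (hT : ∀ k x, Φ k (T x) = (f k : ℂ) • Φ k x) : 0 ≤ T := by
  have hs : ∀ x y, HasSum (fun k => (f k : ℂ) * inner ℂ (Φ k x) (Φ k y)) (inner ℂ x (T y)) := by
    intro x y
    have h := (hΦ.hasSum (T y)).mapL (innerSL ℂ x)
    simp only [innerSL_apply_apply, hT, inner_smul_right] at h
    refine h.congr_fun fun k => ?_
    rw [hΦ.inner_comm, hΦ.apply_self]
  rw [ContinuousLinearMap.nonneg_iff_isPositive, ContinuousLinearMap.isPositive_def]
  refine ⟨fun x y => ?_, fun x => ?_⟩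
  · change inner ℂ (T x) y = inner ℂ x (T y)
    have h := (hs y x).map (starRingEnd ℂ) Complex.continuous_conj
    rw [inner_conj_symm] at h
    refine h.unique ?_
    convert hs x y using 2 with k
    simp
  · have h := hs x x
    rw [ContinuousLinearMap.reApplyInnerSelf_apply, ← inner_conj_symm]
    have h1 := Complex.hasSum_re h
    simp only [inner_self_eq_norm_sq_to_K] at h1
    change 0 ≤ (starRingEnd ℂ (inner ℂ x (T x))).re
    rw [Complex.conj_re]
    refine h1.nonneg fun k => ?_
    have : (f k : ℂ) * ((‖Φ k x‖ : ℝ) : ℂ) ^ 2 = ((f k * ‖Φ k x‖ ^ 2 : ℝ) : ℂ) := by push_cast; rfl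
    rw [show ((f k : ℂ) * (RCLike.ofReal ‖Φ k x‖ : ℂ) ^ 2) = ((f k * ‖Φ k x‖ ^ 2 : ℝ) : ℂ) from this,
      Complex.ofReal_re]
    exact mul_nonneg (hf k) (by positivity)

/-- Totality of the ranges implies that the projections sum up to `1`. -/
theorem of_dense (proj : ∀ k, IsStarProjection (Φ k)) (orth : ∀ j k, j ≠ k → Φ j * Φ k = 0)
    (hd : Dense (Submodule.span ℂ {x | ∃ k, Φ k x = x} : Set H)) : IsGrading Φ := by
  refine ⟨proj, orth, fun x => ?_⟩
  have hself : ∀ k x, Φ k (Φ k x) = Φ k x := fun k x =>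
    congrArg (fun T : H →L[ℂ] H => T x) (proj k).isIdempotentElem
  have hne : ∀ j k x, j ≠ k → Φ j (Φ k x) = 0 := fun j k x h =>
    congrArg (fun T : H →L[ℂ] H => T x) (orth j k h)
  -- Partial sums are projections, hence contractions. This uniform bound carries convergence from
  -- the dense span to all vectors by an `ε/3` argument.
  have hs : ∀ s : Finset ℤ, IsStarProjection (∑ k ∈ s, Φ k) := by
    intro s
    refine ⟨?_, isSelfAdjoint_sum _ fun k _ => (proj k).isSelfAdjoint⟩
    rw [IsIdempotentElem, Finset.sum_mul]
    refine Finset.sum_congr rfl fun j hj => ?_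
    rw [Finset.mul_sum, Finset.sum_eq_single j (fun k _ hk => orth j k hk.symm)
      fun h => absurd hj h]
    exact (proj j).isIdempotentElem
  have hlin : ∀ y ∈ Submodule.span ℂ {x | ∃ k, Φ k x = x}, HasSum (fun k => Φ k y) y := by
    intro y hy
    induction hy using Submodule.span_induction with
    | mem y hy =>
      obtain ⟨k, hk⟩ := hy
      have h := hasSum_single (f := fun j => Φ j y) k fun j hj => by rw [← hk, hne j k y hj]
      rwa [hk] at h
    | zero => simp [hasSum_zero]
    | add y z _ _ h1 h2 => simpa using h1.add h2
    | smul c y _ h => simpa using h.const_smul c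
  rw [HasSum, Metric.tendsto_nhds]
  intro ε hε
  obtain ⟨y, hy, hxy⟩ := Metric.mem_closure_iff.1 (hd x) (ε / 3) (by positivity)
  have h1 := Metric.tendsto_nhds.1 (hlin y hy) (ε / 3) (by positivity)
  filter_upwards [h1] with s h
  have h2 : ‖(∑ k ∈ s, Φ k) (x - y)‖ ≤ ‖x - y‖ := by
    refine (ContinuousLinearMap.le_opNorm _ _).trans ?_
    nlinarith [norm_proj_le_one (hs s), norm_nonneg (x - y)]
  rw [map_sub, sum_apply, sum_apply] at h2
  rw [dist_eq_norm] at *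
  have h3 : ∑ k ∈ s, Φ k x - x = (∑ k ∈ s, Φ k x - ∑ k ∈ s, Φ k y) + (∑ k ∈ s, Φ k y - y)
    - (x - y) := by abel
  rw [h3]
  refine (norm_sub_le _ _).trans_lt ((add_le_add_left (norm_add_le _ _) _).trans_lt ?_)
  linarith

end IsGrading

/-- `D = ∑_k f(k) Φ_k`. -/
def IsDiagonal (Φ : ℤ → H →L[ℂ] H) (f : ℤ → ℝ) (D : H →ₗ.[ℂ] H) : Prop :=
  ∀ x y, (x, y) ∈ D.graph ↔ ∀ k, Φ k y = (f k : ℂ) • Φ k x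

/-! ### Unbounded diagonal operators: self-adjointness, squares, resolvents, commutators. -/

namespace IsDiagonal

variable {Φ : ℤ → H →L[ℂ] H} {f : ℤ → ℝ} {D : H →ₗ.[ℂ] H}

theorem mem_graph_apply (hΦ : IsGrading Φ) (hD : IsDiagonal Φ f D) (k : ℤ) (x : H) : (Φ k x, (f k
    : ℂ) • Φ k x) ∈ D.graph := by
  rw [hD]
  intro j
  rw [map_smul]
  rcases eq_or_ne j k with rfl | h
  · rfl
  · rw [hΦ.apply_ne h, smul_zero, smul_zero]

theorem dense_domain (hΦ : IsGrading Φ) (hD : IsDiagonal Φ f D) : Dense (D.domain : Set H) := by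
  intro x
  refine mem_closure_of_tendsto (hΦ.hasSum x) (Filter.Eventually.of_forall fun s => ?_)
  exact sum_mem fun k _ => LinearPMap.mem_domain_of_mem_graph (mem_graph_apply hΦ hD k x)

theorem inner_eq (hΦ : IsGrading Φ) (hD : IsDiagonal Φ f D) {x y x' y' : H} (h : (x, y) ∈
    D.graph) (h' : (x', y') ∈ D.graph) :
    inner ℂ y x' = inner ℂ x y' := by
  rw [hD] at h h'
  have h1 := (hΦ.hasSum x').mapL (innerSL ℂ y)
  have h2 := (hΦ.hasSum y').mapL (innerSL ℂ x)
  simp only [innerSL_apply_apply] at h1 h2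
  refine h1.unique ?_
  convert h2 using 2 with k
  rw [h', ← hΦ.apply_self, ← hΦ.inner_comm, h, inner_smul_left, inner_smul_right,
    Complex.conj_ofReal, hΦ.inner_comm, hΦ.apply_self]

/-- The pairs `(Φ_k z, f_k Φ_k z)` lie in the graph. Testing a pair of the adjoint graph against
them reads off its components, and membership in the graph of `D` is a condition on components only.
-/
theorem isSelfAdjoint (hΦ : IsGrading Φ) (hD : IsDiagonal Φ f D) : IsSelfAdjoint D := by
  have hd := dense_domain hΦ hD
  rw [LinearPMap.isSelfAdjoint_def]
  refine LinearPMap.eq_of_eq_graph ?_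
  rw [LinearPMap.adjoint_graph_eq_graph_adjoint hd]
  ext ⟨x, y⟩
  rw [Submodule.mem_adjoint_iff]
  constructor
  · intro h
    rw [hD]
    intro k
    refine ext_inner_left ℂ fun z => ?_
    have := h _ _ (mem_graph_apply hΦ hD k z)
    simp only [sub_eq_zero] at this
    rw [← hΦ.inner_comm, ← this, inner_smul_left, inner_smul_right, Complex.conj_ofReal,
      hΦ.inner_comm]
  · intro h a b hab
    rw [sub_eq_zero]
    exact inner_eq hΦ hD hab h

theorem inner_nonneg (hΦ : IsGrading Φ) (hD : IsDiagonal Φ f D) (hf : ∀ k, 0 ≤ f k) (x :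
    D.domain) : 0 ≤ inner ℂ (x : H) (D x) := by
  have h := (hD _ _).1 (D.mem_graph x)
  have h1 := (hΦ.hasSum (D x)).mapL (innerSL ℂ (x : H))
  simp only [innerSL_apply_apply, h, inner_smul_right, hΦ.inner_self_apply] at h1
  refine h1.nonneg fun k => ?_
  rw [← Complex.ofReal_mul, Complex.zero_le_real]
  exact mul_nonneg (hf k) (by positivity)

/-- The intermediate vector `D x` must be recovered from `y = D² x` by a bounded operator: divide
component `k` by `f k`. The gap hypothesis bounds this by `1`; where `f k = 0` the convention `0⁻¹ =
0` gives the right value, as that component of `y` vanishes. -/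
theorem sqRel_iff (hΦ : IsGrading Φ) (hD : IsDiagonal Φ f D) (hf : ∀ k, f k ≠ 0 → 1 ≤ |f k|) (x y
    : H) :
    SqRel D x y ↔ ∀ k, Φ k y = ((f k ^ 2 : ℝ) : ℂ) • Φ k x := by
  constructor
  · rintro ⟨w, h1, h2⟩ k
    rw [(hD _ _).1 h2, (hD _ _).1 h1, smul_smul, sq, Complex.ofReal_mul]
  · intro h
    obtain ⟨T, hT, -⟩ := hΦ.exists_diag (fun k => ((f k)⁻¹ : ℝ)) 1 fun k => by
      rcases eq_or_ne (f k) 0 with h0 | h0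
      · simp [h0]
      · rw [Complex.norm_real, norm_inv, Real.norm_eq_abs]
        exact inv_le_one_of_one_le₀ (hf k h0)
    refine ⟨T y, (hD _ _).2 fun k => ?_, (hD _ _).2 fun k => ?_⟩
    · rw [hT, h, smul_smul, ← Complex.ofReal_mul]
      rcases eq_or_ne (f k) 0 with h0 | h0
      · simp [h0]
      · congr 2; field_simp
    · rw [hT, h, smul_smul, smul_smul, ← Complex.ofReal_mul, ← Complex.ofReal_mul]
      rcases eq_or_ne (f k) 0 with h0 | h0
      · simp [h0]
      · congr 2; field_simp

theorem isResolvent (hΦ : IsGrading Φ) (hD : IsDiagonal Φ f D) {l : ℂ} (hl : l.im ≠ 0) {R : H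
    →L[ℂ] H}
    (hR : ∀ k x, Φ k (R x) = (l - f k)⁻¹ • Φ k x) : IsResolvent D l R := by
  have hne : ∀ k, l - f k ≠ 0 := fun k h => hl (by simpa using congrArg Complex.im h)
  intro x y
  rw [hD]
  constructor
  · rintro rfl k
    rw [map_sub, map_smul, hR, smul_smul, smul_smul, sub_eq_iff_eq_add]
    have h1 : l * (l - f k)⁻¹ = f k * (l - f k)⁻¹ + 1 := by
      rw [← mul_inv_cancel₀ (hne k)]; ring
    rw [h1, add_smul, one_smul]
  · intro h
    refine hΦ.ext_apply fun k => ?_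
    have h1 := h k
    rw [map_sub, map_smul, sub_eq_iff_eq_add, ← sub_eq_iff_eq_add', ← sub_smul] at h1
    rw [hR, ← h1, smul_smul, inv_mul_cancel₀ (hne k), one_smul]

/-- No domain condition survives: the graph of `D` is described by components, so the identity
between matrix entries, summed over `j`, already shows that `T` preserves the domain. -/
theorem isCommutator_iff (hΦ : IsGrading Φ) (hD : IsDiagonal Φ f D) {T R : H →L[ℂ] H} :
    IsCommutator D T R ↔
    ∀ k j x, Φ k (R (Φ j x)) = ((f k - f j : ℝ) : ℂ) • Φ k (T (Φ j x)) := by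
  constructor
  · intro h k j x
    have h1 := (hD _ _).1 (h _ _ (mem_graph_apply hΦ hD j x)) k
    rw [map_add, map_smul, map_smul, ← eq_sub_iff_add_eq', ← sub_smul] at h1
    rw [h1, Complex.ofReal_sub]
  · intro h x y hxy
    rw [hD] at hxy ⊢
    intro k
    have h1 := (((hΦ.hasSum x).mapL R).mapL (Φ k))
    have h2 := (((hΦ.hasSum x).mapL T).mapL (Φ k)).const_smul (f k : ℂ)
    have h3 := (((hΦ.hasSum y).mapL T).mapL (Φ k))
    rw [map_add, ← eq_sub_iff_add_eq']
    refine h1.unique ?_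
    convert h2.sub h3 using 2 with j
    rw [h, hxy, map_smul, map_smul, Complex.ofReal_sub, sub_smul]

end IsDiagonal

end Grading

/-! ### Commutators with diagonal operators and the `δ`-topology -/

section Commutators

variable {H : Type*} [NormedAddCommGroup H] [InnerProductSpace ℂ H]

namespace IsCommutator

variable {D : H →ₗ.[ℂ] H} {A A' B B' : H →L[ℂ] H}

theorem add (hA : IsCommutator D A A') (hB : IsCommutator D B B') :
    IsCommutator D (A + B) (A' + B') := fun x y h => by
  have := add_mem (hA x y h) (hB x y h)
  simp only [Prod.mk_add_mk] at this
  convert this using 2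
  · rfl
  · change A y + B y + (A' x + B' x) = _
    abel

theorem smul (c : ℂ) (hA : IsCommutator D A A') : IsCommutator D (c • A) (c • A') := fun x y h => by
  have := SMulMemClass.smul_mem c (hA x y h)
  simp only [Prod.smul_mk, smul_add] at this
  exact this

theorem neg (hA : IsCommutator D A A') : IsCommutator D (-A) (-A') := by
  simpa using hA.smul (-1)

theorem sub (hA : IsCommutator D A A') (hB : IsCommutator D B B') :
    IsCommutator D (A - B) (A' - B') := by
  simpa [sub_eq_add_neg] using hA.add hB.neg

theorem mul (hA : IsCommutator D A A') (hB : IsCommutator D B B') :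
    IsCommutator D (A * B) (A * B' + A' * B) := fun x y h => by
  have := hA _ _ (hB x y h)
  convert this using 2
  · rfl
  · change A (B y) + (A (B' x) + A' (B x)) = _
    rw [map_add]
    abel

theorem zero : IsCommutator D (0 : H →L[ℂ] H) 0 := fun x y _ => by
  simp

end IsCommutator

namespace IsIteratedCommutator

variable {Q : H →ₗ.[ℂ] H}

theorem add {n : ℕ} : ∀ {A A' B B' : H →L[ℂ] H}, IsIteratedCommutator Q n A A' →
    IsIteratedCommutator Q n B B' → IsIteratedCommutator Q n (A + B) (A' + B') := by
  induction n with
  | zero => rintro A A' B B' rfl rfl; rfl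
  | succ n ih =>
    rintro A A' B B' ⟨A₁, hA, hA'⟩ ⟨B₁, hB, hB'⟩
    exact ⟨_, hA.add hB, ih hA' hB'⟩

theorem smul {n : ℕ} (c : ℂ) : ∀ {A A' : H →L[ℂ] H}, IsIteratedCommutator Q n A A' →
    IsIteratedCommutator Q n (c • A) (c • A') := by
  induction n with
  | zero => rintro A A' rfl; rfl
  | succ n ih =>
    rintro A A' ⟨A₁, hA, hA'⟩
    exact ⟨_, hA.smul c, ih hA'⟩

theorem sub {n : ℕ} {A A' B B' : H →L[ℂ] H} (hA : IsIteratedCommutator Q n A A')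
    (hB : IsIteratedCommutator Q n B B') : IsIteratedCommutator Q n (A - B) (A' - B') := by
  simpa [sub_eq_add_neg] using hA.add (hB.smul (-1))

theorem zero {n : ℕ} : IsIteratedCommutator Q n (0 : H →L[ℂ] H) 0 := by
  induction n with
  | zero => rfl
  | succ n ih => exact ⟨0, .zero, ih⟩

/-- `IsIteratedCommutator` unfolds at the innermost commutator. Limits and matrix entries are
treated by induction at the outermost one, which this lemma and the next make available. -/
theorem snoc {n : ℕ} : ∀ {A B C : H →L[ℂ] H}, IsIteratedCommutator Q n A B →
    IsCommutator Q B C → IsIteratedCommutator Q (n + 1) A C := by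
  induction n with
  | zero => rintro A B C rfl h; exact ⟨C, h, rfl⟩
  | succ n ih =>
    rintro A B C ⟨A₁, hA, hA'⟩ h
    exact ⟨A₁, hA, ih hA' h⟩

theorem exists_snoc {n : ℕ} : ∀ {A C : H →L[ℂ] H}, IsIteratedCommutator Q (n + 1) A C →
    ∃ B, IsIteratedCommutator Q n A B ∧ IsCommutator Q B C := by
  induction n with
  | zero => rintro A C ⟨A₁, hA, rfl⟩; exact ⟨A, rfl, hA⟩
  | succ n ih =>
    rintro A C ⟨A₁, hA, hA'⟩
    obtain ⟨B, hB, hC⟩ := ih hA'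
    exact ⟨B, ⟨A₁, hA, hB⟩, hC⟩

end IsIteratedCommutator

/-- `‖δⁿ(T)‖ ≤ ε`, where `δ = [Q, ·]`. -/
def IterBound (Q : H →ₗ.[ℂ] H) (n : ℕ) (ε : ℝ) (T : H →L[ℂ] H) : Prop :=
  ∃ R, IsIteratedCommutator Q n T R ∧ ‖R‖ ≤ ε

namespace IterBound

variable {Q : H →ₗ.[ℂ] H} {n : ℕ} {A B : H →L[ℂ] H} {a b : ℝ}

theorem add : IterBound Q n a A → IterBound Q n b B → IterBound Q n (a + b) (A + B) := by
  rintro ⟨R, hR, h⟩ ⟨R', hR', h'⟩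
  exact ⟨_, hR.add hR', (norm_add_le _ _).trans (add_le_add h h')⟩

theorem smul (c : ℂ) : IterBound Q n a A → IterBound Q n (‖c‖ * a) (c • A) := by
  rintro ⟨R, hR, h⟩
  exact ⟨_, hR.smul c, by rw [norm_smul]; gcongr⟩

theorem mono (h : a ≤ b) : IterBound Q n a A → IterBound Q n b A := by
  rintro ⟨R, hR, h'⟩
  exact ⟨R, hR, h'.trans h⟩

theorem zero (h : 0 ≤ a) : IterBound Q n a (0 : H →L[ℂ] H) := ⟨0, .zero, by simpa using h⟩

theorem nonneg : IterBound Q n a A → 0 ≤ a := fun ⟨_, _, h⟩ => (norm_nonneg _).trans h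

end IterBound

end Commutators

/-! ### The `δ`-topology: seminorm estimates, products, limits and completion. -/

section Delta

variable {H : Type*} [NormedAddCommGroup H] [InnerProductSpace ℂ H] [CompleteSpace H]

namespace IsDiagonal

variable {Φ : ℤ → H →L[ℂ] H} {f : ℤ → ℝ} {D : H →ₗ.[ℂ] H}

theorem isCommutator_unique (hΦ : IsGrading Φ) (hD : IsDiagonal Φ f D) {T R R' : H →L[ℂ] H}
    (h : IsCommutator D T R) (h' : IsCommutator D T R') : R = R' := by
  rw [isCommutator_iff hΦ hD] at h h'
  refine hΦ.ext_op fun k j => ?_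
  ext x
  exact (h k j x).trans (h' k j x).symm

theorem isIteratedCommutator_unique (hΦ : IsGrading Φ) (hD : IsDiagonal Φ f D) {n : ℕ} :
    ∀ {T R R' : H →L[ℂ] H}, IsIteratedCommutator D n T R → IsIteratedCommutator D n T R' →
      R = R' := by
  induction n with
  | zero => rintro T R R' rfl rfl; rfl
  | succ n ih =>
    rintro T R R' ⟨A, hA, hA'⟩ ⟨B, hB, hB'⟩
    obtain rfl := isCommutator_unique hΦ hD hA hB
    exact ih hA' hB'

theorem isCommutator_star (hΦ : IsGrading Φ) (hD : IsDiagonal Φ f D) {T R : H →L[ℂ] H}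
    (h : IsCommutator D T R) : IsCommutator D (star T) (-star R) := by
  rw [isCommutator_iff hΦ hD] at h ⊢
  intro k j x
  refine ext_inner_left ℂ fun z => ?_
  have h1 := congrArg (fun y => inner ℂ y x) (h j k z)
  simp only [inner_smul_left, Complex.conj_ofReal] at h1
  rw [inner_smul_right, ← hΦ.inner_comm, ← hΦ.inner_comm, ContinuousLinearMap.star_eq_adjoint,
    ContinuousLinearMap.star_eq_adjoint, neg_apply, inner_neg_right,
    ContinuousLinearMap.adjoint_inner_right, ContinuousLinearMap.adjoint_inner_right,
    ← hΦ.inner_comm, ← hΦ.inner_comm, h1]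
  push_cast
  ring

theorem iterBound_star (hΦ : IsGrading Φ) (hD : IsDiagonal Φ f D) {n : ℕ} {a : ℝ} :
    ∀ {T : H →L[ℂ] H}, IterBound D n a T → IterBound D n a (star T) := by
  induction n with
  | zero => rintro T ⟨R, rfl, h⟩; exact ⟨_, rfl, by rwa [norm_star]⟩
  | succ n ih =>
    rintro T ⟨R, ⟨T', hT, hT'⟩, h⟩
    obtain ⟨R', hR', h'⟩ := (ih ⟨R, hT', h⟩).smul (-1)
    rw [neg_smul, one_smul, norm_neg, norm_one, one_mul] at *
    exact ⟨R', ⟨_, isCommutator_star hΦ hD hT, hR'⟩, h'⟩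

/-- Closedness of the derivation: the relation between matrix entries is linear and passes to norm
limits entry by entry. -/
theorem isCommutator_of_tendsto (hΦ : IsGrading Φ) (hD : IsDiagonal Φ f D)
    {a r : ℕ → H →L[ℂ] H} {T R : H →L[ℂ] H} (h : ∀ i, IsCommutator D (a i) (r i))
    (ha : Filter.Tendsto a Filter.atTop (nhds T)) (hr : Filter.Tendsto r Filter.atTop (nhds R)) :
    IsCommutator D T R := by
  simp only [isCommutator_iff hΦ hD] at h ⊢
  intro k j x
  have hev : ∀ {b : ℕ → H →L[ℂ] H} {S : H →L[ℂ] H}, Filter.Tendsto b Filter.atTop (nhds S) →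
      Filter.Tendsto (fun i => Φ k (b i (Φ j x))) Filter.atTop (nhds (Φ k (S (Φ j x)))) :=
    fun {b S} hb => ((Φ k).continuous.tendsto _).comp
      (((ContinuousLinearMap.apply ℂ H (Φ j x)).continuous.tendsto S).comp hb)
  refine tendsto_nhds_unique (hev hr) ?_
  simp only [h]
  exact (hev ha).const_smul _

/-- Leibniz rule: each commutator turns a product into two, whence `2 ^ n`. All orders up to `n`
enter because the commutators distribute over the factors in every way. -/
theorem iterBound_mul (hΦ : IsGrading Φ) (hD : IsDiagonal Φ f D) {n : ℕ} {a b : ℝ} :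
    ∀ {A B : H →L[ℂ] H}, (∀ m ≤ n, IterBound D m a A) → (∀ m ≤ n, IterBound D m b B) →
      IterBound D n (2 ^ n * (a * b)) (A * B) := by
  induction n with
  | zero =>
    intro A B hA hB
    obtain ⟨_, rfl, h⟩ := hA 0 le_rfl
    obtain ⟨_, rfl, h'⟩ := hB 0 le_rfl
    refine ⟨_, rfl, (norm_mul_le _ _).trans ?_⟩
    rw [pow_zero, one_mul]
    exact mul_le_mul h h' (norm_nonneg _) ((norm_nonneg _).trans h)
  | succ n ih =>
    intro A B hA hB
    have key : ∀ {c : ℝ} {C : H →L[ℂ] H}, (∀ m ≤ n + 1, IterBound D m c C) →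
        ∃ C', IsCommutator D C C' ∧ ∀ m ≤ n, IterBound D m c C' := by
      intro c C hC
      obtain ⟨R, ⟨C', hC', -⟩, -⟩ := hC 1 (by lia)
      refine ⟨C', hC', fun m hm => ?_⟩
      obtain ⟨R, ⟨C'', hC'', hR⟩, h⟩ := hC (m + 1) (by lia)
      obtain rfl := isCommutator_unique hΦ hD hC' hC''
      exact ⟨R, hR, h⟩
    obtain ⟨A', hA', hA''⟩ := key hA
    obtain ⟨B', hB', hB''⟩ := key hB
    obtain ⟨R, hR, h⟩ := (ih (fun m hm => hA m (by lia)) hB'').add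
      (ih hA'' (fun m hm => hB m (by lia)))
    exact ⟨R, ⟨_, hA'.mul hB', hR⟩, h.trans_eq (by ring)⟩

/-- Iterated commutators of a convergent sequence converge if they form Cauchy sequences. -/
theorem exists_tendsto_iterated (hΦ : IsGrading Φ) (hD : IsDiagonal Φ f D) {a : ℕ → H →L[ℂ] H}
    {T : H →L[ℂ] H} (ha : Filter.Tendsto a Filter.atTop (nhds T)) {r : ℕ → ℕ → H →L[ℂ] H}
    (hr : ∀ n i, IsIteratedCommutator D n (a i) (r n i)) (hc : ∀ n, CauchySeq (r n)) (n : ℕ) :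
    ∃ R, IsIteratedCommutator D n T R ∧ Filter.Tendsto (r n) Filter.atTop (nhds R) := by
  induction n with
  | zero =>
    refine ⟨T, rfl, ?_⟩
    have : r 0 = a := funext fun i => (hr 0 i).symm
    rwa [this]
  | succ n ih =>
    obtain ⟨R, hR, hl⟩ := ih
    obtain ⟨S, hS⟩ := cauchySeq_tendsto_of_complete (hc (n + 1))
    refine ⟨S, hR.snoc (isCommutator_of_tendsto hΦ hD (fun i => ?_) hl hS), hS⟩
    obtain ⟨B, hB, hB'⟩ := (hr (n + 1) i).exists_snoc
    rwa [isIteratedCommutator_unique hΦ hD (hr n i) hB]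

end IsDiagonal

namespace DeltaBound

variable {D Q : H →ₗ.[ℂ] H} {n : ℕ} {A B : H →L[ℂ] H} {a b : ℝ}

theorem iff_iterBound : DeltaBound D Q n a A ↔
    IterBound Q n a A ∧ ∃ dA, IsCommutator D A dA ∧ IterBound Q n a dA := Iff.rfl

theorem add (hA : DeltaBound D Q n a A) (hB : DeltaBound D Q n b B) :
    DeltaBound D Q n (a + b) (A + B) := by
  obtain ⟨h, dA, hdA, h'⟩ := iff_iterBound.1 hA
  obtain ⟨k, dB, hdB, k'⟩ := iff_iterBound.1 hB
  exact iff_iterBound.2 ⟨h.add k, _, hdA.add hdB, h'.add k'⟩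

theorem smul (c : ℂ) (hA : DeltaBound D Q n a A) : DeltaBound D Q n (‖c‖ * a) (c • A) := by
  obtain ⟨h, dA, hdA, h'⟩ := iff_iterBound.1 hA
  exact iff_iterBound.2 ⟨h.smul c, _, hdA.smul c, h'.smul c⟩

theorem neg (hA : DeltaBound D Q n a A) : DeltaBound D Q n a (-A) := by
  simpa using hA.smul (-1)

theorem sub (hA : DeltaBound D Q n a A) (hB : DeltaBound D Q n b B) :
    DeltaBound D Q n (a + b) (A - B) := by
  simpa [sub_eq_add_neg] using hA.add hB.neg

theorem mono (h : a ≤ b) (hA : DeltaBound D Q n a A) : DeltaBound D Q n b A := by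
  obtain ⟨h1, dA, hdA, h'⟩ := iff_iterBound.1 hA
  exact iff_iterBound.2 ⟨h1.mono h, _, hdA, h'.mono h⟩

theorem zero (h : 0 ≤ a) : DeltaBound D Q n a (0 : H →L[ℂ] H) :=
  iff_iterBound.2 ⟨.zero h, 0, .zero, .zero h⟩

theorem norm_le (hA : DeltaBound D Q 0 a A) : ‖A‖ ≤ a := by
  obtain ⟨⟨_, rfl, h⟩, -⟩ := hA
  exact h

theorem nonneg (hA : DeltaBound D Q n a A) : 0 ≤ a := hA.1.elim fun _ h => (norm_nonneg _).trans h.2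

variable {Φ : ℤ → H →L[ℂ] H} {f g : ℤ → ℝ}

theorem star (hΦ : IsGrading Φ) (hD : IsDiagonal Φ f D) (hQ : IsDiagonal Φ g Q)
    (hA : DeltaBound D Q n a A) : DeltaBound D Q n a (star A) := by
  obtain ⟨h1, dA, hdA, h'⟩ := iff_iterBound.1 hA
  refine iff_iterBound.2 ⟨hQ.iterBound_star hΦ h1, _, hD.isCommutator_star hΦ hdA, ?_⟩
  simpa using (hQ.iterBound_star hΦ h').smul (-1)

/-- Compared with `iterBound_mul` there is one more factor `2`, from the two terms of `[D, A B] = A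
[D, B] + [D, A] B`. -/
theorem mul (hΦ : IsGrading Φ) (hD : IsDiagonal Φ f D) (hQ : IsDiagonal Φ g Q)
    (hA : ∀ m ≤ n, DeltaBound D Q m a A) (hB : ∀ m ≤ n, DeltaBound D Q m b B) :
    DeltaBound D Q n (2 ^ (n + 1) * (a * b)) (A * B) := by
  have key : ∀ {c : ℝ} {C : H →L[ℂ] H}, (∀ m ≤ n, DeltaBound D Q m c C) →
      ∃ C', IsCommutator D C C' ∧ ∀ m ≤ n, IterBound Q m c C' := by
    intro c C hC
    obtain ⟨-, C', hC', -⟩ := iff_iterBound.1 (hC 0 (by lia))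
    refine ⟨C', hC', fun m hm => ?_⟩
    obtain ⟨-, C'', hC'', h⟩ := iff_iterBound.1 (hC m hm)
    obtain rfl := hD.isCommutator_unique hΦ hC' hC''
    exact h
  obtain ⟨A', hA', hA''⟩ := key hA
  obtain ⟨B', hB', hB''⟩ := key hB
  have h1 : ∀ m ≤ n, IterBound Q m a A := fun m hm => (hA m hm).1
  have h2 : ∀ m ≤ n, IterBound Q m b B := fun m hm => (hB m hm).1
  have ha := (hA 0 (by lia)).nonneg
  have hb := (hB 0 (by lia)).nonneg
  refine iff_iterBound.2 ⟨(hQ.iterBound_mul hΦ h1 h2).mono ?_, _, hA'.mul hB',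
    ((hQ.iterBound_mul hΦ h1 hB'').add (hQ.iterBound_mul hΦ hA'' h2)).mono (le_of_eq (by ring))⟩
  have : 0 ≤ 2 ^ n * (a * b) := by positivity
  rw [pow_succ]; linarith

end DeltaBound

/-- All `‖δⁿ(T)‖` and `‖δⁿ([D, T])‖` are finite. -/
def IsSmooth (D Q : H →ₗ.[ℂ] H) (T : H →L[ℂ] H) : Prop := ∀ n, ∃ C, DeltaBound D Q n C T

variable {D Q : H →ₗ.[ℂ] H}

theorem IsSmooth.exists_bound {T : H →L[ℂ] H} (h : IsSmooth D Q T) (n : ℕ) :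
    ∃ C, 1 ≤ C ∧ ∀ m ≤ n, DeltaBound D Q m C T := by
  choose c hc using h
  refine ⟨1 + ∑ m ∈ Finset.range (n + 1), c m, ?_, fun m hm => (hc m).mono ?_⟩
  · have := Finset.sum_nonneg fun m (_ : m ∈ Finset.range (n + 1)) => (hc m).nonneg
    linarith
  · have := Finset.single_le_sum (fun m _ => (hc m).nonneg) (Finset.mem_range.2 (by lia : m < n + 1))
    linarith

theorem IsSmooth.exists_iterated {T : H →L[ℂ] H} (h : IsSmooth D Q T) (n : ℕ) :
    ∃ R, IsIteratedCommutator Q n T R :=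
  (h n).elim fun _ hC => hC.1.imp fun _ h => h.1

theorem DeltaTendsto.tendsto {a : ℕ → H →L[ℂ] H} {T : H →L[ℂ] H} (h : DeltaTendsto D Q a T) :
    Filter.Tendsto a Filter.atTop (nhds T) := by
  rw [Metric.tendsto_atTop]
  intro ε hε
  obtain ⟨M, hM⟩ := h 0 (ε / 2) (by positivity)
  refine ⟨M, fun i hi => ?_⟩
  rw [dist_eq_norm]
  exact (hM i hi).norm_le.trans_lt (by linarith)

theorem DeltaTendsto.cauchy {a : ℕ → H →L[ℂ] H} {T : H →L[ℂ] H} (h : DeltaTendsto D Q a T) :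
    DeltaCauchy D Q a := by
  intro n ε hε
  obtain ⟨M, hM⟩ := h n (ε / 2) (by positivity)
  refine ⟨M, fun i hi j hj => ?_⟩
  have := ((hM i hi).sub (hM j hj)).mono (le_of_eq (add_halves ε))
  rwa [sub_sub_sub_cancel_right] at this

theorem DeltaTendsto.isSmooth {a : ℕ → H →L[ℂ] H} {T : H →L[ℂ] H} (h : DeltaTendsto D Q a T)
    (ha : ∀ i, IsSmooth D Q (a i)) : IsSmooth D Q T := by
  intro n
  obtain ⟨M, hM⟩ := h n 1 one_pos
  obtain ⟨C, hC⟩ := ha M n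
  exact ⟨_, by simpa using hC.sub (hM M le_rfl)⟩

/-- A continuity criterion: order `n` of the image may depend on several orders of the argument, as
it does for products. -/
theorem DeltaTendsto.of_mul_bound {a b : ℕ → H →L[ℂ] H} {T S : H →L[ℂ] H}
    (h : ∀ n, ∃ K : ℝ, ∃ m, ∀ ε > 0, ε ≤ 1 → ∀ i, (∀ k ≤ m, DeltaBound D Q k ε (a i - T)) →
      DeltaBound D Q n (K * ε) (b i - S)) (ha : DeltaTendsto D Q a T) : DeltaTendsto D Q b S := by
  intro n ε hε
  obtain ⟨K, m, hK⟩ := h n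
  -- Small enough that `K η ≤ ε`; the `+ 1` avoids division by zero when `K = 0`.
  set η := min 1 (ε / (|K| + 1)) with hη
  have hη0 : 0 < η := by positivity
  choose M hM using fun k => ha k η hη0
  refine ⟨∑ k ∈ Finset.range (m + 1), M k, fun i hi => ?_⟩
  refine (hK η hη0 (min_le_left _ _) i fun k hk => hM k i ?_).mono ?_
  · exact (Finset.single_le_sum (fun _ _ => Nat.zero_le _)
      (Finset.mem_range.2 (by lia : k < m + 1))).trans hi
  · have h1 : η ≤ ε / (|K| + 1) := min_le_right _ _
    rw [le_div_iff₀ (by positivity)] at h1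
    nlinarith [le_abs_self K]

variable {Φ : ℤ → H →L[ℂ] H} {f g : ℤ → ℝ}

/-- A `δ`-Cauchy sequence that converges in norm is `δ`-convergent. -/
theorem DeltaCauchy.tendsto (hΦ : IsGrading Φ) (hD : IsDiagonal Φ f D) (hQ : IsDiagonal Φ g Q)
    {a : ℕ → H →L[ℂ] H} {T : H →L[ℂ] H} (hs : ∀ i, IsSmooth D Q (a i)) (hc : DeltaCauchy D Q a)
    (ha : Filter.Tendsto a Filter.atTop (nhds T)) : DeltaTendsto D Q a T := by
  have hs' : ∀ i, ∃ da, IsCommutator D (a i) da ∧ ∀ n, ∃ R, IsIteratedCommutator Q n da R := by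
    intro i
    obtain ⟨C, -, da, hda, -⟩ := hs i 0
    refine ⟨da, hda, fun n => ?_⟩
    obtain ⟨C, -, da', hda', R, hR, -⟩ := hs i n
    obtain rfl := hD.isCommutator_unique hΦ hda hda'
    exact ⟨R, hR⟩
  choose r hr using fun n i => (hs i).exists_iterated n
  choose da hda r' hr' using hs'
  have hc' : ∀ n, ∀ ε > 0, ∃ M, ∀ i ≥ M, ∀ j ≥ M, ‖r n i - r n j‖ ≤ ε ∧ ‖r' i n - r' j n‖ ≤ ε := by
    intro n ε hε
    obtain ⟨M, hM⟩ := hc n ε hε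
    refine ⟨M, fun i hi j hj => ?_⟩
    obtain ⟨⟨R, hR, h⟩, d, hd, R', hR', h'⟩ := hM i hi j hj
    obtain rfl := hQ.isIteratedCommutator_unique hΦ hR ((hr n i).sub (hr n j))
    obtain rfl := hD.isCommutator_unique hΦ hd ((hda i).sub (hda j))
    obtain rfl := hQ.isIteratedCommutator_unique hΦ hR' ((hr' i n).sub (hr' j n))
    exact ⟨h, h'⟩
  have cau : ∀ n, CauchySeq (r n) := fun n => Metric.cauchySeq_iff.2 fun ε hε => by
    obtain ⟨M, hM⟩ := hc' n (ε / 2) (by positivity)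
    exact ⟨M, fun i hi j hj => by
      rw [dist_eq_norm]; exact (hM i hi j hj).1.trans_lt (by linarith)⟩
  have cau' : ∀ n, CauchySeq fun i => r' i n := fun n => Metric.cauchySeq_iff.2 fun ε hε => by
    obtain ⟨M, hM⟩ := hc' n (ε / 2) (by positivity)
    exact ⟨M, fun i hi j hj => by
      rw [dist_eq_norm]; exact (hM i hi j hj).2.trans_lt (by linarith)⟩
  have hda0 : ∀ i, r' i 0 = da i := fun i => (hr' i 0).symm
  obtain ⟨dT, hdT⟩ := cauchySeq_tendsto_of_complete (cau' 0)
  have hdT' : Filter.Tendsto da Filter.atTop (nhds dT) := by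
    rwa [funext hda0] at hdT
  have hcomm := hD.isCommutator_of_tendsto hΦ hda ha hdT'
  choose R hR hl using hQ.exists_tendsto_iterated hΦ ha hr cau
  choose R' hR' hl' using hQ.exists_tendsto_iterated hΦ hdT' (fun n i => hr' i n) cau'
  intro n ε hε
  obtain ⟨M, hM⟩ := hc' n ε hε
  refine ⟨M, fun i hi => ⟨⟨_, (hr n i).sub (hR n), ?_⟩, _, (hda i).sub hcomm, _,
    (hr' i n).sub (hR' n), ?_⟩⟩
  -- Fix `i` and let `j` tend to infinity in the Cauchy estimate.
  · refine le_of_tendsto ((tendsto_const_nhds.sub (hl n)).norm)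
      (Filter.eventually_atTop.2 ⟨M, fun j hj => (hM i hi j hj).1⟩)
  · refine le_of_tendsto ((tendsto_const_nhds.sub (hl' n)).norm)
      (Filter.eventually_atTop.2 ⟨M, fun j hj => (hM i hi j hj).2⟩)

theorem DeltaTendsto.star (hΦ : IsGrading Φ) (hD : IsDiagonal Φ f D) (hQ : IsDiagonal Φ g Q)
    {a : ℕ → H →L[ℂ] H} {T : H →L[ℂ] H} (h : DeltaTendsto D Q a T) :
    DeltaTendsto D Q (fun i => star (a i)) (star T) := by
  intro n ε hε
  obtain ⟨M, hM⟩ := h n ε hε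
  exact ⟨M, fun i hi => by simpa using (hM i hi).star hΦ hD hQ⟩

theorem DeltaTendsto.add {a b : ℕ → H →L[ℂ] H} {T S : H →L[ℂ] H} (h : DeltaTendsto D Q a T)
    (h' : DeltaTendsto D Q b S) : DeltaTendsto D Q (fun i => a i + b i) (T + S) := by
  intro n ε hε
  obtain ⟨M, hM⟩ := h n (ε / 2) (by positivity)
  obtain ⟨M', hM'⟩ := h' n (ε / 2) (by positivity)
  refine ⟨M + M', fun i hi => ?_⟩
  have := ((hM i (by lia)).add (hM' i (by lia))).mono (le_of_eq (add_halves ε))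
  rwa [sub_add_sub_comm] at this

theorem DeltaTendsto.smul (c : ℂ) {a : ℕ → H →L[ℂ] H} {T : H →L[ℂ] H} (h : DeltaTendsto D Q a T) :
    DeltaTendsto D Q (fun i => c • a i) (c • T) :=
  h.of_mul_bound fun n => ⟨‖c‖, n, fun ε _ _ i hi => by
    rw [← smul_sub]; exact (hi n le_rfl).smul c⟩

theorem DeltaTendsto.mul_const (hΦ : IsGrading Φ) (hD : IsDiagonal Φ f D) (hQ : IsDiagonal Φ g Q)
    {a : ℕ → H →L[ℂ] H} {T S : H →L[ℂ] H} (h : DeltaTendsto D Q a T) (hS : IsSmooth D Q S) :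
    DeltaTendsto D Q (fun i => a i * S) (T * S) := by
  refine h.of_mul_bound fun n => ?_
  obtain ⟨C, -, hC⟩ := hS.exists_bound n
  refine ⟨2 ^ (n + 1) * C, n, fun ε _ _ i hi => ?_⟩
  rw [← sub_mul]
  exact (DeltaBound.mul hΦ hD hQ hi hC).mono (le_of_eq (by ring))

theorem DeltaTendsto.const_mul (hΦ : IsGrading Φ) (hD : IsDiagonal Φ f D) (hQ : IsDiagonal Φ g Q)
    {a : ℕ → H →L[ℂ] H} {T S : H →L[ℂ] H} (h : DeltaTendsto D Q a T) (hS : IsSmooth D Q S) :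
    DeltaTendsto D Q (fun i => S * a i) (S * T) := by
  refine h.of_mul_bound fun n => ?_
  obtain ⟨C, -, hC⟩ := hS.exists_bound n
  refine ⟨2 ^ (n + 1) * C, n, fun ε _ _ i hi => ?_⟩
  rw [← mul_sub]
  exact (DeltaBound.mul hΦ hD hQ hC hi).mono (le_of_eq (by ring))

variable (D Q) in
/-- The completion of a set of operators in the `δ`-topology, realised by operators. -/
def deltaClosure (𝒞 : Set (H →L[ℂ] H)) : Set (H →L[ℂ] H) :=
  {T | ∃ a : ℕ → H →L[ℂ] H, (∀ i, a i ∈ 𝒞) ∧ DeltaTendsto D Q a T}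

variable {𝒞 : Set (H →L[ℂ] H)}

theorem deltaClosure.isSmooth (h𝒞 : ∀ c ∈ 𝒞, IsSmooth D Q c) {T : H →L[ℂ] H}
    (hT : T ∈ deltaClosure D Q 𝒞) : IsSmooth D Q T := by
  obtain ⟨a, ha, h⟩ := hT
  exact h.isSmooth fun i => h𝒞 _ (ha i)

theorem deltaClosure.exists_approx {T : H →L[ℂ] H} (hT : T ∈ deltaClosure D Q 𝒞) (n : ℕ) {ε : ℝ}
    (hε : 0 < ε) : ∃ c ∈ 𝒞, ∀ m ≤ n, DeltaBound D Q m ε (c - T) := by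
  obtain ⟨a, ha, h⟩ := hT
  choose M hM using fun m => h m ε hε
  exact ⟨a (∑ m ∈ Finset.range (n + 1), M m), ha _, fun m hm => hM m _
    (Finset.single_le_sum (fun _ _ => Nat.zero_le _) (Finset.mem_range.2 (by lia : m < n + 1)))⟩

/-- There are only countably many seminorms, so one diagonal sequence, whose `n`-th term is good to
order `n` within `1 / (n + 1)`, converges in all of them. -/
theorem deltaClosure.of_approx {T : H →L[ℂ] H}
    (h : ∀ n, ∀ ε > 0, ∃ c ∈ 𝒞, ∀ m ≤ n, DeltaBound D Q m ε (c - T)) :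
    T ∈ deltaClosure D Q 𝒞 := by
  choose c hc hb using fun n : ℕ => h n (1 / ((n : ℝ) + 1)) (by positivity)
  refine ⟨c, hc, fun n ε hε => ?_⟩
  obtain ⟨M, hM⟩ := exists_nat_one_div_lt hε
  refine ⟨max M n, fun i hi => (hb i n (le_of_max_le_right hi)).mono (le_trans ?_ hM.le)⟩
  have : (M : ℝ) ≤ i := by exact_mod_cast le_of_max_le_left hi
  gcongr

theorem deltaClosure.idem {T : H →L[ℂ] H} (h : T ∈ deltaClosure D Q (deltaClosure D Q 𝒞)) :
    T ∈ deltaClosure D Q 𝒞 := by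
  refine .of_approx fun n ε hε => ?_
  obtain ⟨S, hS, hb⟩ := deltaClosure.exists_approx h n (half_pos hε)
  obtain ⟨c, hc, hb'⟩ := deltaClosure.exists_approx hS n (half_pos hε)
  refine ⟨c, hc, fun m hm => ?_⟩
  have := ((hb' m hm).add (hb m hm)).mono (le_of_eq (add_halves ε))
  rwa [sub_add_sub_cancel] at this

theorem deltaClosure.complete (hΦ : IsGrading Φ) (hD : IsDiagonal Φ f D) (hQ : IsDiagonal Φ g Q)
    (h𝒞 : ∀ c ∈ 𝒞, IsSmooth D Q c) {a : ℕ → H →L[ℂ] H} (ha : ∀ i, a i ∈ deltaClosure D Q 𝒞)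
    (hc : DeltaCauchy D Q a) : ∃ b ∈ deltaClosure D Q 𝒞, DeltaTendsto D Q a b := by
  have cau : CauchySeq a := Metric.cauchySeq_iff.2 fun ε hε => by
    obtain ⟨M, hM⟩ := hc 0 (ε / 2) (by positivity)
    exact ⟨M, fun i hi j hj => by
      rw [dist_eq_norm]; exact (hM i hi j hj).norm_le.trans_lt (by linarith)⟩
  obtain ⟨b, hb⟩ := cauchySeq_tendsto_of_complete cau
  have h := hc.tendsto hΦ hD hQ (fun i => deltaClosure.isSmooth h𝒞 (ha i)) hb
  exact ⟨b, .idem ⟨a, ha, h⟩, h⟩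

/-- Separate continuity of the product is enough: take the limit in one factor at a time and use
that the closure is idempotent. -/
theorem deltaClosure.mul_mem (hΦ : IsGrading Φ) (hD : IsDiagonal Φ f D) (hQ : IsDiagonal Φ g Q)
    (h𝒞 : ∀ c ∈ 𝒞, IsSmooth D Q c) (hm : ∀ c ∈ 𝒞, ∀ d ∈ 𝒞, c * d ∈ 𝒞) {S T : H →L[ℂ] H}
    (hS : S ∈ deltaClosure D Q 𝒞) (hT : T ∈ deltaClosure D Q 𝒞) : S * T ∈ deltaClosure D Q 𝒞 := by
  obtain ⟨a, ha, h⟩ := hS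
  refine .idem ⟨fun i => a i * T, fun i => ?_, h.mul_const hΦ hD hQ (isSmooth h𝒞 hT)⟩
  obtain ⟨b, hb, h'⟩ := hT
  exact ⟨fun j => a i * b j, fun j => hm _ (ha i) _ (hb j), h'.const_mul hΦ hD hQ (h𝒞 _ (ha i))⟩

/-- The `δ`-closure of a ⋆-algebra of smooth operators is a ⋆-algebra. -/
def deltaClosure.toStarSubalgebra (hΦ : IsGrading Φ) (hD : IsDiagonal Φ f D)
    (hQ : IsDiagonal Φ g Q) (𝒮 : NonUnitalStarSubalgebra ℂ (H →L[ℂ] H))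
    (h𝒮 : ∀ c ∈ 𝒮, IsSmooth D Q c) : NonUnitalStarSubalgebra ℂ (H →L[ℂ] H) where
  carrier := deltaClosure D Q (𝒮 : Set (H →L[ℂ] H))
  add_mem' := fun ⟨a, ha, h⟩ ⟨b, hb, h'⟩ => ⟨_, fun i => add_mem (ha i) (hb i), h.add h'⟩
  zero_mem' := ⟨fun _ => 0, fun _ => zero_mem _, fun n ε hε => ⟨0, fun i _ => by
    rw [sub_zero]; exact .zero hε.le⟩⟩
  mul_mem' := fun hS hT => deltaClosure.mul_mem hΦ hD hQ h𝒮 (fun _ hc _ hd => MulMemClass.mul_mem hc hd) hS hT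
  smul_mem' := fun c _ ⟨a, ha, h⟩ => ⟨_, fun i => SMulMemClass.smul_mem c (ha i), h.smul c⟩
  star_mem' := fun ⟨a, ha, h⟩ => ⟨_, fun i => star_mem (ha i), h.star hΦ hD hQ⟩

end Delta

/-! ### Positive operators and von Neumann algebras -/

section Operators

variable {H : Type*} [NormedAddCommGroup H] [InnerProductSpace ℂ H] [CompleteSpace H]

theorem re_inner_nonneg {A : H →L[ℂ] H} (hA : 0 ≤ A) (x : H) : 0 ≤ (inner ℂ x (A x)).re :=
  ((ContinuousLinearMap.nonneg_iff_isPositive A).1 hA).re_inner_nonneg_right x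

theorem re_inner_mono {A B : H →L[ℂ] H} (h : A ≤ B) (x : H) :
    (inner ℂ x (A x)).re ≤ (inner ℂ x (B x)).re := by
  have := re_inner_nonneg (sub_nonneg.2 h) x
  rw [sub_apply, inner_sub_right, Complex.sub_re] at this
  linarith

theorem re_inner_star_mul_self (A : H →L[ℂ] H) (x : H) :
    (inner ℂ x ((star A * A) x)).re = ‖A x‖ ^ 2 := by
  rw [mul_apply_eq_comp, ContinuousLinearMap.star_eq_adjoint,
    ContinuousLinearMap.adjoint_inner_right, inner_self_eq_norm_sq_to_K]
  norm_cast

/-- Factor `A = S⋆ S`: then `‖A x‖ = ‖S⋆ S x‖ ≤ ‖S‖ ‖S x‖`. This is how weak information about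
positive operators yields strong information. -/
theorem norm_apply_sq_le {A : H →L[ℂ] H} (hA : 0 ≤ A) (x : H) :
    ‖A x‖ ^ 2 ≤ ‖A‖ * (inner ℂ x (A x)).re := by
  set S := CFC.sqrt A
  have hS : star S * S = A := by
    rw [(IsSelfAdjoint.of_nonneg (CFC.sqrt_nonneg A)).star_eq, CFC.sqrt_mul_sqrt_self A]
  have h1 : A x = star S (S x) := by rw [← mul_apply_eq_comp, hS]
  have h2 : ‖A‖ = ‖S‖ * ‖S‖ := by rw [← CStarRing.norm_star_mul_self, hS]
  have h3 := (star S).le_opNorm (S x)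
  rw [norm_star] at h3
  have h4 : (inner ℂ x (A x)).re = ‖S x‖ ^ 2 := by rw [← re_inner_star_mul_self, hS]
  rw [h4, h2, h1, show ‖S‖ * ‖S‖ * ‖S x‖ ^ 2 = (‖S‖ * ‖S x‖) ^ 2 by ring]
  exact pow_le_pow_left₀ (norm_nonneg _) h3 2

/-- The least upper bound of an increasing net of positive operators is its weak limit. -/
theorem tendsto_inner_of_isLUB {ι : Type*} [Preorder ι] [IsDirectedOrder ι] [Nonempty ι]
    {a : ι → H →L[ℂ] H} (hpos : ∀ i, 0 ≤ a i) (ha : Monotone a) {B : H →L[ℂ] H}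
    (hB : IsLUB (Set.range a) B) (x : H) :
    Filter.Tendsto (fun i => (inner ℂ x (a i x)).re) Filter.atTop (nhds (inner ℂ x (B x)).re) := by
  have hle : ∀ i, a i ≤ B := fun i => hB.1 ⟨i, rfl⟩
  have hmono : ∀ x, Monotone fun i => (inner ℂ x (a i x)).re :=
    fun x i j h => re_inner_mono (ha h) x
  have hbdd : ∀ x, BddAbove (Set.range fun i => (inner ℂ x (a i x)).re) :=
    fun x => ⟨(inner ℂ x (B x)).re, by rintro _ ⟨i, rfl⟩; exact re_inner_mono (hle i) x⟩
  have hcau : ∀ x, CauchySeq fun i => a i x := by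
    intro x
    have h0 := Metric.tendsto_nhds.1 (tendsto_atTop_ciSup (hmono x) (hbdd x))
    set L := ⨆ i, (inner ℂ x (a i x)).re
    rw [CauchySeq, Metric.cauchy_iff]
    refine ⟨Filter.map_neBot, fun ε hε => ?_⟩
    -- Chosen so that `‖a i x - a i₀ x‖²`, at most `(‖B‖ + 1)` times the remaining increase of the
    -- form, is below `ε² / 9 < (ε / 2)²`.
    obtain ⟨i₀, hi₀⟩ := Filter.eventually_atTop.1 (h0 (ε ^ 2 / (9 * (‖B‖ + 1))) (by positivity))
    have key : ∀ i ≥ i₀, ‖a i x - a i₀ x‖ < ε / 2 := by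
      intro i hi
      have hsub : 0 ≤ a i - a i₀ := sub_nonneg.2 (ha hi)
      have h1 := norm_apply_sq_le hsub x
      have h2 : ‖a i - a i₀‖ ≤ ‖B‖ := CStarAlgebra.norm_le_norm_of_nonneg_of_le hsub
        ((sub_le_self _ (hpos i₀)).trans (hle i))
      have h3 : (inner ℂ x (a i x)).re ≤ L := le_ciSup (hbdd x) i
      have h4 := hi₀ i₀ le_rfl
      have h5 := hmono x hi
      simp only at h5
      rw [Real.dist_eq, lt_div_iff₀ (by positivity), abs_sub_comm] at h4
      have h6 := le_abs_self (L - (inner ℂ x (a i₀ x)).re)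
      rw [sub_apply, inner_sub_right, Complex.sub_re] at h1
      refine lt_of_pow_lt_pow_left₀ 2 (by positivity) (lt_of_le_of_lt h1 ?_)
      have h7 : ‖a i - a i₀‖ * ((inner ℂ x (a i x)).re - (inner ℂ x (a i₀ x)).re) ≤
          (‖B‖ + 1) * |L - (inner ℂ x (a i₀ x)).re| :=
        mul_le_mul (by linarith) (by linarith) (by linarith) (by positivity)
      nlinarith
    refine ⟨_, Filter.image_mem_map (Filter.Ici_mem_atTop i₀), ?_⟩
    rintro _ ⟨i, hi, rfl⟩ _ ⟨j, hj, rfl⟩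
    have h1 := key i hi
    have h2 := key j hj
    rw [dist_eq_norm]
    have e : a i x - a j x = (a i x - a i₀ x) - (a j x - a i₀ x) := by abel
    rw [e]
    exact (norm_sub_le _ _).trans_lt (by linarith)
  choose C hC using fun x => cauchySeq_tendsto_of_complete (hcau x)
  let T : H →L[ℂ] H := ContinuousLinearMap.ofTendstoOfBoundedRange C a (tendsto_pi_nhds.2 hC) (by
      refine isBounded_iff_forall_norm_le.2 ⟨‖B‖, ?_⟩
      rintro _ ⟨i, rfl⟩
      exact CStarAlgebra.norm_le_norm_of_nonneg_of_le (hpos i) (hle i))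
  have hT : ∀ x y, Filter.Tendsto (fun i => inner ℂ y (a i x)) Filter.atTop
      (nhds (inner ℂ y (T x))) := fun x y => tendsto_const_nhds.inner (hC x)
  have hre : ∀ x, Filter.Tendsto (fun i => (inner ℂ x (a i x)).re) Filter.atTop
      (nhds (inner ℂ x (T x)).re) := fun x => (Complex.continuous_re.tendsto _).comp (hT x x)
  have hsym : ∀ i, ∀ x y, inner ℂ (a i x) y = inner ℂ x (a i y) :=
    fun i x y => (IsSelfAdjoint.of_nonneg (hpos i)).isSymmetric x y
  have hTsym : ∀ x y, inner ℂ (T x) y = inner ℂ x (T y) := fun x y => by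
    have h1 : Filter.Tendsto (fun i => inner ℂ (a i x) y) Filter.atTop
      (nhds (inner ℂ (T x) y)) := (hC x).inner tendsto_const_nhds
    simp only [hsym] at h1
    exact tendsto_nhds_unique h1 (hT y x)
  -- The strong limit `T` is an upper bound, so `B ≤ T`; conversely the forms of the `a i` stay
  -- below that of `B`. Hence the two forms agree.
  have hub : B ≤ T := by
    refine hB.2 ?_
    rintro _ ⟨i, rfl⟩
    rw [ContinuousLinearMap.le_def, ContinuousLinearMap.isPositive_def]
    refine ⟨fun x y => ?_, fun x => ?_⟩
    · change inner ℂ (T x - a i x) y = inner ℂ x (T y - a i y)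
      rw [inner_sub_left, inner_sub_right, hsym i, hTsym]
    · rw [ContinuousLinearMap.reApplyInnerSelf_apply, sub_apply, inner_sub_left, map_sub,
        inner_re_symm (𝕜 := ℂ), inner_re_symm (𝕜 := ℂ) (a i x)]
      exact sub_nonneg.2 (ge_of_tendsto (hre x)
        (Filter.eventually_atTop.2 ⟨i, fun j h => hmono x h⟩))
  have hlim := hre x
  have h1 := re_inner_mono hub x
  have h2 : (inner ℂ x (T x)).re ≤ (inner ℂ x (B x)).re :=
    le_of_tendsto hlim (Filter.Eventually.of_forall fun i => re_inner_mono (hle i) x)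
  rwa [le_antisymm h2 h1] at hlim

theorem mem_vonNeumann_iff {N : VonNeumannAlgebra H} {T : H →L[ℂ] H} :
    T ∈ N ↔ ∀ U ∈ N.commutant, U * T = T * U := by
  conv_lhs => rw [← N.commutant_commutant]
  exact VonNeumannAlgebra.mem_commutant_iff

theorem cfc_mem_vonNeumann {N : VonNeumannAlgebra H} {T : H →L[ℂ] H} (hT : T ∈ N) (f : ℝ → ℝ) :
    cfc f T ∈ N :=
  mem_vonNeumann_iff.2 fun U hU =>
    (Commute.cfc_real (show Commute T U from (mem_vonNeumann_iff.1 hT U hU).symm) f).symm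

theorem sqrt_mem_vonNeumann {N : VonNeumannAlgebra H} {T : H →L[ℂ] H} (hT : T ∈ N) :
    CFC.sqrt T ∈ N :=
  mem_vonNeumann_iff.2 fun U hU =>
    (Commute.cfcₙ_nnreal (show Commute T U from (mem_vonNeumann_iff.1 hT U hU).symm)
      NNReal.sqrt).symm

theorem abs_mem_vonNeumann {N : VonNeumannAlgebra H} {T : H →L[ℂ] H} (hT : T ∈ N) :
    CFC.abs T ∈ N := sqrt_mem_vonNeumann (mul_mem (star_mem hT) hT)

theorem smul_real_eq (r : ℝ) (A : H →L[ℂ] H) : r • A = (r : ℂ) • A := rfl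

/-- `A E A⋆ ≤ ‖A‖² · 1` compressed by a projection. -/
theorem conj_proj_le {E A : H →L[ℂ] H} (hE : IsStarProjection E) (hA : 0 ≤ A) :
    E * A * E ≤ (‖A‖ : ℂ) • E := by
  have := CStarAlgebra.star_left_conjugate_le_norm_smul (a := E) (b := A)
    (IsSelfAdjoint.of_nonneg hA)
  rwa [hE.isSelfAdjoint.star_eq, hE.isIdempotentElem.eq] at this

/-! ### Additivity of a trace and comparison of projections. -/

namespace IsFaithfulNormalSemifiniteTrace

variable {N : VonNeumannAlgebra H} {t : (H →L[ℂ] H) → ℝ≥0∞}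

theorem mono (ht : IsFaithfulNormalSemifiniteTrace N t) {A B : H →L[ℂ] H} (hA : A ∈ N) (hB : B ∈ N)
    (h0 : 0 ≤ A) (h : A ≤ B) : t A ≤ t B := by
  have := ht.map_add A hA (B - A) (sub_mem hB hA) h0 (sub_nonneg.2 h)
  rw [add_sub_cancel] at this
  rw [this]; exact le_self_add

theorem map_zero (ht : IsFaithfulNormalSemifiniteTrace N t) : t 0 = 0 := by
  have := ht.map_smul 0 le_rfl 0 (zero_mem N) le_rfl
  simpa using this

theorem map_sum (ht : IsFaithfulNormalSemifiniteTrace N t) {ι : Type*} (s : Finset ι)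
    {A : ι → H →L[ℂ] H} (hA : ∀ i, A i ∈ N) (h0 : ∀ i, 0 ≤ A i) :
    t (∑ i ∈ s, A i) = ∑ i ∈ s, t (A i) := by
  classical
  induction s using Finset.induction_on with
  | empty => simpa using ht.map_zero
  | insert i s hi ih =>
    rw [Finset.sum_insert hi, Finset.sum_insert hi, ht.map_add _ (hA i) _ (sum_mem fun j _ => hA j)
      (h0 i) (Finset.sum_nonneg fun j _ => h0 j), ih]

/-- If `‖Q E‖ < 1` for projections `Q` and `E`, then `Q` is equivalent to a subprojection of
`1 - E`. -/
theorem le_one_sub (ht : IsFaithfulNormalSemifiniteTrace N t) {Q E : H →L[ℂ] H} (hQ : Q ∈ N)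
    (hE : E ∈ N) (hQp : IsStarProjection Q) (hEp : IsStarProjection E) (h : ‖Q * E‖ < 1) :
    t Q ≤ t (1 - E) := by
  set K := Q * E * Q with hKdef
  have hQs := hQp.isSelfAdjoint.star_eq
  have hQi := hQp.isIdempotentElem.eq
  have hEi := hEp.isIdempotentElem.eq
  have hKeq : K = (Q * E) * star (Q * E) := by
    rw [star_mul, hQs, hEp.isSelfAdjoint.star_eq, hKdef]
    simp only [mul_assoc]
    rw [← mul_assoc E E, hEi]
  have hK0 : 0 ≤ K := hKeq ▸ mul_star_self_nonneg _
  have hKn : ‖K‖ < 1 := by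
    rw [hKeq, CStarRing.norm_self_mul_star]
    nlinarith [norm_nonneg (Q * E)]
  have hKs : IsSelfAdjoint K := IsSelfAdjoint.of_nonneg hK0
  have hspec : ∀ x ∈ spectrum ℝ K, x < 1 := by
    intro x hx
    have h1 := spectrum.norm_le_norm_mul_of_mem hx
    have h2 : ‖(1 : H →L[ℂ] H)‖ ≤ 1 := ContinuousLinearMap.norm_id_le
    have := le_abs_self x
    rw [Real.norm_eq_abs] at h1
    nlinarith [norm_nonneg K]
  -- `Z = (1 - K)^(-1/2)`, with `K = Q E Q` of norm less than `1`. As `Q (1 - E) Q = Q (1 - K)`, it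
  -- turns `(1 - E) Q` into a partial isometry `W` with `W⋆ W = Q` and `W W⋆ ≤ 1 - E`.
  set Z := cfc (fun x : ℝ => (√(1 - x))⁻¹) K with hZ
  have hcont : ContinuousOn (fun x : ℝ => (√(1 - x))⁻¹) (spectrum ℝ K) := by
    refine ContinuousOn.inv₀ (by fun_prop) fun x hx => ?_
    exact (Real.sqrt_pos.2 (sub_pos.2 (hspec x hx))).ne'
  have hZs : star Z = Z := (cfc_predicate (fun x : ℝ => (√(1 - x))⁻¹) K).star_eq
  have hKQ : Commute K Q := by
    change Q * E * Q * Q = Q * (Q * E * Q)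
    simp only [← mul_assoc, hQi]
    rw [mul_assoc (Q * E), hQi]
  have hZQ : Z * Q = Q * Z := Commute.cfc_real hKQ _
  have hZZ : Z * (1 - K) * Z = 1 := by
    have e1 : (1 - K) = cfc (fun x : ℝ => 1 - x) K := by
      rw [cfc_sub (fun _ : ℝ => 1) (fun x => x) K, cfc_const_one ℝ K, cfc_id' ℝ K]
    rw [e1, hZ, ← cfc_mul _ (fun x => 1 - x) K hcont,
      ← cfc_mul (fun x => (√(1 - x))⁻¹ * (1 - x)) _ K (hcont.mul (by fun_prop)) hcont]
    rw [← cfc_const_one ℝ K]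
    refine cfc_congr fun x hx => ?_
    have h1 : 0 < 1 - x := sub_pos.2 (hspec x hx)
    have h2 := Real.sq_sqrt h1.le
    have h3 := Real.sqrt_pos.2 h1
    field_simp
    linarith
  have hZN : Z ∈ N := cfc_mem_vonNeumann (mul_mem (mul_mem hQ hE) hQ) _
  have h1E : IsStarProjection (1 - E) := hEp.one_sub
  set W := (1 - E) * Q * Z with hW
  have hWN : W ∈ N := mul_mem (mul_mem (sub_mem (one_mem N) hE) hQ) hZN
  have hWW : star W * W = Q := by
    have e : star W * W = Z * (Q * ((1 - E) * (1 - E)) * Q) * Z := by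
      rw [hW, star_mul, star_mul, hQs, hZs, h1E.isSelfAdjoint.star_eq]
      simp only [mul_assoc]
    rw [e, h1E.isIdempotentElem.eq]
    have e2 : Q * (1 - E) * Q = Q * (1 - K) := by
      rw [mul_sub, sub_mul, mul_one, hQi, mul_sub, mul_one]
      congr 1
      rw [hKdef]
      simp only [← mul_assoc, hQi]
    rw [e2, ← mul_assoc, hZQ, mul_assoc, mul_assoc, ← mul_assoc Z, hZZ, mul_one]
  have hWn : ‖W‖ ≤ 1 := norm_partialIsometry_le_one hQp hWW
  have hle : W * star W ≤ 1 - E := by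
    have e : W * star W = (1 - E) * (W * star W) * (1 - E) := by
      have e1 : (1 - E) * W = W := by
        rw [hW]
        simp only [← mul_assoc, h1E.isIdempotentElem.eq]
      have e2 : star W * (1 - E) = star W := by
        have := congrArg star e1
        rwa [star_mul, h1E.isSelfAdjoint.star_eq] at this
      rw [← mul_assoc, e1, mul_assoc W, e2]
    rw [e]
    refine (conj_proj_le h1E (mul_star_self_nonneg W)).trans ?_
    rw [← smul_real_eq]
    nth_rewrite 2 [← one_smul ℝ (1 - E)]
    refine smul_le_smul_of_nonneg_right ?_ h1E.nonneg
    rw [CStarRing.norm_self_mul_star]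
    nlinarith [norm_nonneg W]
  calc t Q = t (W * star W) := by rw [← hWW, ht.tracial W hWN]
    _ ≤ t (1 - E) := ht.mono (mul_mem hWN (star_mem hWN)) (sub_mem (one_mem N) hE)
      (mul_star_self_nonneg W) hle

end IsFaithfulNormalSemifiniteTrace

/-- By the C⋆-identity the norm of `Y C` depends on `Y` only through `Y⋆ Y`, which is the same for
`X` and `|X|`. -/
theorem norm_mul_cfc_abs (X : H →L[ℂ] H) (k : ℝ → ℝ) :
    ‖X * cfc k (CFC.abs X)‖ = ‖CFC.abs X * cfc k (CFC.abs X)‖ := by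
  have h : ∀ Y : H →L[ℂ] H, star Y * Y = star X * X → ‖Y * cfc k (CFC.abs X)‖ ^ 2 =
      ‖star (cfc k (CFC.abs X)) * (star X * X) * cfc k (CFC.abs X)‖ := fun Y hY => by
    rw [sq, ← CStarRing.norm_star_mul_self, star_mul, ← hY]
    simp only [mul_assoc]
  have h1 := h X rfl
  rw [← h (CFC.abs X) (by
    rw [(IsSelfAdjoint.of_nonneg (CFC.abs_nonneg X)).star_eq, CFC.abs_mul_abs])] at h1
  exact (pow_left_inj₀ (norm_nonneg _) (norm_nonneg _) two_ne_zero).1 h1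

/-- An approximate polar decomposition. -/
theorem exists_approx_polar {N : VonNeumannAlgebra H} {X : H →L[ℂ] H} (hX : X ∈ N) {ε : ℝ}
    (hε : 0 < ε) : ∃ Z ∈ N, ‖Z‖ ≤ 1 ∧ ‖Z * CFC.abs X - X‖ ≤ ε := by
  set M := CFC.abs X with hM
  have hM0 : 0 ≤ M := CFC.abs_nonneg X
  have hMs : IsSelfAdjoint M := IsSelfAdjoint.of_nonneg hM0
  have hpos : ∀ x ∈ spectrum ℝ M, 0 ≤ x := fun x hx => spectrum_nonneg_of_nonneg hM0 hx
  have hcont : ContinuousOn (fun x : ℝ => (x + ε)⁻¹) (spectrum ℝ M) :=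
    ContinuousOn.inv₀ (by fun_prop) fun x hx => by have := hpos x hx; positivity
  have key : ∀ k : ℝ → ℝ, ContinuousOn k (spectrum ℝ M) → ∀ c, 0 ≤ c →
      (∀ x ∈ spectrum ℝ M, ‖x * k x‖ ≤ c) → ‖X * cfc k M‖ ≤ c := by
    intro k hk c hc h
    rw [norm_mul_cfc_abs, ← hM]
    nth_rewrite 1 [← cfc_id' ℝ M]
    rw [← cfc_mul _ _ M (by fun_prop) hk]
    exact norm_cfc_le hc h
  -- `Z = X (|X| + ε)⁻¹` belongs to `N`. Its norm is governed by `x / (x + ε) ≤ 1`, and the error `Z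
  -- |X| - X` by `ε x / (x + ε) ≤ ε`.
  refine ⟨X * cfc (fun x : ℝ => (x + ε)⁻¹) M, mul_mem hX (cfc_mem_vonNeumann
    (abs_mem_vonNeumann hX) _), key _ hcont 1 zero_le_one fun x hx => ?_, ?_⟩
  · have h0 := hpos x hx
    rw [Real.norm_of_nonneg (by positivity), ← div_eq_mul_inv, div_le_one (by positivity)]
    linarith
  · have e : X * cfc (fun x : ℝ => (x + ε)⁻¹) M * M - X =
        X * cfc (fun x : ℝ => (x + ε)⁻¹ * x - 1) M := by
      rw [cfc_sub (fun x : ℝ => (x + ε)⁻¹ * x) (fun _ => 1) M (hcont.mul (by fun_prop)),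
        cfc_const_one ℝ M, cfc_mul _ _ M hcont (by fun_prop), cfc_id' ℝ M, mul_sub, mul_one,
        mul_assoc]
    rw [e]
    refine key _ ((hcont.mul (by fun_prop)).sub (by fun_prop)) ε hε.le fun x hx => ?_
    have h0 := hpos x hx
    simp only [Pi.sub_apply, Pi.mul_apply]
    have e2 : x * ((x + ε)⁻¹ * x - 1) = -(ε * (x / (x + ε))) := by
      field_simp
      ring
    rw [e2, norm_neg, Real.norm_of_nonneg (by positivity)]
    have : x / (x + ε) ≤ 1 := by rw [div_le_one (by positivity)]; linarith
    nlinarith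

end Operators

/-! ### Traces given by frames -/

section Frame

variable {H : Type*} [NormedAddCommGroup H] [InnerProductSpace ℂ H] [CompleteSpace H]

/-- The sum of the vector states of `ξ`. -/
def vecTrace {ι : Type*} (ξ : ι → H) (T : H →L[ℂ] H) : ℝ≥0∞ :=
  ∑' i, ENNReal.ofReal (inner ℂ (ξ i) (T (ξ i))).re

/-- A family of vectors whose sum of vector states is a trace on `N`. -/
structure IsTraceFrame {ι : Type*} (N : VonNeumannAlgebra H) (ξ : ι → H) (L : ι → H →L[ℂ] H) :
    Prop where
  parseval : ∀ y, HasSum (fun i => ‖star (L i) y‖ ^ 2) (‖y‖ ^ 2)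
  dual : ∀ T ∈ N, ∀ i j, ‖star (L j) (T (ξ i))‖ = ‖star (L i) (star T (ξ j))‖
  separating : ∀ T ∈ N, (∀ i, T (ξ i) = 0) → T = 0
  finite : ∀ x, (∀ E ∈ N, IsStarProjection E → vecTrace ξ E < ∞ → E x = 0) → x = 0

section

variable {ι : Type*} {ξ : ι → H}

theorem vecTrace_add {A B : H →L[ℂ] H} (hA : 0 ≤ A) (hB : 0 ≤ B) :
    vecTrace ξ (A + B) = vecTrace ξ A + vecTrace ξ B := by
  rw [vecTrace, vecTrace, vecTrace, ← ENNReal.tsum_add]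
  congr 1
  funext i
  rw [add_apply, inner_add_right, Complex.add_re,
    ENNReal.ofReal_add (re_inner_nonneg hA _) (re_inner_nonneg hB _)]

theorem vecTrace_smul {r : ℝ} (hr : 0 ≤ r) (A : H →L[ℂ] H) :
    vecTrace ξ ((r : ℂ) • A) = ENNReal.ofReal r * vecTrace ξ A := by
  rw [vecTrace, vecTrace, ← ENNReal.tsum_mul_left]
  congr 1
  funext i
  rw [smul_apply, inner_smul_right, Complex.re_ofReal_mul, ENNReal.ofReal_mul hr]

theorem vecTrace_mono {A B : H →L[ℂ] H} (h : A ≤ B) : vecTrace ξ A ≤ vecTrace ξ B :=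
  ENNReal.tsum_le_tsum fun _ => ENNReal.ofReal_le_ofReal (re_inner_mono h _)

theorem vecTrace_star_mul_self (A : H →L[ℂ] H) :
    vecTrace ξ (star A * A) = ∑' i, ENNReal.ofReal (‖A (ξ i)‖ ^ 2) := by
  simp only [vecTrace, re_inner_star_mul_self]

/-- Each vector state is normal, directed suprema commute with finite sums, and the infinite sum is
itself a supremum of finite ones. -/
theorem vecTrace_isLUB {s : Set (H →L[ℂ] H)} (hpos : ∀ A ∈ s, 0 ≤ A) (hne : s.Nonempty)
    (hdir : DirectedOn (· ≤ ·) s) {B : H →L[ℂ] H} (hB : IsLUB s B) :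
    vecTrace ξ B = ⨆ A ∈ s, vecTrace ξ A := by
  have : Nonempty s := hne.to_subtype
  have : IsDirectedOrder s := ⟨fun a b => by
    obtain ⟨c, hc, h1, h2⟩ := hdir a a.2 b b.2
    exact ⟨⟨c, hc⟩, h1, h2⟩⟩
  have hm : Monotone ((↑) : s → H →L[ℂ] H) := fun _ _ h => h
  have key : ∀ i, ENNReal.ofReal (inner ℂ (ξ i) (B (ξ i))).re =
      ⨆ A : s, ENNReal.ofReal (inner ℂ (ξ i) ((A : H →L[ℂ] H) (ξ i))).re := by
    intro i
    have h1 := (ENNReal.continuous_ofReal.tendsto _).comp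
      (tendsto_inner_of_isLUB (a := ((↑) : s → H →L[ℂ] H)) (fun A => hpos A A.2) hm
        (by rwa [Subtype.range_coe]) (ξ i))
    have h2 : Monotone fun A : s => ENNReal.ofReal (inner ℂ (ξ i) ((A : H →L[ℂ] H) (ξ i))).re :=
      fun A A' h => ENNReal.ofReal_le_ofReal (re_inner_mono (hm h) _)
    exact tendsto_nhds_unique h1 (tendsto_atTop_iSup h2)
  rw [iSup_subtype']
  simp only [vecTrace, key]
  rw [ENNReal.tsum_eq_iSup_sum]
  have h3 : ∀ F : Finset ι, ∑ i ∈ F, ⨆ A : s, ENNReal.ofReal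
      (inner ℂ (ξ i) ((A : H →L[ℂ] H) (ξ i))).re = ⨆ A : s, ∑ i ∈ F, ENNReal.ofReal
      (inner ℂ (ξ i) ((A : H →L[ℂ] H) (ξ i))).re := fun F =>
    ENNReal.finsetSum_iSup fun A A' => by
      obtain ⟨C, h1, h2⟩ := exists_ge_ge A A'
      exact ⟨C, fun i => ⟨ENNReal.ofReal_le_ofReal (re_inner_mono (hm h1) _),
        ENNReal.ofReal_le_ofReal (re_inner_mono (hm h2) _)⟩⟩
  simp only [h3]
  rw [iSup_comm]
  simp only [← ENNReal.tsum_eq_iSup_sum]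

end

namespace IsTraceFrame

variable {ι : Type*} {N : VonNeumannAlgebra H} {ξ : ι → H} {L : ι → H →L[ℂ] H}

/-- Parseval applied to each `A ξ_i` turns `t(A⋆A)` into the double sum of `‖L_j⋆ A ξ_i‖²`. The
field `dual` exchanges `(A, i, j)` with `(A⋆, j, i)`. -/
theorem tracial (h : IsTraceFrame N ξ L) {A : H →L[ℂ] H} (hA : A ∈ N) :
    vecTrace ξ (star A * A) = vecTrace ξ (A * star A) := by
  have key : ∀ A : H →L[ℂ] H, vecTrace ξ (star A * A) =
      ∑' i, ∑' j, ENNReal.ofReal (‖star (L j) (A (ξ i))‖ ^ 2) := by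
    intro A
    rw [vecTrace_star_mul_self]
    congr 1
    funext i
    have h1 := h.parseval (A (ξ i))
    rw [← h1.tsum_eq, ENNReal.ofReal_tsum_of_nonneg (fun _ => by positivity) h1.summable]
  have h2 := key (star A)
  rw [star_star] at h2
  rw [key, h2, ENNReal.tsum_comm]
  simp only [h.dual A hA]

theorem isTrace (h : IsTraceFrame N ξ L) : IsFaithfulNormalSemifiniteTrace N (vecTrace ξ) where
  map_add _ _ _ _ := vecTrace_add
  map_smul r hr A _ _ := vecTrace_smul hr A
  tracial A hA := h.tracial hA
  faithful A hA h0 ht := by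
    refine h.separating A hA fun i => ?_
    have h1 := ENNReal.tsum_eq_zero.1 ht i
    rw [ENNReal.ofReal_eq_zero] at h1
    have h2 := norm_apply_sq_le h0 (ξ i)
    have h3 : ‖A (ξ i)‖ ^ 2 ≤ 0 := h2.trans (mul_nonpos_of_nonneg_of_nonpos (norm_nonneg _) h1)
    exact norm_eq_zero.1 (pow_eq_zero_iff two_ne_zero |>.1 (le_antisymm h3 (by positivity)))
  normal s _ hpos hne hdir B _ hB := vecTrace_isLUB hpos hne hdir hB
  semifinite A hA h0 hne := by
    set S := CFC.sqrt A
    have hSs : star S = S := (IsSelfAdjoint.of_nonneg (CFC.sqrt_nonneg A)).star_eq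
    have hSS : S * S = A := CFC.sqrt_mul_sqrt_self A
    have hSN : S ∈ N := sqrt_mem_vonNeumann hA
    obtain ⟨x, hx⟩ : ∃ x, S x ≠ 0 := by
      by_contra! hx
      refine hne ?_
      rw [← hSS, show S = 0 from ContinuousLinearMap.ext hx, mul_zero]
    -- Some projection of finite trace does not annihilate `S x`. Then `S E S ≤ A` is the required
    -- operator: it is nonzero, and its trace equals that of `E A E ≤ ‖A‖ E`.
    obtain ⟨E, hE, hEp, hEt, hEx⟩ : ∃ E ∈ N, IsStarProjection E ∧ vecTrace ξ E < ∞ ∧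
        E (S x) ≠ 0 := by
      by_contra! hc
      exact hx (h.finite (S x) hc)
    have hES : E * S ∈ N := mul_mem hE hSN
    refine ⟨star (E * S) * (E * S), mul_mem (star_mem hES) hES, star_mul_self_nonneg _, ?_, ?_, ?_⟩
    · have e : star (E * S) * (E * S) = star S * E * S := by
        rw [star_mul, hEp.isSelfAdjoint.star_eq, mul_assoc, ← mul_assoc E,
          hEp.isIdempotentElem.eq, mul_assoc]
      have := star_left_conjugate_le_conjugate hEp.le_one S
      rwa [mul_one, ← e, hSs, hSS] at this
    · intro h0
      rw [CStarRing.star_mul_self_eq_zero_iff] at h0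
      exact hEx (congrArg (fun T : H →L[ℂ] H => T x) h0)
    · rw [h.tracial hES]
      have e : E * S * star (E * S) = E * A * E := by
        rw [star_mul, hEp.isSelfAdjoint.star_eq, hSs, mul_assoc, ← mul_assoc S, hSS, mul_assoc]
      rw [e]
      refine (vecTrace_mono (conj_proj_le hEp h0)).trans_lt ?_
      rw [vecTrace_smul (norm_nonneg _)]
      exact ENNReal.mul_lt_top ENNReal.ofReal_lt_top hEt

/-- `∑ |⟨ξ, V X ξ⟩| ≤ ‖V‖ ‖X‖₁`. -/
theorem sum_norm_inner_le (h : IsTraceFrame N ξ L) {V X : H →L[ℂ] H} (hV : V ∈ N) (hX : X ∈ N)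
    (hfin : vecTrace ξ (CFC.abs X) < ∞) (s : Finset ι) :
    ∑ i ∈ s, ‖inner ℂ (ξ i) (V (X (ξ i)))‖ ≤ ‖V‖ * (vecTrace ξ (CFC.abs X)).toReal := by
  set M := CFC.abs X with hM
  set G := CFC.sqrt M
  have hM0 : 0 ≤ M := CFC.abs_nonneg X
  have hGs : star G = G := (IsSelfAdjoint.of_nonneg (CFC.sqrt_nonneg M)).star_eq
  have hGG : G * G = M := CFC.sqrt_mul_sqrt_self M
  have hGN : G ∈ N := sqrt_mem_vonNeumann (abs_mem_vonNeumann hX)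
  have hfs : ∀ C : H →L[ℂ] H, vecTrace ξ (star C * C) < ∞ → ∑ i ∈ s, ‖C (ξ i)‖ ^ 2 ≤
      (vecTrace ξ (star C * C)).toReal := by
    intro C hC
    have h1 := ENNReal.sum_le_tsum (f := fun i => ENNReal.ofReal (‖C (ξ i)‖ ^ 2)) s
    rw [← vecTrace_star_mul_self, ← ENNReal.ofReal_sum_of_nonneg fun _ _ => by positivity] at h1
    exact (ENNReal.ofReal_le_iff_le_toReal hC.ne).1 h1
  -- First with `Z |X|` in place of `X`. With `|X| = G²` and `C = (V Z G)⋆` the summand is `⟨C ξ, G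
  -- ξ⟩`. Cauchy-Schwarz leaves two square sums, that of `G` equal to `t(|X|)` and that of `C`, by
  -- traciality, at most `‖V‖² t(|X|)`.
  have hbound : ∀ Z ∈ N, ‖Z‖ ≤ 1 → ∑ i ∈ s, ‖inner ℂ (ξ i) (V ((Z * M) (ξ i)))‖ ≤
      ‖V‖ * (vecTrace ξ M).toReal := by
    intro Z hZ hZ1
    set C := star (V * Z * G) with hC
    have hCN : C ∈ N := star_mem (mul_mem (mul_mem hV hZ) hGN)
    have e1 : ∀ x, V ((Z * M) x) = star C (G x) := fun x => by
      rw [hC, star_star, ← hGG]; rfl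
    have e2 : ∀ x, ‖inner ℂ x (V ((Z * M) x))‖ ≤ ‖C x‖ * ‖G x‖ := fun x => by
      rw [e1, ContinuousLinearMap.star_eq_adjoint, ContinuousLinearMap.adjoint_inner_right]
      exact norm_inner_le_norm _ _
    have hGt : vecTrace ξ (star G * G) = vecTrace ξ M := by rw [hGs, hGG]
    have hCt : vecTrace ξ (star C * C) ≤ ENNReal.ofReal (‖V‖ ^ 2) * vecTrace ξ M := by
      rw [h.tracial hCN, ← vecTrace_smul (by positivity)]
      refine vecTrace_mono ?_
      have h1 := CStarAlgebra.star_left_conjugate_le_norm_smul (a := G)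
        (b := star (V * Z) * (V * Z)) (IsSelfAdjoint.star_mul_self _)
      have e3 : C * star C = star G * (star (V * Z) * (V * Z)) * G := by
        rw [hC, star_star, star_mul]; simp only [mul_assoc]
      rw [e3]
      refine h1.trans ?_
      rw [hGs, hGG, ← smul_real_eq]
      refine smul_le_smul_of_nonneg_right ?_ hM0
      rw [CStarRing.norm_star_mul_self, ← sq]
      refine pow_le_pow_left₀ (norm_nonneg _) ((norm_mul_le _ _).trans ?_) 2
      nlinarith [norm_nonneg V]
    have hCfin : ENNReal.ofReal (‖V‖ ^ 2) * vecTrace ξ M < ∞ :=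
      ENNReal.mul_lt_top ENNReal.ofReal_lt_top hfin
    have h3 := (hfs C (hCt.trans_lt hCfin)).trans (ENNReal.toReal_mono hCfin.ne hCt)
    rw [ENNReal.toReal_mul, ENNReal.toReal_ofReal (by positivity)] at h3
    have h4 := hfs G (hGt ▸ hfin)
    rw [hGt] at h4
    refine (Finset.sum_le_sum fun i _ => e2 (ξ i)).trans
      ((Real.sum_mul_le_sqrt_mul_sqrt s _ _).trans ?_)
    refine (mul_le_mul (Real.sqrt_le_sqrt h3) (Real.sqrt_le_sqrt h4) (Real.sqrt_nonneg _)
      (Real.sqrt_nonneg _)).trans_eq ?_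
    rw [Real.sqrt_mul (by positivity), Real.sqrt_sq (norm_nonneg _), mul_assoc,
      Real.mul_self_sqrt ENNReal.toReal_nonneg]
  -- Replacing `Z |X|` by `X` costs at most `K` times the polar error, since only finitely many
  -- indices occur; the tolerance `δ / (K + 1)` keeps this below `δ`.
  refine le_of_forall_pos_le_add fun δ hδ => ?_
  set K := ∑ i ∈ s, ‖V‖ * ‖ξ i‖ ^ 2 with hK
  have hK0 : 0 ≤ K := Finset.sum_nonneg fun i _ => by positivity
  obtain ⟨Z, hZ, hZ1, hZX⟩ := exists_approx_polar hX (ε := δ / (K + 1)) (by positivity)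
  have h1 : ∀ i, ‖inner ℂ (ξ i) (V (X (ξ i)))‖ ≤ ‖inner ℂ (ξ i) (V ((Z * M) (ξ i)))‖ +
      (‖V‖ * ‖ξ i‖ ^ 2) * (δ / (K + 1)) := by
    intro i
    have e : inner ℂ (ξ i) (V (X (ξ i))) = inner ℂ (ξ i) (V ((Z * M) (ξ i))) -
        inner ℂ (ξ i) (V ((Z * M - X) (ξ i))) := by
      rw [sub_apply, map_sub, inner_sub_right]; ring
    rw [e]
    refine (norm_sub_le _ _).trans (add_le_add_right ?_ _)
    refine (norm_inner_le_norm _ _).trans ?_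
    have h2 := (V.le_opNorm ((Z * M - X) (ξ i))).trans
      (mul_le_mul_of_nonneg_left (((Z * M - X).le_opNorm (ξ i)).trans
        (mul_le_mul_of_nonneg_right hZX (norm_nonneg _))) (norm_nonneg V))
    refine (mul_le_mul_of_nonneg_left h2 (norm_nonneg _)).trans_eq (by ring)
  refine (Finset.sum_le_sum fun i _ => h1 i).trans ?_
  rw [Finset.sum_add_distrib, ← Finset.sum_mul, ← hK]
  refine add_le_add (hbound Z hZ hZ1) ?_
  rw [mul_div_assoc', div_le_iff₀ (by positivity)]
  nlinarith

end IsTraceFrame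

end Frame

/-! ### Singular values and Dixmier functionals -/

section SingularValues

variable {H : Type*} [NormedAddCommGroup H] [InnerProductSpace ℂ H] [CompleteSpace H]
  {N : VonNeumannAlgebra H} {t : (H →L[ℂ] H) → ℝ≥0∞} {T : H →L[ℂ] H}

theorem singularValue_le {E : H →L[ℂ] H} (hE : E ∈ N) (hEp : IsStarProjection E) {r : ℝ}
    (h : t (1 - E) ≤ ENNReal.ofReal r) : singularValue N t T r ≤ ‖T * E‖ :=
  csInf_le ⟨0, by rintro _ ⟨E, -, -, -, rfl⟩; exact norm_nonneg _⟩ ⟨E, hE, hEp, h, rfl⟩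

theorem le_singularValue (h0 : t 0 = 0) {c r : ℝ} (h : ∀ E ∈ N, IsStarProjection E →
    t (1 - E) ≤ ENNReal.ofReal r → c ≤ ‖T * E‖) : c ≤ singularValue N t T r := by
  refine le_csInf ⟨_, 1, one_mem N, .one _, by simp [h0], rfl⟩ ?_
  rintro _ ⟨E, hE, hEp, hEt, rfl⟩
  exact h E hE hEp hEt

theorem singularValue_nonneg (r : ℝ) : 0 ≤ singularValue N t T r :=
  Real.sInf_nonneg (by rintro _ ⟨E, -, -, -, rfl⟩; exact norm_nonneg _)

theorem singularValue_antitone (h0 : t 0 = 0) : Antitone (singularValue N t T) := fun _ _ hrs =>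
  le_singularValue h0 fun _ hE hEp hEt =>
    singularValue_le hE hEp (hEt.trans (ENNReal.ofReal_le_ofReal hrs))

theorem integral_const_div_add {a b s : ℝ} (hb : 0 < b) (hs : 0 ≤ s) :
    ∫ r in (0 : ℝ)..s, a / (r + b) = a * (Real.log (s + b) - Real.log b) := by
  simp only [div_eq_mul_inv]
  rw [intervalIntegral.integral_const_mul,
    intervalIntegral.integral_comp_add_right (fun x : ℝ => x⁻¹), zero_add,
    integral_inv_of_pos hb (by linarith), Real.log_div (by linarith) hb.ne']

theorem intervalIntegrable_const_div_add {a b s : ℝ} (hb : 0 < b) (hs : 0 ≤ s) :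
    IntervalIntegrable (fun r : ℝ => a / (r + b)) MeasureTheory.volume 0 s := by
  refine ContinuousOn.intervalIntegrable (ContinuousOn.div (by fun_prop) (by fun_prop) ?_)
  intro x hx
  rw [Set.uIcc_of_le hs] at hx
  linarith [hx.1]

/-- Take `n = ⌊r / K⌋`. Then `K n ≤ r` makes the projection admissible, and `r < K (n + 1)` gives `r
+ 1 ≤ (K + 1)(n + 1)`. -/
theorem singularValue_le_div {K C : ℝ} (hK : 0 < K) (hC : 0 ≤ C)
    (h : ∀ n : ℕ, ∃ E ∈ N, IsStarProjection E ∧ t (1 - E) ≤ ENNReal.ofReal (K * n) ∧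
      ‖T * E‖ ≤ C / (n + 1)) {r : ℝ} (hr : 0 ≤ r) :
    singularValue N t T r ≤ C * (K + 1) / (r + 1) := by
  set n := ⌊r / K⌋₊
  obtain ⟨E, hE, hEp, hEt, hEn⟩ := h n
  have h1 : (n : ℝ) ≤ r / K := Nat.floor_le (by positivity)
  have h2 : r / K < n + 1 := Nat.lt_floor_add_one _
  rw [le_div_iff₀ hK] at h1
  rw [div_lt_iff₀ hK] at h2
  refine (singularValue_le hE hEp (hEt.trans (ENNReal.ofReal_le_ofReal (by linarith)))).trans
    (hEn.trans ?_)
  rw [div_le_div_iff₀ (by positivity) (by positivity), mul_assoc]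
  refine mul_le_mul_of_nonneg_left ?_ hC
  have : (0 : ℝ) ≤ n := Nat.cast_nonneg n
  nlinarith

/-- The bound `C (K + 1) / (r + 1)` integrates to `C (K + 1) log (1 + s)`, cancelling the
normalisation. -/
theorem dixmierFun_le (h0 : t 0 = 0) {K C : ℝ} (hK : 0 < K) (hC : 0 ≤ C)
    (h : ∀ n : ℕ, ∃ E ∈ N, IsStarProjection E ∧ t (1 - E) ≤ ENNReal.ofReal (K * n) ∧
      ‖T * E‖ ≤ C / (n + 1)) {s : ℝ} (hs : 0 < s) : dixmierFun N t T s ≤ C * (K + 1) := by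
  have h1 : ∫ r in (0 : ℝ)..s, singularValue N t T r ≤
      ∫ r in (0 : ℝ)..s, C * (K + 1) / (r + 1) :=
    intervalIntegral.integral_mono_on hs.le (singularValue_antitone h0).intervalIntegrable
      (intervalIntegrable_const_div_add one_pos hs.le) fun r hr =>
        singularValue_le_div hK hC h hr.1
  rw [integral_const_div_add one_pos hs.le, Real.log_one, sub_zero, add_comm s 1] at h1
  have h2 : 0 < Real.log (1 + s) := Real.log_pos (by linarith)
  rw [dixmierFun, one_div, inv_mul_le_iff₀ h2]
  linarith

theorem dixmierFun_nonneg {s : ℝ} (hs : 0 < s) : 0 ≤ dixmierFun N t T s :=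
  mul_nonneg (one_div_nonneg.2 (Real.log_nonneg (by linarith)))
    (intervalIntegral.integral_nonneg hs.le fun r _ => singularValue_nonneg r)

theorem dixmierFun_memLp (h0 : t 0 = 0) {C : ℝ} (hC : ∀ s > 0, dixmierFun N t T s ≤ C) :
    MeasureTheory.MemLp (dixmierFun N t T) ∞ (MeasureTheory.volume.restrict (Set.Ioi (0 : ℝ))) := by
  refine MeasureTheory.memLp_top_of_bound ?_ C ?_
  · refine ContinuousOn.aestronglyMeasurable ?_ measurableSet_Ioi
    refine ContinuousOn.mul (ContinuousOn.div continuousOn_const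
      (ContinuousOn.log (by fun_prop) fun x hx => ?_) fun x hx => ?_) ?_
    · have : 0 < x := hx
      linarith
    · have : 0 < x := hx
      exact (Real.log_pos (by linarith)).ne'
    · exact (intervalIntegral.continuous_primitive (fun a b =>
        (singularValue_antitone h0).intervalIntegrable) 0).continuousOn
  · refine (MeasureTheory.ae_restrict_iff' measurableSet_Ioi).2 (Filter.Eventually.of_forall ?_)
    intro s hs
    rw [Real.norm_of_nonneg (dixmierFun_nonneg hs)]
    exact hC s hs

/-- If `μ_r ~ 2 c / r`, then `F` tends to `2 c`. -/
theorem dixmierFun_tendsto (h0 : t 0 = 0) {c : ℝ} (hc : 0 < c)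
    (h1 : ∀ r, 0 ≤ r → 2 * c / (r + 3 * c) ≤ singularValue N t T r)
    (h2 : ∀ r, singularValue N t T r ≤ 1)
    (h3 : ∀ r, c < r → singularValue N t T r ≤ 2 * c / (r - c)) :
    Filter.Tendsto (dixmierFun N t T) Filter.atTop (nhds (2 * c)) := by
  set g := singularValue N t T
  have hg : ∀ a b, IntervalIntegrable g MeasureTheory.volume a b := fun a b =>
    (singularValue_antitone h0).intervalIntegrable
  have hlog : Filter.Tendsto (fun s : ℝ => (Real.log (1 + s))⁻¹) Filter.atTop (nhds 0) :=
    (Real.tendsto_log_atTop.comp (Filter.tendsto_atTop_add_const_left _ 1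
      Filter.tendsto_id)).inv_tendsto_atTop
  have hlim : ∀ K : ℝ, Filter.Tendsto (fun s : ℝ => 2 * c + K * (Real.log (1 + s))⁻¹) Filter.atTop
      (nhds (2 * c)) := fun K => by
    simpa using (hlog.const_mul K).const_add (2 * c)
  -- Both bounds have the form `2 c + const / log (1 + s)`: bounded errors in the integral disappear
  -- after division by the logarithm.
  refine tendsto_of_tendsto_of_tendsto_of_le_of_le'
    (hlim (2 * c * (Real.log (min 1 (3 * c)) - Real.log (3 * c))))
    (hlim (2 * c - 2 * c * Real.log c)) ?_ ?_
  · filter_upwards [Filter.eventually_gt_atTop 0] with s hs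
    have hl : 0 < Real.log (1 + s) := Real.log_pos (by linarith)
    have hint : ∫ r in (0 : ℝ)..s, 2 * c / (r + 3 * c) ≤ ∫ r in (0 : ℝ)..s, g r :=
      intervalIntegral.integral_mono_on hs.le
        (intervalIntegrable_const_div_add (by positivity) hs.le) (hg _ _) fun r hr => h1 r hr.1
    rw [integral_const_div_add (by positivity) hs.le] at hint
    have hmin : 0 < min 1 (3 * c) := by positivity
    -- Since `s + 3c ≥ min(1, 3c) (1 + s)`, the two logarithms differ by at most a constant from
    -- below.
    have h4 : Real.log (min 1 (3 * c)) + Real.log (1 + s) ≤ Real.log (s + 3 * c) := by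
      rw [← Real.log_mul hmin.ne' (by linarith)]
      refine Real.log_le_log (by positivity) ?_
      have := min_le_left 1 (3 * c)
      have := min_le_right 1 (3 * c)
      nlinarith
    rw [dixmierFun, one_div, ← div_eq_inv_mul, le_div_iff₀ hl, add_mul, mul_assoc _ _⁻¹,
      inv_mul_cancel₀ hl.ne', mul_one]
    nlinarith
  -- The bound `2c / (r - c)` is singular at `r = c`, so the integral is split at `2c` and the
  -- trivial bound `1` is used below.
  · filter_upwards [Filter.eventually_ge_atTop (2 * c)] with s hs
    have hs0 : 0 < s := by linarith
    have hl : 0 < Real.log (1 + s) := Real.log_pos (by linarith)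
    have hsplit := intervalIntegral.integral_add_adjacent_intervals (hg 0 (2 * c)) (hg (2 * c) s)
    have hint1 : ∫ r in (0 : ℝ)..(2 * c), g r ≤ ∫ _r in (0 : ℝ)..(2 * c), (1 : ℝ) :=
      intervalIntegral.integral_mono_on (by positivity) (hg _ _) (by simp) fun r _ => h2 r
    have hint2 : ∫ r in (2 * c)..s, g r ≤ ∫ r in (2 * c)..s, 2 * c / (r - c) := by
      refine intervalIntegral.integral_mono_on hs (hg _ _) ?_ fun r hr => h3 r (by linarith [hr.1])
      refine ContinuousOn.intervalIntegrable (ContinuousOn.div (by fun_prop) (by fun_prop) ?_)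
      intro x hx
      rw [Set.uIcc_of_le hs] at hx
      linarith [hx.1]
    have e : ∫ r in (2 * c)..s, 2 * c / (r - c) = 2 * c * (Real.log (s - c) - Real.log c) := by
      simp only [div_eq_mul_inv]
      rw [intervalIntegral.integral_const_mul,
        intervalIntegral.integral_comp_sub_right (fun x : ℝ => x⁻¹),
        integral_inv_of_pos (by linarith) (by linarith), Real.log_div (by linarith) (by linarith),
        show 2 * c - c = c by ring]
    have h5 : Real.log (s - c) ≤ Real.log (1 + s) := Real.log_le_log (by linarith) (by linarith)
    simp only [intervalIntegral.integral_const, sub_zero, smul_eq_mul, mul_one] at hint1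
    rw [dixmierFun, one_div, ← div_eq_inv_mul, div_le_iff₀ hl, add_mul, mul_assoc _ _⁻¹,
      inv_mul_cancel₀ hl.ne', mul_one]
    rw [e] at hint2
    nlinarith

-- Beyond some `R` the function `F - l` lies within `ε`, and what happens before `R` has bounded
-- support. Positivity and normalisation give `|ω(F) - l| ≤ ε`.
open MeasureTheory in
theorem IsGeneralizedLimit.eq_of_tendsto
    {ω : Lp ℝ ∞ (volume.restrict (Set.Ioi (0 : ℝ))) →L[ℝ] ℝ} (hω : IsGeneralizedLimit ω)
    {F : ℝ → ℝ} (hF : MemLp F ∞ (volume.restrict (Set.Ioi (0 : ℝ)))) {l : ℝ}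
    (h : Filter.Tendsto F Filter.atTop (nhds l)) : ω (hF.toLp F) = l := by
  have hone : MemLp (fun _ : ℝ => (1 : ℝ)) ∞ (volume.restrict (Set.Ioi (0 : ℝ))) :=
    memLp_top_const 1
  have hω1 : ω (hone.toLp _) = 1 := hω.one _ (by
    filter_upwards [hone.coeFn_toLp] with x hx using hx)
  refine eq_of_forall_dist_le fun ε hε => ?_
  obtain ⟨R, hR⟩ := Filter.eventually_atTop.1 (Metric.tendsto_nhds.1 h ε hε)
  have hu : MemLp ((Set.Ioi R).indicator fun x => F x - l) ∞
      (volume.restrict (Set.Ioi (0 : ℝ))) :=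
    (hF.sub (memLp_top_const l)).indicator measurableSet_Ioi
  have hub : ∀ x, |(Set.Ioi R).indicator (fun x => F x - l) x| ≤ ε := by
    intro x
    by_cases hx : x ∈ Set.Ioi R
    · rw [Set.indicator_of_mem hx, ← Real.dist_eq]
      exact (hR x (le_of_lt hx)).le
    · rw [Set.indicator_of_notMem hx, abs_zero]; exact hε.le
  have hv : ω (hF.toLp F - l • hone.toLp _ - hu.toLp _) = 0 := by
    refine hω.vanish _ ⟨R, ?_⟩
    filter_upwards [Lp.coeFn_sub (hF.toLp F - l • hone.toLp _) (hu.toLp _),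
      Lp.coeFn_sub (hF.toLp F) (l • hone.toLp _), Lp.coeFn_smul l (hone.toLp _),
      hF.coeFn_toLp, hone.coeFn_toLp, hu.coeFn_toLp] with x h1 h2 h3 h4 h5 h6 hx
    rw [h1, Pi.sub_apply, h2, Pi.sub_apply, h3, Pi.smul_apply, h4, h5, h6,
      Set.indicator_of_mem (show x ∈ Set.Ioi R from hx)]
    simp
  have hp : 0 ≤ ω (ε • hone.toLp _ - hu.toLp _) := by
    refine hω.nonneg _ ((Lp.coeFn_le _ _).1 ?_)
    filter_upwards [Lp.coeFn_sub (ε • hone.toLp _) (hu.toLp _), Lp.coeFn_smul ε (hone.toLp _),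
      hone.coeFn_toLp, hu.coeFn_toLp, Lp.coeFn_zero ℝ ∞ (volume.restrict (Set.Ioi (0 : ℝ)))]
      with x h1 h3 h5 h6 h7
    rw [h7, h1, Pi.sub_apply, h3, Pi.smul_apply, h5, h6]
    have := (abs_le.1 (hub x)).2
    simp only [Pi.zero_apply, smul_eq_mul, mul_one]
    linarith
  have hm : 0 ≤ ω (ε • hone.toLp _ + hu.toLp _) := by
    refine hω.nonneg _ ((Lp.coeFn_le _ _).1 ?_)
    filter_upwards [Lp.coeFn_add (ε • hone.toLp _) (hu.toLp _), Lp.coeFn_smul ε (hone.toLp _),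
      hone.coeFn_toLp, hu.coeFn_toLp, Lp.coeFn_zero ℝ ∞ (volume.restrict (Set.Ioi (0 : ℝ)))]
      with x h1 h3 h5 h6 h7
    rw [h7, h1, Pi.add_apply, h3, Pi.smul_apply, h5, h6]
    have := (abs_le.1 (hub x)).1
    simp only [Pi.zero_apply, smul_eq_mul, mul_one]
    linarith
  simp only [map_sub, map_add, map_smul, hω1, smul_eq_mul, mul_one] at hv hp hm
  rw [Real.dist_eq, abs_le]
  constructor <;> linarith

/-- An operator with singular values `(1 + n²)^{-1/2}`, of multiplicity `c` for `n = 0` and `2 c` for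
`n ≥ 1`, has `2 c` as its Dixmier traces. -/
theorem dixmier_of_spectralProjections (ht : IsFaithfulNormalSemifiniteTrace N t) (hT : T ∈ N)
    {c : ℝ} (hc : 0 < c) (Q : ℕ → H →L[ℂ] H) (hQ : ∀ n, Q n ∈ N)
    (hQp : ∀ n, IsStarProjection (Q n)) (hQ0 : Q 0 = 0)
    (hQt : ∀ n, t (Q (n + 1)) = ENNReal.ofReal (c * (2 * n + 1)))
    (hup : ∀ n : ℕ, ‖T * (1 - Q n)‖ ≤ (√(1 + (n : ℝ) ^ 2))⁻¹)
    (hlow : ∀ (n : ℕ) (x : H), (√(1 + (n : ℝ) ^ 2))⁻¹ * ‖Q (n + 1) x‖ ≤ ‖T x‖) :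
    T ∈ dixmierIdeal N t ∧
      ∀ ω : MeasureTheory.Lp ℝ ∞ (MeasureTheory.volume.restrict (Set.Ioi (0 : ℝ))) →L[ℝ] ℝ,
        IsGeneralizedLimit ω →
        ∃ hF : MeasureTheory.MemLp (dixmierFun N t T) ∞
            (MeasureTheory.volume.restrict (Set.Ioi (0 : ℝ))), ω (hF.toLp _) = 2 * c := by
  have h0 := ht.map_zero
  have hsq : ∀ n : ℕ, (n : ℝ) ≤ √(1 + (n : ℝ) ^ 2) := fun n => Real.le_sqrt_of_sq_le (by linarith)
  have hsq' : ∀ n : ℕ, √(1 + (n : ℝ) ^ 2) ≤ n + 1 := fun n =>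
    Real.sqrt_le_iff.2 ⟨by positivity, by nlinarith [Nat.cast_nonneg (α := ℝ) n]⟩
  have hsq1 : ∀ n : ℕ, 1 ≤ √(1 + (n : ℝ) ^ 2) := fun n =>
    Real.le_sqrt_of_sq_le (by nlinarith [sq_nonneg (n : ℝ)])
  have hE : ∀ n, 1 - Q n ∈ N := fun n => sub_mem (one_mem N) (hQ n)
  have hEp : ∀ n, IsStarProjection (1 - Q n) := fun n => (hQp n).one_sub
  have hbound : ∀ n : ℕ, ∃ E ∈ N, IsStarProjection E ∧ t (1 - E) ≤ ENNReal.ofReal (2 * c * n) ∧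
      ‖T * E‖ ≤ 2 / ((n : ℝ) + 1) := by
    intro n
    refine ⟨1 - Q n, hE n, hEp n, ?_, (hup n).trans ?_⟩
    · rw [sub_sub_cancel]
      cases n with
      | zero => simp [hQ0, h0]
      | succ n =>
        rw [hQt]
        refine ENNReal.ofReal_le_ofReal ?_
        push_cast
        nlinarith
    · have h1 := hsq n
      have h2 := hsq1 n
      rw [inv_eq_one_div, div_le_div_iff₀ (by linarith) (by positivity)]
      linarith
  have hdix : ∀ s > 0, dixmierFun N t T s ≤ 2 * (2 * c + 1) := fun s hs =>
    dixmierFun_le h0 (by positivity) zero_le_two hbound hs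
  refine ⟨⟨hT, _, hdix⟩, fun ω hω => ⟨dixmierFun_memLp h0 hdix, hω.eq_of_tendsto _ ?_⟩⟩
  refine dixmierFun_tendsto h0 hc (fun r hr => ?_) (fun r => ?_) fun r hr => ?_
  -- This `n` satisfies `c (2n - 1) ≤ r < c (2n + 1)`, so the trace of `Q (n + 1)` just exceeds `r`.
  · set n := ⌊(r / c + 1) / 2⌋₊
    have h1 : (n : ℝ) ≤ (r / c + 1) / 2 := Nat.floor_le (by positivity)
    have h2 : (r / c + 1) / 2 < n + 1 := Nat.lt_floor_add_one _
    have h3 : r < c * (2 * n + 1) := by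
      have : r / c < 2 * n + 1 := by linarith
      rw [div_lt_iff₀ hc] at this
      linarith
    have h4 : 2 * c * (n + 1) ≤ r + 3 * c := by
      have : 2 * (n : ℝ) - 1 ≤ r / c := by linarith
      rw [le_div_iff₀ hc] at this
      linarith
    refine le_singularValue h0 fun E hE hEp hEt => ?_
    have hl : 2 * c / (r + 3 * c) ≤ (√(1 + (n : ℝ) ^ 2))⁻¹ := by
      rw [inv_eq_one_div, div_le_div_iff₀ (by positivity) (by linarith [hsq1 n]), one_mul]
      nlinarith [hsq' n]
    refine hl.trans ?_
    -- If `‖T E‖` were smaller, `hlow` would give `‖Q (n + 1) E‖ < 1`. Comparison of projections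
    -- then forces `c (2n + 1) ≤ t(1 - E) ≤ r`, against the choice of `n`.
    by_contra! hlt
    have hpos : 0 < √(1 + (n : ℝ) ^ 2) := by linarith [hsq1 n]
    have hQE : ‖Q (n + 1) * E‖ ≤ √(1 + (n : ℝ) ^ 2) * ‖T * E‖ := by
      refine ContinuousLinearMap.opNorm_le_bound _ (by positivity) fun x => ?_
      have h5 := hlow n (E x)
      rw [inv_mul_le_iff₀ hpos] at h5
      rw [mul_apply_eq_comp, mul_assoc]
      exact h5.trans (mul_le_mul_of_nonneg_left ((T * E).le_opNorm x) hpos.le)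
    have h6 : ‖Q (n + 1) * E‖ < 1 := by
      refine hQE.trans_lt ?_
      rwa [← lt_inv_mul_iff₀ hpos, mul_one]
    have h7 := (ht.le_one_sub (hQ _) hE (hQp _) hEp h6).trans hEt
    rw [hQt, ENNReal.ofReal_le_ofReal_iff hr] at h7
    linarith
  · refine (singularValue_le (E := 1 - Q 0) (hE 0) (hEp 0) (by simp [hQ0, h0])).trans
      ((hup 0).trans ?_)
    simp
  -- The same `n` serves the upper bound: the trace of `Q n` is `c (2n - 1) ≤ r`, so `1 - Q n` is
  -- admissible. The hypothesis `c < r` makes `n ≥ 1`, which the trace formula needs.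
  · set n := ⌊(r / c + 1) / 2⌋₊ with hn
    have hrc : 1 < r / c := (one_lt_div hc).2 hr
    have h1 : (n : ℝ) ≤ (r / c + 1) / 2 := Nat.floor_le (by positivity)
    have h2 : (r / c + 1) / 2 < n + 1 := Nat.lt_floor_add_one _
    have hn1 : 1 ≤ n := by
      rw [hn, Nat.one_le_floor_iff]
      linarith
    obtain ⟨m, hm⟩ : ∃ m, n = m + 1 := ⟨n - 1, by lia⟩
    have h3 : 2 * (n : ℝ) - 1 ≤ r / c := by linarith
    rw [le_div_iff₀ hc] at h3
    refine (singularValue_le (E := 1 - Q n) (hE n) (hEp n) ?_).trans ((hup n).trans ?_)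
    · rw [sub_sub_cancel, hm, hQt]
      refine ENNReal.ofReal_le_ofReal (le_trans (le_of_eq ?_) h3)
      rw [hm]
      push_cast
      ring
    · have h4 : r / c - 1 < 2 * n := by linarith
      have h5 : r - c < 2 * n * c := by
        have := mul_lt_mul_of_pos_right h4 hc
        rwa [sub_mul, div_mul_cancel₀ _ hc.ne', one_mul] at this
      have h6 := hsq n
      have h7 := hsq1 n
      rw [inv_eq_one_div, div_le_div_iff₀ (by linarith) (by linarith)]
      nlinarith

end SingularValues

/-! ### Relations in the graph algebra -/

section Graph

variable {V : Type u} [Quiver.{u + 1} V]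

/-- Evaluation at a family. -/
def evalFamily (F : CuntzKriegerFamily V) : GraphCStar V →+ F.B where
  toFun x := (x.1 : ∀ F : CuntzKriegerFamily V, F.B) F
  map_zero' := rfl
  map_add' _ _ := rfl

theorem ext_evalFamily {x y : GraphCStar V} (h : ∀ F, evalFamily F x = evalFamily F y) : x = y :=
  Subtype.ext <| Subtype.ext <| funext h

theorem P_mul_P_of_ne {v w : V} (h : v ≠ w) : P v * P w = 0 :=
  ext_evalFamily fun F => F.isCK.orth v w h

theorem star_P (v : V) : star (P v) = P v := (isStarProjection_P v).isSelfAdjoint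

theorem P_mul_self (v : V) : P v * P v = P v := (isStarProjection_P v).isIdempotentElem

theorem P_eq_sum (hlf : LocallyFinite V) (v : V) (hv : Nonempty (Quiver.Star v)) :
    P v = ∑ᶠ e : Quiver.Star v, S e.2 * star (S e.2) := by
  have := hlf.1 v
  refine ext_evalFamily fun F => ?_
  rw [(evalFamily F).map_finsum (Set.toFinite _)]
  exact F.isCK.sum v hv

theorem S_mul_P {a b : V} (e : a ⟶ b) : S e * P b = S e := by
  rw [← sub_eq_zero, ← CStarRing.star_mul_self_eq_zero_iff]
  simp only [star_sub, star_mul, star_P, sub_mul, mul_sub, mul_assoc, star_S_mul_S, P_mul_self]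
  simp only [← mul_assoc, star_S_mul_S, P_mul_self, sub_self]

/-- Not among the defining relations. With `y_f = (1 - p_a) S_f`, the sum of the `y_f y_f⋆` over the
edges out of `a` is `(1 - p_a) p_a (1 - p_a) = 0`, and a vanishing sum of positive elements has
vanishing terms. -/
theorem P_mul_S (hlf : LocallyFinite V) {a b : V} (e : a ⟶ b) : P a * S e = S e := by
  have := hlf.1 a
  have := Fintype.ofFinite (Quiver.Star a)
  have hsum := P_eq_sum hlf a ⟨⟨b, e⟩⟩
  rw [finsum_eq_sum_of_fintype] at hsum
  let y : Quiver.Star a → GraphCStar V := fun f => S f.2 - P a * S f.2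
  have hy : ∑ f, y f * star (y f) = 0 := by
    have h1 : ∀ f, y f * star (y f) = S f.2 * star (S f.2) - P a * (S f.2 * star (S f.2)) -
        S f.2 * star (S f.2) * P a + P a * (S f.2 * star (S f.2)) * P a := fun f => by
      simp only [y, star_sub, star_mul, star_P, sub_mul, mul_sub, mul_assoc]
      abel
    simp only [h1]
    rw [Finset.sum_add_distrib, Finset.sum_sub_distrib, Finset.sum_sub_distrib, ← Finset.mul_sum,
      ← Finset.sum_mul, ← Finset.sum_mul, ← Finset.mul_sum, ← hsum, P_mul_self, P_mul_self]
    simp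
  have h2 := (Finset.sum_eq_zero_iff_of_nonneg fun f _ => mul_star_self_nonneg (y f)).1 hy ⟨b, e⟩
    (Finset.mem_univ _)
  rw [CStarRing.mul_star_self_eq_zero_iff, sub_eq_zero] at h2
  exact h2.symm

theorem star_S_mul_P (hlf : LocallyFinite V) {a b : V} (e : a ⟶ b) :
    star (S e) * P a = star (S e) := by
  have := congrArg star (P_mul_S hlf e)
  rwa [star_mul, star_P] at this

/-- For a common source the sum of `|S_g⋆ S_f|²` over all edges `g` is `S_f⋆ p_a S_f = S_f⋆ S_f`.
The term `g = f` alone already gives this, so the other terms vanish. For different sources the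
vertex projections are orthogonal. -/
theorem star_S_mul_S_of_ne (hlf : LocallyFinite V) {a b a' b' : V} (e : a ⟶ b) (f : a' ⟶ b')
    (h : (⟨a, b, e⟩ : Σ a b : V, a ⟶ b) ≠ ⟨a', b', f⟩) : star (S e) * S f = 0 := by
  rcases eq_or_ne a a' with rfl | ha
  · have := hlf.1 a
    have := Fintype.ofFinite (Quiver.Star a)
    classical
    have hsum := P_eq_sum hlf a ⟨⟨b', f⟩⟩
    rw [finsum_eq_sum_of_fintype] at hsum
    have h1 : ∑ g : Quiver.Star a, star (star (S g.2) * S f) * (star (S g.2) * S f) = P b' := by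
      have h2 : ∀ g : Quiver.Star a, star (star (S g.2) * S f) * (star (S g.2) * S f) =
          star (S f) * (S g.2 * star (S g.2)) * S f := fun g => by
        rw [star_mul, star_star]; simp only [mul_assoc]
      simp only [h2]
      rw [← Finset.sum_mul, ← Finset.mul_sum, ← hsum, star_S_mul_P hlf, star_S_mul_S]
    rw [← Finset.add_sum_erase _ _ (Finset.mem_univ (⟨b', f⟩ : Quiver.Star a))] at h1
    simp only [star_S_mul_S, star_P, P_mul_self, add_eq_left] at h1
    have h3 := (Finset.sum_eq_zero_iff_of_nonneg fun g _ => star_mul_self_nonneg _).1 h1 ⟨b, e⟩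
      (Finset.mem_erase.2 ⟨fun h4 => h ?_, Finset.mem_univ _⟩)
    · exact (CStarRing.star_mul_self_eq_zero_iff _).1 h3
    · exact congrArg (fun g : Quiver.Star a => (⟨a, g.1, g.2⟩ : Σ a b : V, a ⟶ b)) h4
  · rw [← star_S_mul_P hlf e, ← P_mul_S hlf f, mul_assoc, ← mul_assoc (P a), P_mul_P_of_ne ha,
      zero_mul, mul_zero]

theorem pathS_mul_P {a b : V} (μ : Quiver.Path a b) : pathS μ * P b = pathS μ := by
  cases μ with
  | nil => exact P_mul_self a
  | cons μ e => rw [pathS, mul_assoc, S_mul_P]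

theorem P_mul_star_pathS {a b : V} (μ : Quiver.Path a b) :
    P b * star (pathS μ) = star (pathS μ) := by
  have := congrArg star (pathS_mul_P μ)
  rwa [star_mul, star_P] at this

theorem P_mul_pathS {a b : V} (μ : Quiver.Path a b) : P a * pathS μ = pathS μ := by
  induction μ with
  | nil => exact P_mul_self a
  | cons μ e ih => rw [pathS, ← mul_assoc, ih]

theorem star_pathS_mul_P {a b : V} (μ : Quiver.Path a b) :
    star (pathS μ) * P a = star (pathS μ) := by
  have := congrArg star (P_mul_pathS μ)
  rwa [star_mul, star_P] at this

theorem star_pathS_mul_pathS (hlf : LocallyFinite V) {a b : V} (μ : Quiver.Path a b) :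
    star (pathS μ) * pathS μ = P b := by
  induction μ with
  | nil => rw [pathS, star_P, P_mul_self]
  | cons μ e ih =>
    rw [pathS, star_mul, mul_assoc, ← mul_assoc (star (pathS μ)), ih, P_mul_S hlf, star_S_mul_S]

theorem pathS_comp {a b c : V} (μ : Quiver.Path a b)
    (ν : Quiver.Path b c) : pathS (μ.comp ν) = pathS μ * pathS ν := by
  induction ν with
  | nil => rw [Quiver.Path.comp_nil, pathS, pathS_mul_P]
  | cons ν e ih => rw [Quiver.Path.comp_cons, pathS, pathS, ih, mul_assoc]

theorem pathS_toPath (hlf : LocallyFinite V) {a b : V} (e : a ⟶ b) : pathS e.toPath = S e :=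
  P_mul_S hlf e

variable (V) in
/-- Paths with arbitrary source and range. -/
abbrev Pth := Σ a b : V, Quiver.Path a b

theorem star_pathS_mul_pathS_of_ne (hlf : LocallyFinite V) {a b a' b' : V} (μ : Quiver.Path a b)
    (ν : Quiver.Path a' b') (hl : μ.length = ν.length) (h : (⟨a, b, μ⟩ : Pth V) ≠ ⟨a', b', ν⟩) :
    star (pathS μ) * pathS ν = 0 := by
  induction μ generalizing b' with
  | nil =>
    cases ν with
    | nil =>
      have : a ≠ a' := by rintro rfl; exact h rfl
      rw [pathS, pathS, star_P, P_mul_P_of_ne this]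
    | cons ν f => simp at hl
  | @cons c b μ e ih =>
    cases ν with
    | nil => simp at hl
    | @cons c' _ ν f =>
      simp only [Quiver.Path.length_cons, Nat.add_right_cancel_iff] at hl
      rw [pathS, pathS, star_mul, mul_assoc, ← mul_assoc (star (pathS μ))]
      by_cases hμ : (⟨a, c, μ⟩ : Pth V) = ⟨a', c', ν⟩
      · cases hμ
        rw [star_pathS_mul_pathS hlf, P_mul_S hlf]
        refine star_S_mul_S_of_ne hlf e f fun h' => h ?_
        cases h'
        rfl
      · rw [ih ν hl hμ, zero_mul, mul_zero]

/-! ### The spanning set of the core -/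

variable (V) in
/-- The linear span of the `S_α S_β⋆`. -/
def pathSpan : Submodule ℂ (GraphCStar V) :=
  Submodule.span ℂ {x | ∃ (a b c : V) (α : Quiver.Path a c) (β : Quiver.Path b c),
    x = pathS α * star (pathS β)}

theorem pathS_mul_star_mem {a b c : V} (α : Quiver.Path a c) (β : Quiver.Path b c) :
    pathS α * star (pathS β) ∈ pathSpan V := Submodule.subset_span ⟨a, b, c, α, β, rfl⟩

theorem mul_mem_pathSpan_of {y : GraphCStar V} (h : ∀ {a b c : V} (α : Quiver.Path a c)
    (β : Quiver.Path b c), y * (pathS α * star (pathS β)) ∈ pathSpan V) {m : GraphCStar V}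
    (hm : m ∈ pathSpan V) : y * m ∈ pathSpan V := by
  induction hm using Submodule.span_induction with
  | mem m hm => obtain ⟨a, b, c, α, β, rfl⟩ := hm; exact h α β
  | zero => rw [mul_zero]; exact zero_mem _
  | add m m' _ _ h1 h2 => rw [mul_add]; exact add_mem h1 h2
  | smul r m _ h1 => rw [mul_smul_comm]; exact Submodule.smul_mem _ _ h1

theorem P_mul_pathSpan {v : V} {m : GraphCStar V} (hm : m ∈ pathSpan V) :
    P v * m ∈ pathSpan V := by
  refine mul_mem_pathSpan_of (fun {a b c} α β => ?_) hm
  rw [← mul_assoc]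
  rcases eq_or_ne v a with rfl | h
  · rw [P_mul_pathS]; exact pathS_mul_star_mem α β
  · rw [← P_mul_pathS, ← mul_assoc, P_mul_P_of_ne h, zero_mul, zero_mul]; exact zero_mem _

theorem S_mul_pathSpan (hlf : LocallyFinite V) {v w : V} (e : v ⟶ w) {m : GraphCStar V}
    (hm : m ∈ pathSpan V) : S e * m ∈ pathSpan V := by
  refine mul_mem_pathSpan_of (fun {a b c} α β => ?_) hm
  rw [← mul_assoc]
  rcases eq_or_ne w a with rfl | h
  · rw [← pathS_toPath hlf, ← pathS_comp]; exact pathS_mul_star_mem _ β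
  · rw [← P_mul_pathS, ← S_mul_P, mul_assoc (S e), ← mul_assoc (P w), P_mul_P_of_ne h, zero_mul,
      mul_zero, zero_mul]
    exact zero_mem _

theorem star_S_mul_pathSpan (hlf : LocallyFinite V) {v w : V} (e : v ⟶ w) {m : GraphCStar V}
    (hm : m ∈ pathSpan V) : star (S e) * m ∈ pathSpan V := by
  refine mul_mem_pathSpan_of (fun {a b c} α β => ?_) hm
  rw [← mul_assoc]
  -- If `α` is a vertex, `S_e⋆` is absorbed into `S_β⋆` as a last edge of `β`; otherwise it meets
  -- the first edge of `α` and cancels it or annihilates.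
  rcases Nat.eq_zero_or_pos α.length with h0 | h0
  · obtain rfl := α.eq_of_length_zero h0
    obtain rfl := α.eq_nil_of_length_zero h0
    rw [pathS, mul_assoc, P_mul_star_pathS]
    rcases eq_or_ne v a with rfl | h
    · rw [← star_mul, ← pathS, ← P_mul_star_pathS]
      exact pathS_mul_star_mem Quiver.Path.nil (β.cons e)
    · rw [← P_mul_star_pathS, ← star_S_mul_P hlf, mul_assoc, ← mul_assoc (P v), P_mul_P_of_ne h,
        zero_mul, mul_zero]
      exact zero_mem _
  · obtain ⟨d, f, α', -, rfl⟩ := α.eq_toPath_comp_of_length_eq_succ (n := α.length - 1) (by lia)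
    rw [pathS_comp, pathS_toPath hlf, ← mul_assoc]
    by_cases h : (⟨v, w, e⟩ : Σ a b : V, a ⟶ b) = ⟨a, d, f⟩
    · cases h
      rw [star_S_mul_S, P_mul_pathS]
      exact pathS_mul_star_mem α' β
    · rw [star_S_mul_S_of_ne hlf e f h, zero_mul, zero_mul]
      exact zero_mem _

theorem P_mem_pathSpan (v : V) : P v ∈ pathSpan V := by
  have := pathS_mul_star_mem (Quiver.Path.nil : Quiver.Path v v) Quiver.Path.nil
  rwa [pathS, star_P, P_mul_self] at this

/-- The induction carries stability of the span under left multiplication by `x` and by `x⋆`: the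
first handles products and the second makes the claim invariant under the involution. -/
theorem mem_pathSpan (hlf : LocallyFinite V) {x : GraphCStar V} (hx : x ∈ core V) :
    x ∈ pathSpan V := by
  have hst : ∀ m ∈ pathSpan V, star m ∈ pathSpan V := by
    intro m hm
    induction hm using Submodule.span_induction with
    | mem m hm =>
      obtain ⟨a, b, c, α, β, rfl⟩ := hm
      rw [star_mul, star_star]
      exact pathS_mul_star_mem β α
    | zero => rw [star_zero]; exact zero_mem _
    | add m m' _ _ h1 h2 => rw [star_add]; exact add_mem h1 h2
    | smul r m _ h1 => rw [star_smul]; exact Submodule.smul_mem _ _ h1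
  suffices h : x ∈ pathSpan V ∧ (∀ m ∈ pathSpan V, x * m ∈ pathSpan V) ∧
      ∀ m ∈ pathSpan V, star x * m ∈ pathSpan V from h.1
  refine NonUnitalStarAlgebra.adjoin_induction ℂ (p := fun x _ => x ∈ pathSpan V ∧
    (∀ m ∈ pathSpan V, x * m ∈ pathSpan V) ∧ ∀ m ∈ pathSpan V, star x * m ∈ pathSpan V)
    ?_ ?_ ?_ ?_ ?_ ?_ hx
  · rintro _ (⟨v, rfl⟩ | ⟨a, b, e, rfl⟩)
    · refine ⟨P_mem_pathSpan v, fun m hm => P_mul_pathSpan hm, fun m hm => ?_⟩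
      rw [star_P]; exact P_mul_pathSpan hm
    · refine ⟨?_, fun m hm => S_mul_pathSpan hlf e hm, fun m hm => star_S_mul_pathSpan hlf e hm⟩
      rw [← S_mul_P]
      exact S_mul_pathSpan hlf e (P_mem_pathSpan b)
  · rintro x y _ _ ⟨h1, h2, h3⟩ ⟨k1, k2, k3⟩
    refine ⟨add_mem h1 k1, fun m hm => ?_, fun m hm => ?_⟩
    · rw [add_mul]; exact add_mem (h2 m hm) (k2 m hm)
    · rw [star_add, add_mul]; exact add_mem (h3 m hm) (k3 m hm)
  · refine ⟨zero_mem _, fun m _ => ?_, fun m _ => ?_⟩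
    · rw [zero_mul]; exact zero_mem _
    · rw [star_zero, zero_mul]; exact zero_mem _
  · rintro x y _ _ ⟨h1, h2, h3⟩ ⟨k1, k2, k3⟩
    refine ⟨h2 y k1, fun m hm => ?_, fun m hm => ?_⟩
    · rw [mul_assoc]; exact h2 _ (k2 m hm)
    · rw [star_mul, mul_assoc]; exact k3 _ (h3 m hm)
  · rintro r x _ ⟨h1, h2, h3⟩
    refine ⟨Submodule.smul_mem _ _ h1, fun m hm => ?_, fun m hm => ?_⟩
    · rw [smul_mul_assoc]; exact Submodule.smul_mem _ _ (h2 m hm)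
    · rw [star_smul, smul_mul_assoc]; exact Submodule.smul_mem _ _ (h3 m hm)
  · rintro x _ ⟨h1, h2, h3⟩
    exact ⟨hst x h1, h3, fun m hm => by rw [star_star]; exact h2 m hm⟩

/-- Induction over the core along the spanning set `S_α S_β⋆`. -/
theorem core_induction (hlf : LocallyFinite V) {p : GraphCStar V → Prop}
    (mem : ∀ {a b c : V} (α : Quiver.Path a c) (β : Quiver.Path b c),
      p (pathS α * star (pathS β))) (zero : p 0) (add : ∀ x y, p x → p y → p (x + y))
    (smul : ∀ (r : ℂ) x, p x → p (r • x)) {x : GraphCStar V} (hx : x ∈ core V) : p x := by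
  refine Submodule.span_induction (p := fun x _ => p x) ?_ zero (fun x y _ _ => add x y)
    (fun r x _ => smul r x) (mem_pathSpan hlf hx)
  rintro _ ⟨a, b, c, α, β, rfl⟩
  exact mem α β

end Graph

/-! ### The vertex projections do not vanish -/

section Nontrivial

/-- The basis vectors of `ℓ²`. -/
def basisVec {I : Type*} [DecidableEq I] (i : I) : lp (fun _ : I => ℂ) 2 := lp.single 2 i 1

theorem orthonormal_basisVec {I : Type*} [DecidableEq I] :
    Orthonormal ℂ (basisVec : I → lp (fun _ : I => ℂ) 2) := by
  rw [orthonormal_iff_ite]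
  intro i j
  rw [basisVec, basisVec, lp.inner_single_left, lp.single_apply]
  rcases eq_or_ne i j with rfl | h
  · simp
  · simp [h]

theorem ext_basisVec {I : Type*} [DecidableEq I] {E : Type*} [NormedAddCommGroup E]
    [NormedSpace ℂ E] {A B : lp (fun _ : I => ℂ) 2 →L[ℂ] E}
    (h : ∀ i, A (basisVec i) = B (basisVec i)) : A = B := by
  ext x
  have hx := lp.hasSum_single (p := 2) (by simp) x
  have hs : ∀ i, (lp.single 2 i (x i) : lp (fun _ : I => ℂ) 2) = x i • basisVec i := fun i => by
    rw [basisVec, ← lp.single_smul, smul_eq_mul, mul_one]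
  simp only [hs] at hx
  have h1 := hx.mapL A
  have h2 := hx.mapL B
  simp only [map_smul, h] at h1 h2
  exact h1.unique h2

/-- The isometry `ℓ²(J) → ℓ²(I)` given by an injective map. -/
def basisIsometry {I J : Type*} [DecidableEq I] [DecidableEq J] {f : J → I}
    (hf : Function.Injective f) : lp (fun _ : J => ℂ) 2 →L[ℂ] lp (fun _ : I => ℂ) 2 :=
  ((orthonormal_basisVec.comp f hf).orthogonalFamily.linearIsometry).toContinuousLinearMap

section

variable {I J : Type*} [DecidableEq I] [DecidableEq J] {f : J → I} (hf : Function.Injective f)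

theorem basisIsometry_apply (j : J) : basisIsometry hf (basisVec j) = basisVec (f j) := by
  refine ((orthonormal_basisVec.comp f hf).orthogonalFamily.linearIsometry_apply_single _).trans ?_
  simp

theorem adjoint_mul_basisIsometry (x : lp (fun _ : J => ℂ) 2) :
    ContinuousLinearMap.adjoint (basisIsometry hf) (basisIsometry hf x) = x := by
  refine ext_inner_left ℂ fun y => ?_
  rw [ContinuousLinearMap.adjoint_inner_right]
  exact LinearIsometry.inner_map_map _ y x

theorem adjoint_basisIsometry_apply (j : J) :
    ContinuousLinearMap.adjoint (basisIsometry hf) (basisVec (f j)) = basisVec j := by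
  rw [← basisIsometry_apply hf, adjoint_mul_basisIsometry]

theorem adjoint_basisIsometry_of_notMem {i : I} (h : i ∉ Set.range f) :
    ContinuousLinearMap.adjoint (basisIsometry hf) (basisVec i) = 0 := by
  have key : (innerSL ℂ (basisVec i)).comp (basisIsometry hf) = 0 := by
    refine ext_basisVec fun j => ?_
    rw [ContinuousLinearMap.comp_apply, basisIsometry_apply, innerSL_apply_apply]
    exact orthonormal_basisVec.2 fun h' => h ⟨j, h'.symm⟩
  refine ext_inner_right ℂ fun y => ?_
  rw [ContinuousLinearMap.adjoint_inner_left, inner_zero_left]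
  exact congrArg (fun T : lp (fun _ : J => ℂ) 2 →L[ℂ] ℂ => T y) key

end

variable {V : Type u} [Quiver.{u + 1} V]

/-- On `ℓ²(V × ℕ)` let `p_v` project onto `ℓ²({v} × ℕ)`. For finite nonempty `Star a` a bijection
`Star a × ℕ ≃ ℕ` cuts the range of `p_a` into infinite-dimensional pieces, one for each edge, and
`S_e` maps the range of `p_b` isometrically onto the piece of `e`. -/
theorem exists_family (hlf : LocallyFinite V) :
    ∃ F : CuntzKriegerFamily V, ∀ v, F.p v ≠ 0 := by
  classical
  have ψ : ∀ a : V, Nonempty (Quiver.Star a) → Nonempty (Quiver.Star a × ℕ ≃ ℕ) := fun a ha => by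
    have := hlf.1 a
    exact nonempty_equiv_of_countable
  let H := lp (fun _ : V × ℕ => ℂ) 2
  let K := lp (fun _ : ℕ => ℂ) 2
  have hw : ∀ v : V, Function.Injective fun n : ℕ => (v, n) := fun v m n h => (Prod.mk.inj h).2
  have hs : ∀ {a b : V} (e : a ⟶ b),
      Function.Injective fun n : ℕ => (a, (ψ a ⟨⟨b, e⟩⟩).some (⟨b, e⟩, n)) := fun e m n h => by
    simpa using h
  let W : V → K →L[ℂ] H := fun v => basisIsometry (hw v)
  let U : ∀ {a b : V}, (a ⟶ b) → K →L[ℂ] H := fun e => basisIsometry (hs e)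
  let p : V → H →L[ℂ] H := fun v => W v ∘L ContinuousLinearMap.adjoint (W v)
  have hp : ∀ v n, p v (basisVec (v, n)) = basisVec (v, n) := fun v n => by
    change W v (ContinuousLinearMap.adjoint (W v) (basisVec (v, n))) = _
    rw [adjoint_basisIsometry_apply (hw v) n, basisIsometry_apply]
  have hp' : ∀ v w n, v ≠ w → p v (basisVec (w, n)) = 0 := fun v w n h => by
    change W v (ContinuousLinearMap.adjoint (W v) (basisVec (w, n))) = _
    rw [adjoint_basisIsometry_of_notMem (hw v) (by rintro ⟨m, hm⟩; exact h (Prod.mk.inj hm).1),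
      map_zero]
  have hSS : ∀ {a b : V} (e : a ⟶ b) (x : H), star (U e ∘L ContinuousLinearMap.adjoint (W b)) x =
      W b (ContinuousLinearMap.adjoint (U e) x) := fun e x => by
    rw [ContinuousLinearMap.star_eq_adjoint, ContinuousLinearMap.adjoint_comp,
      ContinuousLinearMap.adjoint_adjoint]
    rfl
  refine ⟨{ B := H →L[ℂ] H, p := p, S := fun {a b} e => U e ∘L ContinuousLinearMap.adjoint (W b),
            isCK := ⟨fun v => ⟨?_, ?_⟩, fun v w h => ?_, fun {a b} e => ?_, fun v hv => ?_⟩ },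
    fun v h => ?_⟩
  · refine ext_basisVec fun ⟨w, n⟩ => ?_
    change p v (p v _) = p v _
    rcases eq_or_ne v w with rfl | h
    · rw [hp, hp]
    · rw [hp' v w n h, map_zero]
  · change star (p v) = p v
    rw [ContinuousLinearMap.star_eq_adjoint, ContinuousLinearMap.adjoint_comp,
      ContinuousLinearMap.adjoint_adjoint]
  · refine ext_basisVec fun ⟨u, n⟩ => ?_
    change p v (p w _) = 0
    rcases eq_or_ne w u with rfl | h'
    · rw [hp, hp' v w n h]
    · rw [hp' w u n h', map_zero]
  · refine ContinuousLinearMap.ext fun x => ?_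
    change star (U e ∘L ContinuousLinearMap.adjoint (W b)) (U e _) = _
    rw [hSS, adjoint_mul_basisIsometry]
    rfl
  · have := hlf.1 v
    have := Fintype.ofFinite (Quiver.Star v)
    rw [finsum_eq_sum_of_fintype]
    refine ext_basisVec fun ⟨w, n⟩ => ?_
    rw [sum_apply]
    have hterm : ∀ e : Quiver.Star v, ((U e.2 ∘L ContinuousLinearMap.adjoint (W e.1)) *
        star (U e.2 ∘L ContinuousLinearMap.adjoint (W e.1))) (basisVec (w, n)) =
        U e.2 (ContinuousLinearMap.adjoint (U e.2) (basisVec (w, n))) := fun e => by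
      rw [mul_apply_eq_comp, hSS, ContinuousLinearMap.comp_apply, adjoint_mul_basisIsometry]
    simp only [hterm]
    rcases eq_or_ne v w with rfl | h
    · rw [hp]
      obtain ⟨⟨e, m⟩, rfl⟩ := (ψ v hv).some.surjective n
      rw [Finset.sum_eq_single e]
      · rw [adjoint_basisIsometry_apply (hs e.2) m, basisIsometry_apply]
      · intro f _ hf
        rw [adjoint_basisIsometry_of_notMem (hs f.2), map_zero]
        rintro ⟨k, hk⟩
        have h1 := (ψ v hv).some.injective (Prod.mk.inj hk).2
        exact hf (Prod.mk.inj h1).1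
      · exact fun h => absurd (Finset.mem_univ e) h
    · rw [hp' v w n h, Finset.sum_eq_zero]
      intro e _
      rw [adjoint_basisIsometry_of_notMem (hs e.2), map_zero]
      rintro ⟨k, hk⟩
      exact h (Prod.mk.inj hk).1
  · have h1 := hp v 0
    have h2 : p v = 0 := h
    rw [h2] at h1
    have h3 := orthonormal_basisVec.ne_zero ((v, 0) : V × ℕ)
    exact h3 h1.symm

theorem P_ne_zero (hlf : LocallyFinite V) (v : V) : P v ≠ 0 := by
  obtain ⟨F, hF⟩ := exists_family hlf
  obtain ⟨φ, hφ, -⟩ := exists_lift F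
  intro h
  exact hF v (by rw [← hφ, h, map_zero])

end Nontrivial

section Core

variable {V : Type u} [Quiver.{u + 1} V]

/-! ### Finiteness of path sets -/

theorem finite_in (hlf : LocallyFinite V) (v : V) (k : ℕ) :
    {q : Σ a : V, Quiver.Path a v | q.2.length = k}.Finite := by
  induction k generalizing v with
  | zero =>
    refine (Set.finite_singleton ⟨v, Quiver.Path.nil⟩).subset ?_
    rintro ⟨a, q⟩ (hq : q.length = 0)
    obtain rfl := q.eq_of_length_zero hq
    obtain rfl := q.eq_nil_of_length_zero hq
    rfl
  | succ k ih =>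
    have := hlf.2 v
    refine (Set.finite_iUnion fun e : Quiver.Costar v => (ih e.1).image
      fun q => (⟨q.1, q.2.cons e.2⟩ : Σ a : V, Quiver.Path a v)).subset ?_
    rintro ⟨a, q⟩ (hq : q.length = k + 1)
    cases q with
    | nil => simp at hq
    | @cons b _ q e =>
      exact Set.mem_iUnion.2 ⟨⟨b, e⟩, ⟨a, q⟩, by simpa using hq, rfl⟩

theorem finite_out (hlf : LocallyFinite V) (v : V) (k : ℕ) :
    {q : Σ b : V, Quiver.Path v b | q.2.length = k}.Finite := by
  induction k with
  | zero =>
    refine (Set.finite_singleton ⟨v, Quiver.Path.nil⟩).subset ?_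
    rintro ⟨a, q⟩ (hq : q.length = 0)
    obtain rfl := q.eq_of_length_zero hq
    obtain rfl := q.eq_nil_of_length_zero hq
    rfl
  | succ k ih =>
    have := hlf.1
    refine (ih.biUnion fun q _ => Set.finite_range
      fun e : Quiver.Star q.1 => (⟨e.1, q.2.cons e.2⟩ : Σ b : V, Quiver.Path v b)).subset ?_
    rintro ⟨a, q⟩ (hq : q.length = k + 1)
    cases q with
    | nil => simp at hq
    | @cons b _ q e =>
      exact Set.mem_iUnion₂.2 ⟨⟨b, q⟩, by simpa using hq, ⟨a, e⟩, rfl⟩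

/-- The paths of length `k` with source `v`. -/
def outPaths (hlf : LocallyFinite V) (v : V) (k : ℕ) : Finset (Σ b : V, Quiver.Path v b) :=
  (finite_out hlf v k).toFinset

theorem mem_outPaths (hlf : LocallyFinite V) {v : V} {k : ℕ} {q : Σ b : V, Quiver.Path v b} :
    q ∈ outPaths hlf v k ↔ q.2.length = k := by simp [outPaths]

theorem outPaths_zero (hlf : LocallyFinite V) (v : V) :
    outPaths hlf v 0 = {⟨v, Quiver.Path.nil⟩} := by
  ext ⟨b, q⟩
  rw [mem_outPaths, Finset.mem_singleton]
  constructor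
  · intro hq
    obtain rfl := q.eq_of_length_zero hq
    obtain rfl := q.eq_nil_of_length_zero hq
    rfl
  · intro h
    cases h
    rfl

theorem sum_outPaths_succ {M : Type*} [AddCommMonoid M] (hlf : LocallyFinite V) (v : V) (k : ℕ)
    [∀ w : V, Fintype (Quiver.Star w)] (f : (Σ b : V, Quiver.Path v b) → M) :
    ∑ q ∈ outPaths hlf v (k + 1), f q =
      ∑ q ∈ outPaths hlf v k, ∑ e : Quiver.Star q.1, f ⟨e.1, q.2.cons e.2⟩ := by
  rw [Finset.sum_sigma']
  symm
  refine Finset.sum_bij (fun x _ => (⟨x.2.1, x.1.2.cons x.2.2⟩ : Σ b : V, Quiver.Path v b))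
    ?_ ?_ ?_ fun _ _ => rfl
  · rintro ⟨q, e⟩ h
    simp only [Finset.mem_sigma, mem_outPaths, Finset.mem_univ, and_true] at h
    simp [mem_outPaths, h]
  · rintro ⟨⟨b, q⟩, ⟨c, e⟩⟩ _ ⟨⟨b', q'⟩, ⟨c', e'⟩⟩ _ h
    cases h
    rfl
  · rintro ⟨c, q⟩ h
    rw [mem_outPaths] at h
    cases q with
    | nil => simp at h
    | @cons b _ q e =>
      exact ⟨⟨⟨b, q⟩, ⟨c, e⟩⟩, by simpa [mem_outPaths] using h, rfl⟩

/-- The paths of length `k` with range `v`. -/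
def inPaths (hlf : LocallyFinite V) (v : V) (k : ℕ) : Finset (Σ a : V, Quiver.Path a v) :=
  (finite_in hlf v k).toFinset

theorem mem_inPaths (hlf : LocallyFinite V) {v : V} {k : ℕ} {q : Σ a : V, Quiver.Path a v} :
    q ∈ inPaths hlf v k ↔ q.2.length = k := by simp [inPaths]

theorem card_inPaths (hlf : LocallyFinite V) (v : V) (k : ℕ) :
    (inPaths hlf v k).card = pathCount v k :=
  (Nat.card_eq_card_finite_toFinset (finite_in hlf v k)).symm

theorem exists_path_to (hns : NoSources V) (v : V) (k : ℕ) :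
    ∃ (a : V) (μ : Quiver.Path a v), μ.length = k := by
  induction k generalizing v with
  | zero => exact ⟨v, Quiver.Path.nil, rfl⟩
  | succ k ih =>
    obtain ⟨b, e⟩ := hns v
    obtain ⟨a, μ, hμ⟩ := ih b
    exact ⟨a, μ.cons e, by simp [hμ]⟩

theorem pathCount_ne_zero (hlf : LocallyFinite V) (hns : NoSources V) (v : V) (k : ℕ) :
    pathCount v k ≠ 0 := by
  obtain ⟨a, μ, hμ⟩ := exists_path_to hns v k
  rw [← card_inPaths hlf]
  exact Finset.card_ne_zero.2 ⟨⟨a, μ⟩, (mem_inPaths hlf).2 hμ⟩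

/-- The embedding of the paths with range `v` into all paths. -/
def inEmb (v : V) : (Σ a : V, Quiver.Path a v) ↪ Pth V :=
  ⟨fun q => ⟨q.1, v, q.2⟩, by rintro ⟨a, q⟩ ⟨a', q'⟩ h; cases h; rfl⟩

/-- The embedding of the paths with source `v` into all paths. -/
def outEmb (v : V) : (Σ b : V, Quiver.Path v b) ↪ Pth V :=
  ⟨fun q => ⟨v, q.1, q.2⟩, by rintro ⟨a, q⟩ ⟨a', q'⟩ h; cases h; rfl⟩

theorem mem_map_inEmb (hlf : LocallyFinite V) {v : V} {k : ℕ} {q : Pth V} :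
    q ∈ (inPaths hlf v k).map (inEmb v) ↔ q.2.1 = v ∧ q.2.2.length = k := by
  rw [Finset.mem_map]
  constructor
  · rintro ⟨p, hp, rfl⟩
    exact ⟨rfl, (mem_inPaths hlf).1 hp⟩
  · obtain ⟨a, b, q⟩ := q
    rintro ⟨rfl, h⟩
    exact ⟨⟨a, q⟩, (mem_inPaths hlf).2 h, rfl⟩

theorem mem_map_outEmb (hlf : LocallyFinite V) {v : V} {k : ℕ} {q : Pth V} :
    q ∈ (outPaths hlf v k).map (outEmb v) ↔ q.1 = v ∧ q.2.2.length = k := by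
  rw [Finset.mem_map]
  constructor
  · rintro ⟨p, hp, rfl⟩
    exact ⟨rfl, (mem_outPaths hlf).1 hp⟩
  · obtain ⟨a, b, q⟩ := q
    rintro ⟨rfl, h⟩
    exact ⟨⟨b, q⟩, (mem_outPaths hlf).2 h, rfl⟩

/-! ### The core as an algebra -/

/-- `p_v`, as an element of the core. -/
def cP (v : V) : core V := ⟨P v, P_mem_core v⟩

/-- `S_μ`, as an element of the core. -/
def cS {a b : V} (μ : Quiver.Path a b) : core V := ⟨pathS μ, pathS_mem_core μ⟩

theorem star_cP (v : V) : star (cP v) = cP v := Subtype.ext (star_P v)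

theorem cP_mul_self (v : V) : cP v * cP v = cP v := Subtype.ext (P_mul_self v)

theorem cP_mul_of_ne {v w : V} (h : v ≠ w) : cP v * cP w = 0 := Subtype.ext (P_mul_P_of_ne h)

theorem cS_mul_cP {a b : V} (μ : Quiver.Path a b) : cS μ * cP b = cS μ :=
  Subtype.ext (pathS_mul_P μ)

theorem cP_mul_cS {a b : V} (μ : Quiver.Path a b) : cP a * cS μ = cS μ :=
  Subtype.ext (P_mul_pathS μ)

theorem cP_mul_star_cS {a b : V} (μ : Quiver.Path a b) : cP b * star (cS μ) = star (cS μ) :=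
  Subtype.ext (P_mul_star_pathS μ)

theorem star_cS_mul_cP {a b : V} (μ : Quiver.Path a b) : star (cS μ) * cP a = star (cS μ) :=
  Subtype.ext (star_pathS_mul_P μ)

theorem star_cS_mul_cS (hlf : LocallyFinite V) {a b : V} (μ : Quiver.Path a b) :
    star (cS μ) * cS μ = cP b := Subtype.ext (star_pathS_mul_pathS hlf μ)

theorem star_cS_mul_cS_of_ne (hlf : LocallyFinite V) {a b a' b' : V} (μ : Quiver.Path a b)
    (ν : Quiver.Path a' b') (hl : μ.length = ν.length) (h : (⟨a, b, μ⟩ : Pth V) ≠ ⟨a', b', ν⟩) :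
    star (cS μ) * cS ν = 0 := Subtype.ext (star_pathS_mul_pathS_of_ne hlf μ ν hl h)

theorem cS_comp {a b c : V} (μ : Quiver.Path a b) (ν : Quiver.Path b c) :
    cS (μ.comp ν) = cS μ * cS ν := Subtype.ext (pathS_comp μ ν)

theorem core_ind (hlf : LocallyFinite V) {p : core V → Prop}
    (mem : ∀ {a b c : V} (α : Quiver.Path a c) (β : Quiver.Path b c), p (cS α * star (cS β)))
    (zero : p 0) (add : ∀ x y, p x → p y → p (x + y)) (smul : ∀ (r : ℂ) x, p x → p (r • x))
    (x : core V) : p x := by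
  obtain ⟨x, hx⟩ := x
  have h := core_induction hlf (p := fun x => ∃ y : core V, (y : GraphCStar V) = x ∧ p y)
    (fun α β => ⟨_, rfl, mem α β⟩) ⟨0, rfl, zero⟩
    (by rintro _ _ ⟨x, rfl, hx⟩ ⟨y, rfl, hy⟩; exact ⟨x + y, rfl, add x y hx hy⟩)
    (by rintro r _ ⟨x, rfl, hx⟩; exact ⟨r • x, rfl, smul r x hx⟩) hx
  obtain ⟨y, hy, hp⟩ := h
  rwa [show y = ⟨x, hx⟩ from Subtype.ext hy] at hp

/-- `p_F = ∑_{v ∈ F} p_v`. -/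
def cPF (F : Finset V) : core V := ∑ v ∈ F, cP v

theorem star_cPF (F : Finset V) : star (cPF F) = cPF F := by
  rw [cPF, star_sum]
  exact Finset.sum_congr rfl fun v _ => star_cP v

theorem cPF_mul_cP {F : Finset V} {v : V} (hv : v ∈ F) : cPF F * cP v = cP v := by
  classical
  rw [cPF, Finset.sum_mul, Finset.sum_eq_single_of_mem v hv, cP_mul_self]
  exact fun w _ hw => cP_mul_of_ne hw

theorem cPF_mul_cPF {F G : Finset V} (h : F ⊆ G) : cPF G * cPF F = cPF F := by
  conv_lhs => rw [cPF.eq_def F]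
  rw [Finset.mul_sum, cPF]
  exact Finset.sum_congr rfl fun v hv => cPF_mul_cP (h hv)

theorem cPF_mul_mono {F G : Finset V} (h : F ⊆ G) {x : core V} (hx : cPF F * x = x) :
    cPF G * x = x := by rw [← hx, ← mul_assoc, cPF_mul_cPF h]

theorem exists_cPF_mul (hlf : LocallyFinite V) (x : core V) : ∃ F : Finset V, cPF F * x = x := by
  classical
  induction x using core_ind hlf with
  | mem α β =>
    rename_i a b c
    refine ⟨{a}, ?_⟩
    rw [cPF, Finset.sum_singleton, ← mul_assoc, cP_mul_cS]
  | zero => exact ⟨∅, mul_zero _⟩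
  | add x y hx hy =>
    obtain ⟨F, hF⟩ := hx
    obtain ⟨G, hG⟩ := hy
    refine ⟨F ∪ G, ?_⟩
    rw [mul_add, cPF_mul_mono Finset.subset_union_left hF,
      cPF_mul_mono Finset.subset_union_right hG]
  | smul r x hx =>
    obtain ⟨F, hF⟩ := hx
    exact ⟨F, by rw [mul_smul_comm, hF]⟩

theorem exists_support (hlf : LocallyFinite V) (x : core V) :
    ∃ F : Finset V, cPF F * x = x ∧ x * cPF F = x := by
  classical
  obtain ⟨F, hF⟩ := exists_cPF_mul hlf x
  obtain ⟨G, hG⟩ := exists_cPF_mul hlf (star x)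
  refine ⟨F ∪ G, cPF_mul_mono Finset.subset_union_left hF, ?_⟩
  have := congrArg star (cPF_mul_mono (Finset.subset_union_right : G ⊆ F ∪ G) hG)
  rwa [star_mul, star_star, star_cPF] at this

/-! ### Homogeneous elements -/

/-- `x` is homogeneous of degree `k` for the gauge action. -/
def Homog (k : ℤ) (x : core V) : Prop :=
  ∀ z : Circle, gauge z (x : GraphCStar V) = (z : ℂ) ^ k • (x : GraphCStar V)

theorem Homog.mul {j k : ℤ} {x y : core V} (hx : Homog j x) (hy : Homog k y) :
    Homog (j + k) (x * y) := fun z => by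
  have h : gauge z ((x * y : core V) : GraphCStar V) =
    gauge z (x : GraphCStar V) * gauge z (y : GraphCStar V) := map_mul (gauge z) _ _
  rw [h, hx z, hy z, smul_mul_smul_comm, ← zpow_add₀ (Circle.coe_ne_zero z)]
  rfl

theorem Homog.star {k : ℤ} {x : core V} (hx : Homog k x) : Homog (-k) (star x) := fun z => by
  have h : gauge z ((Star.star x : core V) : GraphCStar V) = Star.star (gauge z (x : GraphCStar V)) :=
    map_star (gauge z) _
  rw [h, hx z, star_smul, zpow_neg]
  congr 1
  rw [star_zpow₀, Complex.star_def, ← Circle.coe_inv_eq_conj, Circle.coe_inv, inv_zpow]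

theorem Homog.zero (k : ℤ) : Homog k (0 : core V) := fun z => by
  change gauge z (0 : GraphCStar V) = _ • (0 : GraphCStar V)
  rw [map_zero, smul_zero]

theorem Homog.add {k : ℤ} {x y : core V} (hx : Homog k x) (hy : Homog k y) : Homog k (x + y) :=
  fun z => by
    have h : gauge z ((x + y : core V) : GraphCStar V) =
      gauge z (x : GraphCStar V) + gauge z (y : GraphCStar V) := map_add (gauge z) _ _
    rw [h, hx z, hy z, ← smul_add]
    rfl

theorem Homog.smul {k : ℤ} {x : core V} (r : ℂ) (hx : Homog k x) : Homog k (r • x) := fun z => by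
  have h : gauge z ((r • x : core V) : GraphCStar V) = r • gauge z (x : GraphCStar V) :=
    map_smul (gauge z) _ _
  rw [h, hx z, smul_comm]
  rfl

theorem homog_cP (v : V) : Homog 0 (cP v) := fun z => by
  rw [zpow_zero, one_smul]
  exact gauge_P z v

theorem homog_cS {a b : V} (μ : Quiver.Path a b) : Homog μ.length (cS μ) := by
  induction μ with
  | nil => exact homog_cP a
  | @cons b c μ e ih =>
    have he : Homog 1 (⟨S e, S_mem_core e⟩ : core V) := fun z => by
      rw [zpow_one]
      exact gauge_S z e
    have := ih.mul he
    rw [Quiver.Path.length_cons]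
    push_cast
    exact this

theorem homog_gen {a b c : V} (α : Quiver.Path a c) (β : Quiver.Path b c) :
    Homog ((α.length : ℤ) - β.length) (cS α * star (cS β)) := by
  rw [sub_eq_add_neg]
  exact (homog_cS α).mul (homog_cS β).star

theorem homog_cPF (F : Finset V) : Homog 0 (cPF F) := by
  classical
  induction F using Finset.induction_on with
  | empty => exact Homog.zero 0
  | insert v F hv ih => rw [cPF, Finset.sum_insert hv]; exact (homog_cP v).add ih

/-! ### The trace along outgoing paths -/

theorem trace_P_eq_sum (hlf : LocallyFinite V) (τ : GaugeTrace V) (w : V)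
    [Fintype (Quiver.Star w)] (hw : Nonempty (Quiver.Star w)) :
    ∑ e : Quiver.Star w, τ (P e.1) = τ (P w) := by
  have h0 : τ (0 : GraphCStar V) = 0 := by
    have := τ.smul_sq 0 0
    simpa using this
  have key : ∀ s : Finset (Quiver.Star w), τ (∑ e ∈ s, S e.2 * star (S e.2)) =
      ∑ e ∈ s, τ (P e.1) := fun s => by
    classical
    induction s using Finset.induction_on with
    | empty => simpa using h0
    | insert e s he ih =>
      rw [Finset.sum_insert he, Finset.sum_insert he, τ.map_add _ _ (mul_star_self_nonneg _)
        (Finset.sum_nonneg fun _ _ => mul_star_self_nonneg _), ih, ← τ.map_star_mul_self,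
        star_S_mul_S]
  rw [← key, P_eq_sum hlf w hw, finsum_eq_sum_of_fintype]

/-- Prolonging the paths by one edge redistributes the mass `τ(p_w)` of each endpoint that is not a
sink over the ends of its edges. At a sink the mass is lost, which is the only source of inequality.
-/
theorem sum_outPaths_le (hlf : LocallyFinite V) (τ : GaugeTrace V) (v : V) (k : ℕ) :
    ∑ q ∈ outPaths hlf v k, τ (P q.1) ≤ τ (P v) := by
  have := hlf.1
  have := fun w : V => Fintype.ofFinite (Quiver.Star w)
  induction k with
  | zero => rw [outPaths_zero, Finset.sum_singleton]
  | succ k ih =>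
    rw [sum_outPaths_succ]
    refine le_trans (Finset.sum_le_sum fun q _ => ?_) ih
    rcases isEmpty_or_nonempty (Quiver.Star q.1) with h | h
    · rw [Finset.univ_eq_empty, Finset.sum_empty]; exact zero_le
    · exact (trace_P_eq_sum hlf τ q.1 h).le

theorem sum_outPaths_eq (hlf : LocallyFinite V) (τ : GaugeTrace V) {v : V}
    (hv : NoSinksDownstream v) (k : ℕ) :
    ∑ q ∈ outPaths hlf v k, τ (P q.1) = τ (P v) := by
  have := hlf.1
  have := fun w : V => Fintype.ofFinite (Quiver.Star w)
  induction k with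
  | zero => rw [outPaths_zero, Finset.sum_singleton]
  | succ k ih =>
    rw [sum_outPaths_succ, ← ih]
    exact Finset.sum_congr rfl fun q _ => trace_P_eq_sum hlf τ q.1 (hv q.1 ⟨q.2⟩)

end Core

section Hilbert

variable {V : Type u} [Quiver.{u + 1} V] (τ : GaugeTrace V)

/-! ### The representation on the Hilbert space -/

/-- The inclusion of the core into the Hilbert space. -/
def cvec : core V →ₗ[ℂ] L2 τ where
  toFun x := vec τ x x.2
  map_add' x y := UniformSpace.Completion.coe_add (Xc.mk τ x x.2) (Xc.mk τ y y.2)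
  map_smul' c x := UniformSpace.Completion.coe_smul c (Xc.mk τ x x.2)

theorem denseRange_cvec : DenseRange (cvec τ) :=
  UniformSpace.Completion.denseRange_coe (α := Xc τ)

variable {τ} in
theorem ext_cvec {A B : L2 τ →L[ℂ] L2 τ} (h : ∀ x, A (cvec τ x) = B (cvec τ x)) : A = B :=
  DFunLike.coe_injective ((denseRange_cvec τ).equalizer A.continuous B.continuous (funext h))

theorem norm_cvec_sq (x : core V) :
    ‖cvec τ x‖ ^ 2 = (τ (star (x : GraphCStar V) * x)).toReal := by
  have h : ‖cvec τ x‖ = ‖Xc.mk τ x x.2‖ := UniformSpace.Completion.norm_coe _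
  rw [h]
  exact Xc.norm_sq (Xc.mk τ x x.2)

theorem norm_cvec_sq' (x : core V) :
    ‖cvec τ x‖ ^ 2 = (τ ((x : GraphCStar V) * star x)).toReal := by
  rw [norm_cvec_sq, τ.map_star_mul_self]
  rfl

theorem norm_cvec_star (x : core V) : ‖cvec τ (star x)‖ = ‖cvec τ x‖ := by
  rw [← sq_eq_sq₀ (norm_nonneg _) (norm_nonneg _), norm_cvec_sq, norm_cvec_sq']
  exact congrArg (fun y => (τ (y * star (x : GraphCStar V))).toReal) (star_star (x : GraphCStar V))

theorem ne_top_core (x : core V) : τ (star (x : GraphCStar V) * x) ≠ ∞ := (τ.core_lt_top x.2).ne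

theorem re_inner_cvec (x y : core V) :
    (inner ℂ (cvec τ x) (cvec τ y)).re = (‖cvec τ (x + y)‖ ^ 2 - ‖cvec τ (x - y)‖ ^ 2) / 4 := by
  have h1 := norm_add_sq (𝕜 := ℂ) (cvec τ x) (cvec τ y)
  have h2 := norm_sub_sq (𝕜 := ℂ) (cvec τ x) (cvec τ y)
  rw [← map_add] at h1
  rw [← map_sub] at h2
  simp only [RCLike.re_to_complex] at h1 h2
  linarith

/-- The inner product comes from polarisation, so its dependence on `x⋆ y` alone has to be
recovered. The terms are arranged into an identity between sums of positive elements, because `τ` is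
additive only on the positive cone. -/
theorem re_inner_cvec_eq {x y x' y' : core V} (h : star x * y = star x' * y') :
    (inner ℂ (cvec τ x) (cvec τ y)).re = (inner ℂ (cvec τ x') (cvec τ y')).re := by
  have h' : star y * x = star y' * x' := by simpa using congrArg star h
  have key : star (x + y) * (x + y) + star (x' - y') * (x' - y') =
      star (x - y) * (x - y) + star (x' + y') * (x' + y') := by
    simp only [star_add, star_sub, mul_add, add_mul, mul_sub, sub_mul, h, h']
    abel
  have h1 := congrArg (fun z : core V => τ (z : GraphCStar V)) key
  have h2 := τ.map_add _ _ (star_mul_self_nonneg ((x + y : core V) : GraphCStar V))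
    (star_mul_self_nonneg ((x' - y' : core V) : GraphCStar V))
  have h3 := τ.map_add _ _ (star_mul_self_nonneg ((x - y : core V) : GraphCStar V))
    (star_mul_self_nonneg ((x' + y' : core V) : GraphCStar V))
  have h4 := congrArg ENNReal.toReal ((h2.symm.trans h1).trans h3)
  rw [ENNReal.toReal_add (ne_top_core τ _) (ne_top_core τ _),
    ENNReal.toReal_add (ne_top_core τ _) (ne_top_core τ _)] at h4
  simp only [← norm_cvec_sq] at h4
  rw [re_inner_cvec, re_inner_cvec]
  linarith

/-- For a trace `x ↦ x⋆` is isometric, so the previous lemma may be applied to adjoints. -/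
theorem re_inner_cvec_eq' {x y x' y' : core V} (h : y * star x = y' * star x') :
    (inner ℂ (cvec τ x) (cvec τ y)).re = (inner ℂ (cvec τ x') (cvec τ y')).re := by
  have hsw : ∀ x y : core V, (inner ℂ (cvec τ x) (cvec τ y)).re =
      (inner ℂ (cvec τ (star x)) (cvec τ (star y))).re := fun x y => by
    rw [re_inner_cvec, re_inner_cvec, ← star_add, ← star_sub, norm_cvec_star, norm_cvec_star]
  rw [hsw x, hsw x']
  refine re_inner_cvec_eq τ ?_
  simpa using congrArg star h

theorem im_inner_cvec (x y : core V) : (inner ℂ (cvec τ x) (cvec τ y)).im =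
    (inner ℂ (cvec τ (Complex.I • x)) (cvec τ y)).re := by
  rw [map_smul, inner_smul_left]
  simp

theorem inner_cvec_eq {x y x' y' : core V} (h : star x * y = star x' * y') :
    inner ℂ (cvec τ x) (cvec τ y) = inner ℂ (cvec τ x') (cvec τ y') := by
  refine Complex.ext (re_inner_cvec_eq τ h) ?_
  rw [im_inner_cvec, im_inner_cvec]
  refine re_inner_cvec_eq τ ?_
  rw [star_smul, star_smul, smul_mul_assoc, smul_mul_assoc, h]

theorem inner_cvec_eq' {x y x' y' : core V} (h : y * star x = y' * star x') :
    inner ℂ (cvec τ x) (cvec τ y) = inner ℂ (cvec τ x') (cvec τ y') := by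
  refine Complex.ext (re_inner_cvec_eq' τ h) ?_
  rw [im_inner_cvec, im_inner_cvec]
  refine re_inner_cvec_eq' τ ?_
  rw [star_smul, star_smul, mul_smul_comm, mul_smul_comm, h]

variable {τ} in
theorem inner_ext_cvec {A B : L2 τ →L[ℂ] L2 τ}
    (h : ∀ x y, inner ℂ (cvec τ x) (A (cvec τ y)) = inner ℂ (cvec τ x) (B (cvec τ y))) :
    A = B := by
  refine ext_cvec fun y => ?_
  refine ext_inner_left ℂ fun w => ?_
  exact congrFun ((denseRange_cvec τ).equalizer (by fun_prop) (by fun_prop)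
    (funext fun x => h x y : (fun w => inner ℂ w (A (cvec τ y))) ∘ cvec τ =
      (fun w => inner ℂ w (B (cvec τ y))) ∘ cvec τ)) w

theorem rep_cvec (a x : core V) : rep τ a (cvec τ x) = cvec τ (a * x) :=
  ContinuousLinearMap.completion_apply_coe (leftMulXc a) (Xc.mk τ x x.2)

theorem star_rep (a : core V) : star (rep τ a) = rep τ (star a) := by
  refine inner_ext_cvec fun x y => ?_
  rw [ContinuousLinearMap.star_eq_adjoint, ContinuousLinearMap.adjoint_inner_right, rep_cvec,
    rep_cvec]
  refine inner_cvec_eq τ ?_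
  rw [star_mul, mul_assoc]

theorem rep_mul (a b : core V) : rep τ (a * b) = rep τ a * rep τ b :=
  ext_cvec fun x => by rw [mul_apply_eq_comp, rep_cvec, rep_cvec, rep_cvec, mul_assoc]

theorem rep_add (a b : core V) : rep τ (a + b) = rep τ a + rep τ b :=
  ext_cvec fun x => by rw [add_apply, rep_cvec, rep_cvec, rep_cvec, add_mul, map_add]

theorem rep_smul (c : ℂ) (a : core V) : rep τ (c • a) = c • rep τ a :=
  ext_cvec fun x => by rw [smul_apply, rep_cvec, rep_cvec, smul_mul_assoc, map_smul]

theorem rep_zero : rep τ (0 : core V) = 0 :=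
  ext_cvec fun x => by rw [zero_apply, rep_cvec, zero_mul, map_zero]

/-- The representation as a ⋆-homomorphism. -/
def repHom : core V →⋆ₙₐ[ℂ] (L2 τ →L[ℂ] L2 τ) where
  toFun := rep τ
  map_smul' := rep_smul τ
  map_zero' := rep_zero τ
  map_add' := rep_add τ
  map_mul' := rep_mul τ
  map_star' a := (star_rep τ a).symm

theorem inner_rep_left (a : core V) (x y : L2 τ) :
    inner ℂ (rep τ a x) y = inner ℂ x (rep τ (star a) y) := by
  rw [← star_rep, ContinuousLinearMap.star_eq_adjoint, ContinuousLinearMap.adjoint_inner_right]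

/-! ### Right multiplication -/

/-- Right multiplication by `f` on `X_c`. -/
def rightMulXc (f : core V) : Xc τ →L[ℂ] Xc τ :=
  LinearMap.mkContinuous
    { toFun := fun x => Xc.mk τ (x.val * (f : GraphCStar V)) (mul_mem x.val_mem f.2)
      map_add' := fun x y =>
        Subtype.ext (p := fun a => a ∈ core V) (add_mul x.val y.val (f : GraphCStar V))
      map_smul' := fun c x =>
        Subtype.ext (p := fun a => a ∈ core V) (smul_mul_assoc c x.val (f : GraphCStar V)) }
    ‖(f : GraphCStar V)‖ fun x => by
      rw [← sq_le_sq₀ (norm_nonneg _) (by positivity), mul_pow, Xc.norm_sq, Xc.norm_sq]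
      -- Traciality turns right multiplication by `f` into left multiplication of `x⋆` by `f⋆`.
      have h1 := τ.star_mul_le (star (f : GraphCStar V)) (star x.val)
      rw [← star_mul, star_star, star_star, norm_star, ← τ.map_star_mul_self,
        ← τ.map_star_mul_self] at h1
      have h := ENNReal.toReal_mono (ENNReal.mul_ne_top ENNReal.ofReal_ne_top x.ne_top) h1
      rw [ENNReal.toReal_mul, ENNReal.toReal_ofReal (by positivity)] at h
      exact h

/-- Right multiplication by `f` on `H`. -/
def rightMul (f : core V) : L2 τ →L[ℂ] L2 τ := (rightMulXc τ f).completion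

theorem rightMul_cvec (f x : core V) : rightMul τ f (cvec τ x) = cvec τ (x * f) :=
  ContinuousLinearMap.completion_apply_coe (rightMulXc τ f) (Xc.mk τ x x.2)

theorem star_rightMul (f : core V) : star (rightMul τ f) = rightMul τ (star f) := by
  refine inner_ext_cvec fun x y => ?_
  rw [ContinuousLinearMap.star_eq_adjoint, ContinuousLinearMap.adjoint_inner_right, rightMul_cvec,
    rightMul_cvec]
  refine inner_cvec_eq' τ ?_
  rw [star_mul, mul_assoc]

theorem rightMul_rep (f a : core V) : rightMul τ f * rep τ a = rep τ a * rightMul τ f :=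
  ext_cvec fun x => by
    rw [mul_apply_eq_comp, mul_apply_eq_comp, rep_cvec, rightMul_cvec, rightMul_cvec, rep_cvec,
      mul_assoc]

/-! ### The spectral decomposition of the gauge action -/

theorem gaugeL2_cvec (z : Circle) (x : core V) :
    gaugeL2 τ z (cvec τ x) = cvec τ ⟨gauge z x, gauge_mem_core z x.2⟩ :=
  ContinuousLinearMap.completion_apply_coe (gaugeXc z) (Xc.mk τ x x.2)

theorem norm_gaugeL2 (z : Circle) (y : L2 τ) : ‖gaugeL2 τ z y‖ = ‖y‖ := by
  refine congrFun ((denseRange_cvec τ).equalizer (by fun_prop) (by fun_prop)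
    (funext fun x => ?_ : (fun w => ‖gaugeL2 τ z w‖) ∘ cvec τ = (fun w => ‖w‖) ∘ cvec τ)) y
  change ‖gaugeL2 τ z (cvec τ x)‖ = ‖cvec τ x‖
  rw [gaugeL2_cvec, ← sq_eq_sq₀ (norm_nonneg _) (norm_nonneg _), norm_cvec_sq, norm_cvec_sq]
  change (τ (star (gauge z (x : GraphCStar V)) * gauge z (x : GraphCStar V))).toReal = _
  rw [← map_star, ← map_mul, τ.gauge_invariant z _ (star_mul_self_nonneg _)]

theorem inner_gaugeL2 (z : Circle) (x y : L2 τ) :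
    inner ℂ (gaugeL2 τ z x) (gaugeL2 τ z y) = inner ℂ x y :=
  LinearIsometry.inner_map_map (⟨gaugeL2 τ z, norm_gaugeL2 τ z⟩ : L2 τ →ₗᵢ[ℂ] L2 τ) x y

variable {τ} in
theorem mem_spectralSubspace {k : ℤ} {y : L2 τ} :
    y ∈ spectralSubspace τ k ↔ ∀ z : Circle, gaugeL2 τ z y = (z : ℂ) ^ k • y := by
  rw [spectralSubspace, Submodule.mem_iInf]
  refine forall_congr' fun z => ?_
  rw [LinearMap.mem_ker]
  exact sub_eq_zero

theorem exists_circle_zpow_ne_one {n : ℤ} (hn : n ≠ 0) : ∃ z : Circle, (z : ℂ) ^ n ≠ 1 := by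
  refine ⟨Circle.exp (Real.pi / n), ?_⟩
  have hn' : (n : ℂ) ≠ 0 := by exact_mod_cast hn
  rw [Circle.coe_exp, ← Complex.exp_int_mul]
  push_cast
  rw [show (n : ℂ) * (Real.pi / n * Complex.I) = Real.pi * Complex.I by field_simp,
    Complex.exp_pi_mul_I]
  norm_num

theorem isOrtho_spectralSubspace {j k : ℤ} (h : j ≠ k) :
    Submodule.IsOrtho (spectralSubspace τ j) (spectralSubspace τ k) := by
  rw [Submodule.isOrtho_iff_inner_eq]
  intro x hx y hy
  rw [mem_spectralSubspace] at hx hy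
  obtain ⟨z, hz⟩ := exists_circle_zpow_ne_one (sub_ne_zero.2 h.symm)
  have h1 := inner_gaugeL2 τ z x y
  rw [hx, hy, inner_smul_left, inner_smul_right, ← mul_assoc, map_zpow₀,
    ← Circle.coe_inv_eq_conj, Circle.coe_inv, inv_zpow, ← zpow_neg,
    ← zpow_add₀ (Circle.coe_ne_zero z)] at h1
  by_contra h0
  exact hz (by rw [sub_eq_add_neg, add_comm]; exact mul_right_cancel₀ h0 (h1.trans (one_mul _).symm))

theorem cvec_mem_spectralSubspace {k : ℤ} {x : core V} (hx : Homog k x) :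
    cvec τ x ∈ spectralSubspace τ k := by
  rw [mem_spectralSubspace]
  intro z
  rw [gaugeL2_cvec, ← map_smul]
  exact congrArg (cvec τ) (Subtype.ext (hx z))

theorem isGrading (hlf : LocallyFinite V) : IsGrading (Phi τ) := by
  refine IsGrading.of_dense (fun k => isStarProjection_starProjection) (fun j k h => ?_) ?_
  · exact (isOrtho_spectralSubspace τ h).starProjection_comp_starProjection
  · refine (denseRange_cvec τ).mono ?_
    rintro _ ⟨x, rfl⟩
    induction x using core_ind hlf with
    | mem α β =>
      exact Submodule.subset_span ⟨_, Submodule.starProjection_eq_self_iff.2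
        (cvec_mem_spectralSubspace τ (homog_gen α β))⟩
    | zero => rw [map_zero]; exact zero_mem _
    | add x y hx hy => rw [map_add]; exact add_mem hx hy
    | smul r x hx => rw [map_smul]; exact Submodule.smul_mem _ _ hx

theorem Phi_cvec {k : ℤ} {x : core V} (hx : Homog k x) : Phi τ k (cvec τ x) = cvec τ x :=
  Submodule.starProjection_eq_self_iff.2 (cvec_mem_spectralSubspace τ hx)

theorem Phi_cvec_of_ne (hlf : LocallyFinite V) {j k : ℤ} (h : k ≠ j) {x : core V}
    (hx : Homog j x) : Phi τ k (cvec τ x) = 0 := by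
  rw [← Phi_cvec τ hx, (isGrading τ hlf).apply_ne h]

/-- The spectral projections preserve the core, so density arguments can be carried out inside a
single degree. -/
theorem exists_Phi_cvec (hlf : LocallyFinite V) (k : ℤ) (x : core V) :
    ∃ y : core V, Homog k y ∧ Phi τ k (cvec τ x) = cvec τ y := by
  induction x using core_ind hlf with
  | mem α β =>
    by_cases h : k = (α.length : ℤ) - β.length
    · subst h
      exact ⟨_, homog_gen α β, Phi_cvec τ (homog_gen α β)⟩
    · exact ⟨0, Homog.zero k, by rw [map_zero]; exact Phi_cvec_of_ne τ hlf h (homog_gen α β)⟩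
  | zero => exact ⟨0, Homog.zero k, by rw [map_zero, map_zero]⟩
  | add x y hx hy =>
    obtain ⟨x', h1, h2⟩ := hx
    obtain ⟨y', h3, h4⟩ := hy
    exact ⟨x' + y', h1.add h3, by rw [map_add, map_add, map_add, h2, h4]⟩
  | smul r x hx =>
    obtain ⟨x', h1, h2⟩ := hx
    exact ⟨r • x', h1.smul r, by rw [map_smul, map_smul, map_smul, h2]⟩

/-- Equality of operators can be tested on the vectors `S_α S_β⋆`. -/
theorem ext_gen (hlf : LocallyFinite V) {A B : L2 τ →L[ℂ] L2 τ}
    (h : ∀ {a b c : V} (α : Quiver.Path a c) (β : Quiver.Path b c),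
      A (cvec τ (cS α * star (cS β))) = B (cvec τ (cS α * star (cS β)))) : A = B := by
  refine ext_cvec fun x => ?_
  induction x using core_ind hlf with
  | mem α β => exact h α β
  | zero => rw [map_zero, map_zero, map_zero]
  | add x y hx hy => rw [map_add, map_add, map_add, hx, hy]
  | smul r x hx => rw [map_smul, map_smul, map_smul, hx]

/-- An operator that shifts the degree by `m`. -/
theorem Phi_shift (hlf : LocallyFinite V) {m : ℤ} {T : L2 τ →L[ℂ] L2 τ}
    (hT : ∀ {j : ℤ} {x : core V}, Homog j x → Phi τ (j + m) (T (cvec τ x)) = T (cvec τ x))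
    (k : ℤ) : Phi τ (k + m) * T = T * Phi τ k := by
  refine ext_gen τ hlf fun α β => ?_
  rw [mul_apply_eq_comp, mul_apply_eq_comp]
  by_cases h : k = (α.length : ℤ) - β.length
  · subst h
    rw [hT (homog_gen α β), Phi_cvec τ (homog_gen α β)]
  · rw [Phi_cvec_of_ne τ hlf h (homog_gen α β), map_zero, ← hT (homog_gen α β),
      (isGrading τ hlf).apply_ne (by simpa using h)]

theorem Phi_rep (hlf : LocallyFinite V) {m : ℤ} {a : core V} (ha : Homog m a) (k : ℤ) :
    Phi τ (k + m) * rep τ a = rep τ a * Phi τ k :=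
  Phi_shift τ hlf (fun hx => by
    rw [rep_cvec, add_comm]
    exact Phi_cvec τ (ha.mul hx)) k

theorem Phi_rightMul (hlf : LocallyFinite V) {m : ℤ} {a : core V} (ha : Homog m a) (k : ℤ) :
    Phi τ (k + m) * rightMul τ a = rightMul τ a * Phi τ k :=
  Phi_shift τ hlf (fun hx => by
    rw [rightMul_cvec]
    exact Phi_cvec τ (hx.mul ha)) k

theorem isDiagonal_gaugeOp (hlf : LocallyFinite V) (f : ℤ → ℝ) :
    IsDiagonal (Phi τ) f (gaugeOp τ f) := by
  have hΦ := isGrading τ hlf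
  have hsm : ∀ (r : ℝ) (x : L2 τ), r • x = (r : ℂ) • x := fun r x => (Complex.coe_smul r x).symm
  intro x y
  rw [LinearPMap.mem_graph_iff]
  constructor
  · rintro ⟨⟨w, hw⟩, rfl, rfl⟩ k
    change Phi τ k (∑' j : ℤ, f j • Phi τ j w) = _
    rw [hΦ.apply_tsum (fun j => ?_) hw, hsm]
    rw [hsm, map_smul, hΦ.apply_self]
  · intro h
    have h1 : HasSum (fun k => f k • Phi τ k x) y := by
      have := hΦ.hasSum y
      simp only [h] at this
      simpa only [hsm] using this
    exact ⟨⟨x, h1.summable⟩, rfl, h1.tsum_eq⟩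

theorem isDiagonal_dirac (hlf : LocallyFinite V) :
    IsDiagonal (Phi τ) (fun k => (k : ℝ)) (dirac τ) := isDiagonal_gaugeOp τ hlf _

theorem isDiagonal_absDirac (hlf : LocallyFinite V) :
    IsDiagonal (Phi τ) (fun k => |(k : ℝ)|) (absDirac τ) := isDiagonal_gaugeOp τ hlf _

theorem one_le_abs_intCast {k : ℤ} (hk : (k : ℝ) ≠ 0) : 1 ≤ |(k : ℝ)| := by
  rw [← Int.cast_abs]
  exact_mod_cast Int.one_le_abs (by exact_mod_cast hk)

theorem isAbsoluteValue_absDirac (hlf : LocallyFinite V) :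
    IsAbsoluteValue (dirac τ) (absDirac τ) where
  selfAdjoint := (isDiagonal_absDirac τ hlf).isSelfAdjoint (isGrading τ hlf)
  nonneg := (isDiagonal_absDirac τ hlf).inner_nonneg (isGrading τ hlf) fun k => abs_nonneg _
  sq x y := by
    rw [(isDiagonal_absDirac τ hlf).sqRel_iff (isGrading τ hlf)
        (fun k hk => by rw [abs_abs]; exact one_le_abs_intCast (abs_ne_zero.1 hk)),
      (isDiagonal_dirac τ hlf).sqRel_iff (isGrading τ hlf) fun k hk => one_le_abs_intCast hk]
    simp only [sq_abs]

/-! ### The von Neumann algebra -/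

theorem rankOne_mem (x y : core V) : rankOne τ x y ∈ gaugeN τ := by
  change rankOne τ x y ∈ StarSubalgebra.centralizer ℂ _
  rw [StarSubalgebra.mem_centralizer_iff]
  intro U hU
  have hx : rankOne τ x y ∈ Submodule.span ℂ {T | ∃ x y : core V, T = rankOne τ x y} :=
    Submodule.subset_span ⟨x, y, rfl⟩
  have h1 := (StarSubalgebra.mem_centralizer_iff ℂ).1 hU _ hx
  have h2 := (StarSubalgebra.mem_centralizer_iff ℂ).1 (star_mem hU) _ hx
  exact ⟨h1.1.symm, h2.1.symm⟩

theorem commute_rankOne {U : L2 τ →L[ℂ] L2 τ} (hU : U ∈ (gaugeN τ).commutant) (x y : core V) :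
    rankOne τ x y * U = U * rankOne τ x y :=
  VonNeumannAlgebra.mem_commutant_iff.1 hU _ (rankOne_mem τ x y)

/-- As `p_F` has degree `0` and `x p_F = x`, the vector `x` is `Θ_{x, p_F} p_F`; commuting `U` past
`Θ` exhibits `U x` as `x` times a vector of degree `0`. Hence `U` commutes with left multiplication
and preserves degrees, which puts `A_c` and the `Φ_k` into `N`. -/
theorem commutant_cvec {U : L2 τ →L[ℂ] L2 τ}
    (hU : U ∈ (gaugeN τ).commutant) {x : core V} {F : Finset V} (hF : x * cPF F = x) :
    U (cvec τ x) = rep τ x (Phi τ 0 (rep τ (cPF F) (U (cvec τ (cPF F))))) := by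
  have h := congrArg (fun T : L2 τ →L[ℂ] L2 τ => T (cvec τ (cPF F)))
    (commute_rankOne τ hU x (cPF F))
  simp only [rankOne, mul_apply_eq_comp, star_cPF] at h
  rw [h, rep_cvec, cPF_mul_cPF (Finset.Subset.refl F), Phi_cvec τ (homog_cPF F), rep_cvec, hF]

theorem rep_mem (hlf : LocallyFinite V) (a : core V) : rep τ a ∈ gaugeN τ := by
  rw [mem_vonNeumann_iff]
  intro U hU
  refine ext_cvec fun x => ?_
  obtain ⟨F, -, hF⟩ := exists_support hlf x
  rw [mul_apply_eq_comp, mul_apply_eq_comp, rep_cvec, commutant_cvec τ hU hF,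
    commutant_cvec τ hU (x := a * x) (F := F) (by rw [mul_assoc, hF]), rep_mul]
  rfl

theorem commutant_Phi (hlf : LocallyFinite V) {U : L2 τ →L[ℂ] L2 τ}
    (hU : U ∈ (gaugeN τ).commutant) (k : ℤ) : U * Phi τ k = Phi τ k * U := by
  have h := Phi_shift τ hlf (m := 0) (T := U) (fun {j x} hx => ?_) k
  · rw [add_zero] at h
    exact h.symm
  · obtain ⟨F, -, hF⟩ := exists_support hlf x
    rw [add_zero, commutant_cvec τ hU hF]
    have h1 := congrArg (fun T : L2 τ →L[ℂ] L2 τ => T (rep τ (cPF F) (U (cvec τ (cPF F)))))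
      (Phi_rep τ hlf hx 0)
    simp only [mul_apply_eq_comp, zero_add] at h1
    rw [← h1, (isGrading τ hlf).apply_self]

theorem Phi_mem (hlf : LocallyFinite V) (k : ℤ) : Phi τ k ∈ gaugeN τ :=
  mem_vonNeumann_iff.2 fun _ hU => commutant_Phi τ hlf hU k

theorem diag_mem (hlf : LocallyFinite V) {f : ℤ → ℂ} {T : L2 τ →L[ℂ] L2 τ}
    (hT : ∀ k x, Phi τ k (T x) = f k • Phi τ k x) : T ∈ gaugeN τ :=
  mem_vonNeumann_iff.2 fun _ hU =>
    (isGrading τ hlf).commute_diag hT (commutant_Phi τ hlf hU)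

/-- Right multiplications commute with left ones, and with `Φ_0` if the factor has degree `0`, hence
with every `Θ_{x, y}`. The centraliser condition also involves adjoints, which are treated through
`f⋆`. -/
theorem rightMul_mem_commutant (hlf : LocallyFinite V) {f : core V} (hf : Homog 0 f) :
    rightMul τ f ∈ (gaugeN τ).commutant := by
  have key : ∀ f : core V, Homog 0 f → ∀ T ∈ Submodule.span ℂ
      {T | ∃ x y : core V, T = rankOne τ x y}, T * rightMul τ f = rightMul τ f * T := by
    intro f hf T hT
    induction hT using Submodule.span_induction with
    | mem T hT =>
      obtain ⟨x, y, rfl⟩ := hT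
      have h := Phi_rightMul τ hlf hf 0
      rw [add_zero] at h
      rw [rankOne, mul_assoc, ← rightMul_rep, ← mul_assoc, mul_assoc (rep τ x), h, ← mul_assoc,
        ← mul_assoc, ← mul_assoc, rightMul_rep]
    | zero => rw [zero_mul, mul_zero]
    | add A B _ _ hA hB => rw [add_mul, mul_add, hA, hB]
    | smul r A _ hA => rw [smul_mul_assoc, mul_smul_comm, hA]
  have hmem : rightMul τ f ∈ StarSubalgebra.centralizer ℂ
      (Submodule.span ℂ {T | ∃ x y : core V, T = rankOne τ x y} : Set (L2 τ →L[ℂ] L2 τ)) := by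
    rw [StarSubalgebra.mem_centralizer_iff]
    refine fun T hT => ⟨key f hf T hT, ?_⟩
    have h := congrArg star (key (star f) (by simpa using hf.star) T hT)
    rw [star_mul, star_mul, star_rightMul, star_star] at h
    exact h.symm
  rw [VonNeumannAlgebra.mem_commutant_iff]
  intro T hT
  exact (((StarSubalgebra.mem_centralizer_iff ℂ).1 hT _ hmem).1).symm

theorem rightMul_comm (hlf : LocallyFinite V) {f : core V} (hf : Homog 0 f) {T : L2 τ →L[ℂ] L2 τ}
    (hT : T ∈ gaugeN τ) (x : L2 τ) : T (rightMul τ f x) = rightMul τ f (T x) :=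
  congrArg (fun A : L2 τ →L[ℂ] L2 τ => A x)
    (VonNeumannAlgebra.mem_commutant_iff.1 (rightMul_mem_commutant τ hlf hf) T hT)

end Hilbert

section Frame

variable {V : Type u} [Quiver.{u + 1} V] (τ : GaugeTrace V)

/-! ### The trace frame -/

/-- The weight of `⟨S_μ⋆, T S_μ⋆⟩` in the trace. -/
def weight (q : Pth V) : ℝ :=
  if q.2.2.length = 0 then 0 else 1 / (pathCount q.2.1 q.2.2.length : ℝ)

theorem weight_nonneg (q : Pth V) : 0 ≤ weight q := by
  rw [weight]
  split_ifs <;> positivity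

/-- The elements whose vector states sum up to the trace. -/
def frameElt : Pth V × Bool → core V
  | (q, true) => cS q.2.2
  | (q, false) => ((√(weight q) : ℝ) : ℂ) • star (cS q.2.2)

/-- The right support of a frame element. -/
def frameVertex : Pth V × Bool → V
  | (q, true) => q.2.1
  | (q, false) => q.1

theorem frameElt_mul_cP (i : Pth V × Bool) : frameElt i * cP (frameVertex i) = frameElt i := by
  obtain ⟨⟨a, b, μ⟩, _ | _⟩ := i
  · rw [frameElt, frameVertex, smul_mul_assoc, star_cS_mul_cP]
  · exact cS_mul_cP μ

/-- The frame operators. -/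
def frameOp (i : Pth V × Bool) : L2 τ →L[ℂ] L2 τ := rep τ (frameElt i) * Phi τ 0

theorem star_Phi (hlf : LocallyFinite V) (k : ℤ) : star (Phi τ k) = Phi τ k :=
  ((isGrading τ hlf).proj k).isSelfAdjoint

theorem star_frameOp (hlf : LocallyFinite V) (i : Pth V × Bool) :
    star (frameOp τ i) = Phi τ 0 * rep τ (star (frameElt i)) := by
  rw [frameOp, star_mul, star_rep, star_Phi τ hlf]

theorem vecTrace_frame (T : L2 τ →L[ℂ] L2 τ) : vecTrace (fun i => cvec τ (frameElt i)) T =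
    ∑' q : Pth V, (ENNReal.ofReal (inner ℂ (cvec τ (cS q.2.2)) (T (cvec τ (cS q.2.2)))).re +
      ENNReal.ofReal (weight q *
        (inner ℂ (cvec τ (star (cS q.2.2))) (T (cvec τ (star (cS q.2.2))))).re)) := by
  refine (ENNReal.tsum_prod (f := fun (q : Pth V) (b : Bool) => ENNReal.ofReal
    (inner ℂ (cvec τ (frameElt (q, b))) (T (cvec τ (frameElt (q, b))))).re)).trans ?_
  refine tsum_congr fun q => ?_
  rw [tsum_bool, add_comm]
  congr 2
  rw [frameElt, map_smul, map_smul, inner_smul_left, inner_smul_right, Complex.conj_ofReal,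
    ← mul_assoc, ← Complex.ofReal_mul, Real.mul_self_sqrt (weight_nonneg q), Complex.re_ofReal_mul]

/-- Positivity makes both vector states nonnegative, so the truncation may be applied to each
separately. The weight `0` on paths of length `0` keeps `p_v` from being counted twice. -/
theorem tildeTrace_eq {T : L2 τ →L[ℂ] L2 τ} (hT : 0 ≤ T) :
    tildeTrace τ T = vecTrace (fun i => cvec τ (frameElt i)) T := by
  rw [vecTrace_frame, tildeTrace]
  refine tsum_congr fun q => ?_
  rw [← ENNReal.ofReal_add (re_inner_nonneg hT _)
    (mul_nonneg (weight_nonneg q) (re_inner_nonneg hT _))]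
  congr 1
  rw [omegaPath, weight]
  split_ifs
  · rw [zero_mul, add_zero]; rfl
  · rfl

/-- Needed because `tildeTrace` and `vecTrace` truncate negative values at different places, and
agreement is established on positive operators only. -/
theorem IsFaithfulNormalSemifiniteTrace.congr {H : Type*} [NormedAddCommGroup H]
    [InnerProductSpace ℂ H] [CompleteSpace H] {N : VonNeumannAlgebra H} {t t' : (H →L[ℂ] H) → ℝ≥0∞}
    (ht : IsFaithfulNormalSemifiniteTrace N t) (h : ∀ T, 0 ≤ T → t' T = t T) :
    IsFaithfulNormalSemifiniteTrace N t' where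
  map_add A hA B hB hA0 hB0 := by
    rw [h _ hA0, h _ hB0, h _ (add_nonneg hA0 hB0), ht.map_add A hA B hB hA0 hB0]
  map_smul r hr A hA hA0 := by
    have h1 : 0 ≤ (r : ℂ) • A := smul_nonneg (Complex.zero_le_real.2 hr) hA0
    rw [h _ hA0, h _ h1, ht.map_smul r hr A hA hA0]
  tracial A hA := by
    rw [h _ (star_mul_self_nonneg A), h _ (mul_star_self_nonneg A), ht.tracial A hA]
  faithful A hA hA0 h0 := ht.faithful A hA hA0 (by rw [← h _ hA0, h0])
  normal s hs hpos hne hdir B hB hlub := by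
    obtain ⟨A, hA⟩ := hne
    rw [h B ((hpos A hA).trans (hlub.1 hA)), ht.normal s hs hpos ⟨A, hA⟩ hdir B hB hlub]
    refine iSup_congr fun A => iSup_congr fun hA => (h A (hpos A hA)).symm
  semifinite A hA hA0 hne := by
    obtain ⟨B, hB, hB0, hle, hBne, hfin⟩ := ht.semifinite A hA hA0 hne
    exact ⟨B, hB, hB0, hle, hBne, by rwa [h B hB0]⟩

/-! ### The spectral projections `p_v Φ_k` -/

theorem rep_cP_proj (v : V) : IsStarProjection (rep τ (cP v)) where
  isIdempotentElem := by
    change rep τ (cP v) * rep τ (cP v) = _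
    rw [← rep_mul, cP_mul_self]
  isSelfAdjoint := by
    change star (rep τ (cP v)) = _
    rw [star_rep, star_cP]

theorem Phi_rep_zero (hlf : LocallyFinite V) {a : core V} (ha : Homog 0 a) (k : ℤ) :
    Phi τ k * rep τ a = rep τ a * Phi τ k := by
  simpa using Phi_rep τ hlf ha k

theorem cut_proj (hlf : LocallyFinite V) (v : V) (k : ℤ) :
    IsStarProjection (rep τ (cP v) * Phi τ k) := by
  have hc := Phi_rep_zero τ hlf (homog_cP v) k
  refine ⟨?_, ?_⟩
  · change _ * _ * (_ * _) = _
    rw [mul_assoc, ← mul_assoc (Phi τ k), hc, mul_assoc (rep τ (cP v)),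
      ((isGrading τ hlf).proj k).isIdempotentElem.eq, ← mul_assoc,
      (rep_cP_proj τ v).isIdempotentElem.eq]
  · change star (_ * _) = _
    rw [star_mul, star_Phi τ hlf, (rep_cP_proj τ v).isSelfAdjoint.star_eq, hc]

theorem cut_mem (hlf : LocallyFinite V) (v : V) (k : ℤ) : rep τ (cP v) * Phi τ k ∈ gaugeN τ :=
  mul_mem (rep_mem τ hlf _) (Phi_mem τ hlf k)

theorem re_inner_proj {H : Type*} [NormedAddCommGroup H] [InnerProductSpace ℂ H] [CompleteSpace H]
    {E : H →L[ℂ] H} (hE : IsStarProjection E) (x : H) :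
    (inner ℂ x (E x)).re = ‖E x‖ ^ 2 := by
  have h := re_inner_star_mul_self E x
  rwa [hE.isSelfAdjoint.star_eq, hE.isIdempotentElem.eq] at h

theorem ofReal_norm_cS (hlf : LocallyFinite V) {a b : V} (μ : Quiver.Path a b) :
    ENNReal.ofReal (‖cvec τ (cS μ)‖ ^ 2) = τ (P b) := by
  rw [norm_cvec_sq, ENNReal.ofReal_toReal (ne_top_core τ _)]
  exact congrArg τ.toFun (star_pathS_mul_pathS hlf μ)

theorem cP_mul_cS_of_ne {v a b : V} (μ : Quiver.Path a b) (h : v ≠ a) : cP v * cS μ = 0 := by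
  rw [← cP_mul_cS, ← mul_assoc, cP_mul_of_ne h, zero_mul]

theorem cP_mul_star_cS_of_ne {v a b : V} (μ : Quiver.Path a b) (h : v ≠ b) :
    cP v * star (cS μ) = 0 := by
  rw [← cP_mul_star_cS, ← mul_assoc, cP_mul_of_ne h, zero_mul]

theorem cut_eq_zero (hlf : LocallyFinite V) {v : V} {k j : ℤ} {x : core V} (hx : Homog j x)
    (h : k ≠ j ∨ cP v * x = 0) : (rep τ (cP v) * Phi τ k) (cvec τ x) = 0 := by
  rw [mul_apply_eq_comp]
  by_cases hk : k = j
  · subst hk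
    rw [Phi_cvec τ hx, rep_cvec, h.resolve_left fun h => h rfl, map_zero]
  · rw [Phi_cvec_of_ne τ hlf hk hx, map_zero]

theorem cut_eq_self {v : V} {k : ℤ} {x : core V} (hx : Homog k x)
    (h : cP v * x = x) : (rep τ (cP v) * Phi τ k) (cvec τ x) = cvec τ x := by
  rw [mul_apply_eq_comp, Phi_cvec τ hx, rep_cvec, h]

/-- Degree and left support select the vectors `S_μ` with `s(μ) = v` and `|μ| = n`. Each contributes
`‖S_μ‖² = τ(S_μ⋆ S_μ) = τ(p_{r(μ)})`. -/
theorem trace_cut_nat (hlf : LocallyFinite V) (v : V) (n : ℕ) :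
    vecTrace (fun i => cvec τ (frameElt i)) (rep τ (cP v) * Phi τ n) =
      ∑ q ∈ outPaths hlf v n, τ (P q.1) := by
  have hE := cut_proj τ hlf v n
  rw [vecTrace_frame]
  simp only [re_inner_proj hE]
  rw [tsum_eq_sum (s := (outPaths hlf v n).map (outEmb v)), Finset.sum_map]
  · refine Finset.sum_congr rfl fun ⟨b, μ⟩ hq => ?_
    rw [mem_outPaths] at hq
    subst hq
    change ENNReal.ofReal (‖(rep τ (cP v) * Phi τ μ.length) (cvec τ (cS μ))‖ ^ 2) +
      ENNReal.ofReal (weight ⟨v, b, μ⟩ *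
        ‖(rep τ (cP v) * Phi τ μ.length) (cvec τ (star (cS μ)))‖ ^ 2) = τ (P b)
    rw [cut_eq_self τ (homog_cS μ) (cP_mul_cS μ), ofReal_norm_cS τ hlf μ]
    -- In degree `0` the vectors `S_μ` and `S_μ⋆` coincide and the weight removes the second copy;
    -- otherwise `S_μ⋆` has the wrong sign of degree.
    rcases Nat.eq_zero_or_pos μ.length with h0 | h0
    · rw [show weight (⟨v, b, μ⟩ : Pth V) = 0 from if_pos h0]
      simp
    · rw [cut_eq_zero τ hlf (homog_cS μ).star (Or.inl (by simp; lia))]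
      simp
  · rintro ⟨a, b, μ⟩ hq
    rw [mem_map_outEmb] at hq
    have h1 : (rep τ (cP v) * Phi τ n) (cvec τ (cS μ)) = 0 := by
      refine cut_eq_zero τ hlf (homog_cS μ) ?_
      by_cases h : a = v
      · exact Or.inl fun h' => hq ⟨h, by exact_mod_cast h'.symm⟩
      · exact Or.inr (cP_mul_cS_of_ne μ (Ne.symm h))
    change ENNReal.ofReal (‖(rep τ (cP v) * Phi τ n) (cvec τ (cS μ))‖ ^ 2) + ENNReal.ofReal
      (weight ⟨a, b, μ⟩ * ‖(rep τ (cP v) * Phi τ n) (cvec τ (star (cS μ)))‖ ^ 2) = 0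
    rw [h1]
    rcases Nat.eq_zero_or_pos μ.length with h0 | h0
    · rw [show weight (⟨a, b, μ⟩ : Pth V) = 0 from if_pos h0]
      simp
    · rw [cut_eq_zero τ hlf (homog_cS μ).star (Or.inl (by lia))]
      simp

/-- Now the `S_μ⋆` with `r(μ) = v` and `|μ| = n` are selected, each of squared norm `τ(p_v)`. There
are `|v|_n` of them, a nonzero number without sources, and the weight `1 / |v|_n` averages. -/
theorem trace_cut_neg (hlf : LocallyFinite V) (hns : NoSources V) (v : V) (n : ℕ) (hn : n ≠ 0) :
    vecTrace (fun i => cvec τ (frameElt i)) (rep τ (cP v) * Phi τ (-n)) = τ (P v) := by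
  have hE := cut_proj τ hlf v (-n)
  rw [vecTrace_frame]
  simp only [re_inner_proj hE]
  have h1 : ∀ {a b : V} (μ : Quiver.Path a b),
      (rep τ (cP v) * Phi τ (-n)) (cvec τ (cS μ)) = 0 := fun μ =>
    cut_eq_zero τ hlf (homog_cS μ) (Or.inl (by lia))
  simp only [h1, norm_zero]
  rw [tsum_eq_sum (s := (inPaths hlf v n).map (inEmb v)), Finset.sum_map]
  · have h2 : ∀ q ∈ inPaths hlf v n, ENNReal.ofReal (0 ^ 2) + ENNReal.ofReal (weight (inEmb v q) *
        ‖(rep τ (cP v) * Phi τ (-n)) (cvec τ (star (cS (inEmb v q).2.2)))‖ ^ 2) =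
        ENNReal.ofReal (1 / pathCount v n) * τ (P v) := by
      rintro ⟨a, μ⟩ hq
      rw [mem_inPaths] at hq
      subst hq
      change ENNReal.ofReal (0 ^ 2) + ENNReal.ofReal (weight ⟨a, v, μ⟩ *
        ‖(rep τ (cP v) * Phi τ (-μ.length)) (cvec τ (star (cS μ)))‖ ^ 2) = _
      rw [cut_eq_self τ (homog_cS μ).star (cP_mul_star_cS μ), norm_cvec_star,
        ENNReal.ofReal_mul (weight_nonneg _), ofReal_norm_cS τ hlf μ,
        show weight (⟨a, v, μ⟩ : Pth V) = _ from if_neg hn]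
      simp
    rw [Finset.sum_congr rfl h2, Finset.sum_const, card_inPaths, nsmul_eq_mul, ← mul_assoc,
      ← ENNReal.ofReal_natCast, ← ENNReal.ofReal_mul (by positivity), mul_one_div_cancel, ENNReal.ofReal_one,
      one_mul]
    exact_mod_cast pathCount_ne_zero hlf hns v n
  · rintro ⟨a, b, μ⟩ hq
    rw [mem_map_inEmb] at hq
    have h3 : (rep τ (cP v) * Phi τ (-n)) (cvec τ (star (cS μ))) = 0 := by
      refine cut_eq_zero τ hlf (homog_cS μ).star ?_
      by_cases h : b = v
      · exact Or.inl fun h' => hq ⟨h, by simpa using h'.symm⟩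
      · exact Or.inr (cP_mul_star_cS_of_ne μ (Ne.symm h))
    change ENNReal.ofReal (0 ^ 2) + ENNReal.ofReal
      (weight ⟨a, b, μ⟩ * ‖(rep τ (cP v) * Phi τ (-n)) (cvec τ (star (cS μ)))‖ ^ 2) = 0
    rw [h3]
    simp

theorem trace_cut_le (hlf : LocallyFinite V) (hns : NoSources V) (v : V) (k : ℤ) :
    vecTrace (fun i => cvec τ (frameElt i)) (rep τ (cP v) * Phi τ k) ≤ τ (P v) := by
  obtain ⟨n, rfl | rfl⟩ := k.eq_nat_or_neg
  · rw [trace_cut_nat τ hlf]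
    exact sum_outPaths_le hlf τ v n
  · rcases eq_or_ne n 0 with rfl | hn
    · have := trace_cut_nat τ hlf v 0
      rw [Nat.cast_zero, neg_zero]
      rw [Nat.cast_zero] at this
      rw [this]
      exact sum_outPaths_le hlf τ v 0
    · exact (trace_cut_neg τ hlf hns v n hn).le

theorem trace_cut_eq (hlf : LocallyFinite V) (hns : NoSources V) {v : V}
    (hv : NoSinksDownstream v) (k : ℤ) :
    vecTrace (fun i => cvec τ (frameElt i)) (rep τ (cP v) * Phi τ k) = τ (P v) := by
  obtain ⟨n, rfl | rfl⟩ := k.eq_nat_or_neg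
  · rw [trace_cut_nat τ hlf]
    exact sum_outPaths_eq hlf τ hv n
  · rcases eq_or_ne n 0 with rfl | hn
    · have := trace_cut_nat τ hlf v 0
      rw [Nat.cast_zero, neg_zero]
      rw [Nat.cast_zero] at this
      rw [this]
      exact sum_outPaths_eq hlf τ hv 0
    · exact trace_cut_neg τ hlf hns v n hn

theorem trace_P_lt_top (v : V) : τ (P v) < ∞ := τ.proj_lt_top τ.semifinite (isStarProjection_P v)

/-! ### The trace property -/

variable {τ} in
theorem norm_le_of_inner_cvec {y : L2 τ} {C : ℝ} (hC : 0 ≤ C)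
    (h : ∀ f : core V, ‖inner ℂ (cvec τ f) y‖ ≤ C * ‖cvec τ f‖) : ‖y‖ ≤ C := by
  have h1 : ∀ w : L2 τ, ‖inner ℂ w y‖ ≤ C * ‖w‖ := fun w =>
    (denseRange_cvec τ).induction_on (p := fun w => ‖inner ℂ w y‖ ≤ C * ‖w‖) w
      (isClosed_le (by fun_prop) (by fun_prop)) h
  have h2 := h1 y
  rw [inner_self_eq_norm_sq_to_K] at h2
  rcases (norm_nonneg y).eq_or_lt with h0 | h0
  · rwa [← h0]
  · norm_cast at h2
    rw [abs_of_nonneg (by positivity), sq] at h2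
    exact le_of_mul_le_mul_right h2 h0

theorem norm_rep_cP_le (v : V) (x : L2 τ) : ‖rep τ (cP v) x‖ ≤ ‖x‖ := by
  have := (rep τ (cP v)).le_of_opNorm_le (norm_proj_le_one (rep_cP_proj τ v)) x
  rwa [one_mul] at this

/-- Put `X = Φ_0 y⋆ T x Φ_0`, so that the two sides are `‖X p_v‖` and `‖X⋆ p_w‖`. For `f` of degree
`0`, `⟨f, X p_v⟩ = ⟨X⋆ (p_w f), p_v⟩ = ⟨X⋆ p_w, p_v f⋆⟩`, since right multiplication by `f` commutes
with `X⋆ ∈ N`; and `‖f⋆‖ = ‖f‖`. Applying the inequality to `T⋆` reverses it. -/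
theorem dual_le (hlf : LocallyFinite V) {T : L2 τ →L[ℂ] L2 τ} (hT : T ∈ gaugeN τ) {x y : core V}
    {v w : V} (hx : x * cP v = x) (hy : y * cP w = y) :
    ‖Phi τ 0 (rep τ (star y) (T (cvec τ x)))‖ ≤
      ‖Phi τ 0 (rep τ (star x) (star T (cvec τ y)))‖ := by
  have hΦ := isGrading τ hlf
  have hy' : cP w * star y = star y := by
    have := congrArg star hy
    rwa [star_mul, star_cP] at this
  set X := Phi τ 0 * rep τ (star y) * T * rep τ x * Phi τ 0 with hX
  have hsX : star X = Phi τ 0 * rep τ (star x) * star T * rep τ y * Phi τ 0 := by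
    simp only [hX, star_mul, star_Phi τ hlf, star_rep, star_star, mul_assoc]
  have hXN : star X ∈ gaugeN τ := by
    rw [hsX]
    exact mul_mem (mul_mem (mul_mem (mul_mem (Phi_mem τ hlf 0) (rep_mem τ hlf _)) (star_mem hT))
      (rep_mem τ hlf _)) (Phi_mem τ hlf 0)
  have e1 : Phi τ 0 (rep τ (star y) (T (cvec τ x))) = X (cvec τ (cP v)) := by
    simp only [hX, mul_apply_eq_comp]
    rw [Phi_cvec τ (homog_cP v), rep_cvec, hx]
  have e2 : Phi τ 0 (rep τ (star x) (star T (cvec τ y))) = star X (cvec τ (cP w)) := by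
    simp only [hsX, mul_apply_eq_comp]
    rw [Phi_cvec τ (homog_cP w), rep_cvec, hy]
  have e3 : Phi τ 0 * X = X := by
    simp only [hX, ← mul_assoc]
    rw [(hΦ.proj 0).isIdempotentElem.eq]
  have e4 : rep τ (cP w) * X = X := by
    simp only [hX, ← mul_assoc]
    rw [← Phi_rep_zero τ hlf (homog_cP w), mul_assoc (Phi τ 0), ← rep_mul, hy']
  have e5 : star X * rep τ (cP w) = star X := by
    have := congrArg star e4
    rwa [star_mul, star_rep, star_cP] at this
  rw [e1, e2]
  refine norm_le_of_inner_cvec (norm_nonneg _) fun f => ?_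
  obtain ⟨f₀, hf, hfe⟩ := exists_Phi_cvec τ hlf 0 f
  have h1 : inner ℂ (cvec τ f) (X (cvec τ (cP v))) =
      inner ℂ (star X (cvec τ (cP w))) (cvec τ (cP v * star f₀)) := by
    calc inner ℂ (cvec τ f) (X (cvec τ (cP v)))
        = inner ℂ (cvec τ f) (Phi τ 0 (X (cvec τ (cP v)))) := by
          rw [← mul_apply_eq_comp (Phi τ 0) X, e3]
      _ = inner ℂ (cvec τ f₀) (X (cvec τ (cP v))) := by rw [← hΦ.inner_comm, hfe]
      _ = inner ℂ (star X (cvec τ f₀)) (cvec τ (cP v)) := by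
          rw [ContinuousLinearMap.star_eq_adjoint, ContinuousLinearMap.adjoint_inner_left]
      _ = inner ℂ (star X (rightMul τ f₀ (cvec τ (cP w)))) (cvec τ (cP v)) := by
          rw [rightMul_cvec, ← rep_cvec, ← mul_apply_eq_comp (star X), e5]
      _ = inner ℂ (rightMul τ f₀ (star X (cvec τ (cP w)))) (cvec τ (cP v)) := by
          rw [rightMul_comm τ hlf hf hXN]
      _ = inner ℂ (star X (cvec τ (cP w))) (rightMul τ (star f₀) (cvec τ (cP v))) := by
          rw [← star_rightMul, ContinuousLinearMap.star_eq_adjoint (rightMul τ f₀),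
            ContinuousLinearMap.adjoint_inner_right]
      _ = _ := by rw [rightMul_cvec]
  rw [h1]
  refine (norm_inner_le_norm _ _).trans ?_
  gcongr
  rw [← rep_cvec]
  refine (norm_rep_cP_le τ v _).trans ?_
  rw [norm_cvec_star, ← hfe]
  exact hΦ.norm_apply_le 0 _

theorem exists_split {a c : V} (α : Quiver.Path a c) {n : ℕ} (hn : n ≤ α.length) :
    ∃ (d : V) (α' : Quiver.Path a d) (α'' : Quiver.Path d c), α = α'.comp α'' ∧ α'.length = n := by
  obtain ⟨d, p, q, h1, h2⟩ := α.exists_eq_comp_of_le_length hn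
  exact ⟨d, p, q, h1, h2⟩

/-- `T` kills `ξ_i f` for every `f` of degree `0`, and all generators have this form up to a scalar.
If `|β| ≤ |α|`, split off an initial segment of `α` of length `|α| - |β|`. Otherwise write `S_α S_β⋆
= S_μ⋆ (S_{μα} S_β⋆)` with a path `μ` of length `|β| - |α|` into the source of `α`, which exists as
there are no sources. -/
theorem frame_separating (hlf : LocallyFinite V) (hns : NoSources V) {T : L2 τ →L[ℂ] L2 τ}
    (hT : T ∈ gaugeN τ) (h : ∀ i, T (cvec τ (frameElt i)) = 0) : T = 0 := by
  have key : ∀ (i : Pth V × Bool) (f : core V), Homog 0 f → T (cvec τ (frameElt i * f)) = 0 :=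
    fun i f hf => by
      rw [← rightMul_cvec, rightMul_comm τ hlf hf hT, h, map_zero]
  refine ext_gen τ hlf fun {a b c} α β => ?_
  rw [zero_apply]
  rcases le_or_gt β.length α.length with hl | hl
  · obtain ⟨d, α', α'', rfl, hα⟩ := exists_split α (n := α.length - β.length) (by lia)
    rw [Quiver.Path.length_comp] at hα hl
    rw [cS_comp, mul_assoc]
    refine key (⟨a, d, α'⟩, true) _ ?_
    have := homog_gen α'' β
    rwa [show (α''.length : ℤ) - β.length = 0 by lia] at this
  · obtain ⟨a', μ, hμ⟩ := exists_path_to hns a (β.length - α.length)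
    have hw : weight (⟨a', a, μ⟩ : Pth V) ≠ 0 := by
      rw [show weight (⟨a', a, μ⟩ : Pth V) = _ from if_neg (by dsimp only; lia)]
      exact one_div_ne_zero (by exact_mod_cast pathCount_ne_zero hlf hns _ _)
    have hw' : ((√(weight (⟨a', a, μ⟩ : Pth V)) : ℝ) : ℂ) ≠ 0 := by
      exact_mod_cast (Real.sqrt_pos.2 (lt_of_le_of_ne (weight_nonneg _) hw.symm)).ne'
    have h1 := key (⟨a', a, μ⟩, false) (cS (μ.comp α) * star (cS β)) (by
      have := homog_gen (μ.comp α) β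
      rwa [Quiver.Path.length_comp, show ((μ.length + α.length : ℕ) : ℤ) - β.length = 0 by lia]
        at this)
    rw [frameElt, smul_mul_assoc, map_smul, map_smul, smul_eq_zero, or_iff_right hw', cS_comp,
      ← mul_assoc, ← mul_assoc, star_cS_mul_cS hlf, cP_mul_cS] at h1
    exact h1

theorem eq_zero_of_forall_cP (hlf : LocallyFinite V) {y : L2 τ}
    (h : ∀ v, rep τ (cP v) y = 0) : y = 0 := by
  refine norm_le_zero_iff.1 (norm_le_of_inner_cvec le_rfl fun f => ?_)
  obtain ⟨F, hF, -⟩ := exists_support hlf f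
  rw [← hF, ← rep_cvec, inner_rep_left, star_cPF, cPF]
  have h1 : rep τ (∑ v ∈ F, cP v) y = 0 := by
    change repHom τ (∑ v ∈ F, cP v) y = 0
    rw [map_sum, sum_apply]
    exact Finset.sum_eq_zero fun v _ => h v
  rw [h1, inner_zero_right, norm_zero, zero_mul]

theorem frame_apply (hlf : LocallyFinite V) {i : Pth V × Bool} {x : core V}
    (h : Homog 0 (star (frameElt i) * x)) : (frameOp τ i * star (frameOp τ i)) (cvec τ x) =
      cvec τ (frameElt i * (star (frameElt i) * x)) := by
  rw [star_frameOp τ hlf, frameOp]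
  simp only [mul_apply_eq_comp]
  rw [rep_cvec, Phi_cvec τ h, Phi_cvec τ h, rep_cvec]

theorem frame_apply_of_ne (hlf : LocallyFinite V) {i : Pth V × Bool} {x : core V} {j : ℤ}
    (hj : j ≠ 0) (h : Homog j (star (frameElt i) * x)) :
    (frameOp τ i * star (frameOp τ i)) (cvec τ x) = 0 := by
  rw [star_frameOp τ hlf, frameOp]
  simp only [mul_apply_eq_comp]
  rw [rep_cvec, Phi_cvec_of_ne τ hlf hj.symm h, map_zero, map_zero]

/-- Degree leaves finitely many terms. In degree `n ≥ 0` only the initial segment `α'` of length `n`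
survives, and `S_α' S_α'⋆` fixes `S_α`. In degree `-n < 0` every path `μ` of length `n` into the
source `a` of `α` contributes the fraction `1 / |a|_n`, because `S_μ⋆ S_μ = p_a`. -/
theorem frame_hasSum_gen (hlf : LocallyFinite V) (hns : NoSources V) {a b c : V}
    (α : Quiver.Path a c) (β : Quiver.Path b c) :
    HasSum (fun i => (frameOp τ i * star (frameOp τ i)) (cvec τ (cS α * star (cS β))))
      (cvec τ (cS α * star (cS β))) := by
  classical
  have hg := homog_gen α β
  have htrue : ∀ q : Pth V, Homog (-q.2.2.length + ((α.length : ℤ) - β.length))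
      (star (frameElt (q, true)) * (cS α * star (cS β))) := fun q => (homog_cS q.2.2).star.mul hg
  have hfalse : ∀ q : Pth V, Homog (q.2.2.length + ((α.length : ℤ) - β.length))
      (star (frameElt (q, false)) * (cS α * star (cS β))) := fun q => by
    refine Homog.mul ?_ hg
    rw [frameElt, star_smul, star_star]
    exact (homog_cS q.2.2).smul _
  rcases le_or_gt β.length α.length with hl | hl
  · obtain ⟨d, α', α'', rfl, hα⟩ := exists_split α (n := α.length - β.length) (by lia)
    have hα' : (α'.length : ℤ) = ((α'.comp α'').length : ℤ) - β.length := by lia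
    have h0 := frame_apply τ hlf (i := (⟨a, d, α'⟩, true)) (x := cS (α'.comp α'') * star (cS β)) (by
      have := htrue ⟨a, d, α'⟩
      rwa [← hα', neg_add_cancel] at this)
    have h1 : frameElt (⟨a, d, α'⟩, true) * (star (frameElt (⟨a, d, α'⟩, true)) *
        (cS (α'.comp α'') * star (cS β))) = cS (α'.comp α'') * star (cS β) := by
      change cS α' * (star (cS α') * _) = _
      rw [cS_comp, mul_assoc (cS α'), ← mul_assoc (star (cS α')), star_cS_mul_cS hlf, ← mul_assoc (cP d),
        cP_mul_cS]
    rw [h1] at h0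
    have h2 := hasSum_single (f := fun i => (frameOp τ i * star (frameOp τ i))
      (cvec τ (cS (α'.comp α'') * star (cS β)))) (⟨a, d, α'⟩, true) ?_
    · rwa [h0] at h2
    · rintro ⟨q, _ | _⟩ hq
      -- Both lengths are nonnegative here, so the sum vanishes only for a path of length `0`, where
      -- the weight makes the frame element zero.
      · by_cases h : (q.2.2.length : ℤ) + (((α'.comp α'').length : ℤ) - β.length) = 0
        · have hz : frameElt (q, false) = 0 := by
            rw [frameElt, weight, if_pos (by lia), Real.sqrt_zero, Complex.ofReal_zero, zero_smul]
          rw [frameOp, hz, rep_zero, zero_mul, zero_mul, zero_apply]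
        · exact frame_apply_of_ne τ hlf h (hfalse q)
      · by_cases h : -(q.2.2.length : ℤ) + (((α'.comp α'').length : ℤ) - β.length) = 0
        · obtain ⟨a', d', μ⟩ := q
          have hne : (⟨a', d', μ⟩ : Pth V) ≠ ⟨a, d, α'⟩ := fun h' => hq (by rw [h'])
          have h4 := htrue ⟨a', d', μ⟩
          rw [h] at h4
          rw [frame_apply τ hlf h4]
          change cvec τ (cS μ * (star (cS μ) * _)) = 0
          rw [cS_comp, mul_assoc (cS α'), ← mul_assoc (star (cS μ)),
            star_cS_mul_cS_of_ne hlf μ α' (by dsimp only at h; lia) hne, zero_mul, mul_zero, map_zero]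
        · exact frame_apply_of_ne τ hlf h (htrue q)
  · obtain ⟨n, hn⟩ : ∃ n, n = β.length - α.length := ⟨_, rfl⟩
    have hval : ∀ q ∈ (inPaths hlf a n).map (inEmb a), (frameOp τ (q, false) *
        star (frameOp τ (q, false))) (cvec τ (cS α * star (cS β))) =
        ((1 / pathCount a n : ℝ) : ℂ) • cvec τ (cS α * star (cS β)) := by
      rintro ⟨a', b', μ⟩ hq
      rw [mem_map_inEmb] at hq
      obtain ⟨rfl, h⟩ := hq
      dsimp only at h
      have h4 := hfalse ⟨a', b', μ⟩
      dsimp only at h4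
      rw [show (μ.length : ℤ) + ((α.length : ℤ) - β.length) = 0 by lia] at h4
      rw [frame_apply τ hlf h4, ← map_smul]
      congr 1
      rw [frameElt, star_smul, star_star, smul_mul_assoc, smul_mul_assoc, mul_smul_comm, smul_smul,
        ← mul_assoc, star_cS_mul_cS hlf, ← mul_assoc, cP_mul_cS, Complex.star_def,
        Complex.conj_ofReal, ← Complex.ofReal_mul, Real.mul_self_sqrt (weight_nonneg _), weight,
        if_neg (by dsimp only; lia)]
      dsimp only
      rw [h]
    have hs : ∑ i ∈ (inPaths hlf a n).map (inEmb a) ×ˢ {false}, (frameOp τ i *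
        star (frameOp τ i)) (cvec τ (cS α * star (cS β))) = cvec τ (cS α * star (cS β)) := by
      rw [Finset.sum_product]
      simp only [Finset.sum_singleton]
      rw [Finset.sum_congr rfl hval, Finset.sum_const, Finset.card_map, card_inPaths,
        ← Nat.cast_smul_eq_nsmul ℂ, smul_smul]
      push_cast
      rw [mul_one_div_cancel, one_smul]
      exact_mod_cast pathCount_ne_zero hlf hns a n
    have h2 := hasSum_sum_of_ne_finset_zero (L := SummationFilter.unconditional _) (f := fun i => (frameOp τ i * star (frameOp τ i))
      (cvec τ (cS α * star (cS β)))) (s := (inPaths hlf a n).map (inEmb a) ×ˢ {false}) ?_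
    · rwa [hs] at h2
    · rintro ⟨⟨a', b', μ⟩, _ | _⟩ hq
      · by_cases h : (μ.length : ℤ) + ((α.length : ℤ) - β.length) = 0
        · have hb : b' ≠ a := by
            rintro rfl
            exact hq (Finset.mem_product.2 ⟨(mem_map_inEmb hlf).2 ⟨rfl, by dsimp only; lia⟩, by simp⟩)
          have h4 := hfalse ⟨a', b', μ⟩
          dsimp only at h4
          rw [h] at h4
          have hz : cS μ * (cS α * star (cS β)) = 0 := by
            rw [← cS_mul_cP μ, mul_assoc (cS μ), ← mul_assoc (cP b'), cP_mul_cS_of_ne α hb, zero_mul,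
              mul_zero]
          rw [frame_apply τ hlf h4, frameElt, star_smul, star_star]
          simp only [smul_mul_assoc, mul_smul_comm]
          rw [hz, mul_zero, smul_zero, smul_zero, map_zero]
        · exact frame_apply_of_ne τ hlf h (hfalse ⟨a', b', μ⟩)
      · exact frame_apply_of_ne τ hlf (by lia) (htrue ⟨a', b', μ⟩)

/-- On the core the operators `L_i L_i⋆` sum to the identity. Positivity gives Bessel's inequality
there and, by density, contractive partial sums; strong convergence then extends to all vectors, and
pairing with `y` yields Parseval. -/
theorem frame_parseval (hlf : LocallyFinite V) (hns : NoSources V) (y : L2 τ) :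
    HasSum (fun i => ‖star (frameOp τ i) y‖ ^ 2) (‖y‖ ^ 2) := by
  set A := fun i => frameOp τ i * star (frameOp τ i) with hA
  have hsum : ∀ x : core V, HasSum (fun i => A i (cvec τ x)) (cvec τ x) := fun x => by
    induction x using core_ind hlf with
    | mem α β => exact frame_hasSum_gen τ hlf hns α β
    | zero => simp
    | add x y hx hy => simpa using hx.add hy
    | smul r x hx => simpa using hx.const_smul r
  have hin : ∀ i y, (inner ℂ y (A i y)).re = ‖star (frameOp τ i) y‖ ^ 2 := fun i y => by
    have := re_inner_star_mul_self (star (frameOp τ i)) y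
    rwa [star_star] at this
  have hre : ∀ {y : L2 τ}, HasSum (fun i => A i y) y →
      HasSum (fun i => ‖star (frameOp τ i) y‖ ^ 2) (‖y‖ ^ 2) := fun {y} h => by
    have h1 := Complex.hasSum_re (h.mapL (innerSL ℂ y))
    simp only [innerSL_apply_apply, hin] at h1
    rwa [show (inner ℂ y y).re = ‖y‖ ^ 2 from (norm_sq_eq_re_inner (𝕜 := ℂ) y).symm] at h1
  have hA0 : ∀ s : Finset (Pth V × Bool), 0 ≤ ∑ i ∈ s, A i := fun s =>
    Finset.sum_nonneg fun i _ => mul_star_self_nonneg _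
  have hle : ∀ (s : Finset (Pth V × Bool)) (y : L2 τ),
      (inner ℂ y ((∑ i ∈ s, A i) y)).re ≤ ‖y‖ ^ 2 := fun s y => by
    refine (denseRange_cvec τ).induction_on
      (p := fun y => (inner ℂ y ((∑ i ∈ s, A i) y)).re ≤ ‖y‖ ^ 2) y
      (isClosed_le (Complex.continuous_re.comp (by fun_prop)) (by fun_prop)) fun x => ?_
    rw [sum_apply, inner_sum, Complex.re_sum]
    simp only [hin]
    exact sum_le_hasSum s (fun i _ => by positivity) (hre (hsum x))
  have hn : ∀ s : Finset (Pth V × Bool), ‖∑ i ∈ s, A i‖ ≤ 1 := fun s => by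
    set B := ∑ i ∈ s, A i
    -- From `‖B y‖² ≤ ‖B‖ ⟨y, B y⟩ ≤ ‖B‖ ‖y‖²`; a number bounded by its own square root is at most
    -- `1`.
    have h1 : ‖B‖ ≤ √‖B‖ := B.opNorm_le_bound (Real.sqrt_nonneg _) fun y => by
      rw [← sq_le_sq₀ (norm_nonneg _) (by positivity), mul_pow, Real.sq_sqrt (norm_nonneg _)]
      refine (norm_apply_sq_le (hA0 s) y).trans ?_
      gcongr
      exact hle s y
    have h2 := Real.sq_sqrt (norm_nonneg B)
    have h3 := Real.sqrt_nonneg ‖B‖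
    nlinarith
  refine hre ?_
  change Filter.Tendsto (fun s => ∑ i ∈ s, A i y) Filter.atTop (nhds y)
  rw [Metric.tendsto_nhds]
  intro ε hε
  obtain ⟨x, hx⟩ := (denseRange_cvec τ).exists_dist_lt y (show 0 < ε / 3 by positivity)
  have h1 : Filter.Tendsto (fun s => ∑ i ∈ s, A i (cvec τ x)) Filter.atTop (nhds (cvec τ x)) :=
    hsum x
  filter_upwards [Metric.tendsto_nhds.1 h1 (ε / 3) (by positivity)] with s hs
  have h2 : dist (∑ i ∈ s, A i y) (∑ i ∈ s, A i (cvec τ x)) ≤ dist y (cvec τ x) := by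
    rw [← sum_apply, ← sum_apply, dist_eq_norm, dist_eq_norm, ← map_sub]
    simpa using (∑ i ∈ s, A i).le_of_opNorm_le (hn s) (y - cvec τ x)
  calc dist (∑ i ∈ s, A i y) y ≤ dist (∑ i ∈ s, A i y) (∑ i ∈ s, A i (cvec τ x)) +
        dist (∑ i ∈ s, A i (cvec τ x)) (cvec τ x) + dist (cvec τ x) y := dist_triangle4 _ _ _ _
    _ < ε := by
      rw [dist_comm (cvec τ x) y]
      linarith

theorem isTraceFrame (hlf : LocallyFinite V) (hns : NoSources V) :
    IsTraceFrame (gaugeN τ) (fun i => cvec τ (frameElt i)) (frameOp τ) where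
  parseval := frame_parseval τ hlf hns
  dual T hT i j := by
    rw [star_frameOp τ hlf, star_frameOp τ hlf]
    refine le_antisymm (dual_le τ hlf hT (frameElt_mul_cP i) (frameElt_mul_cP j)) ?_
    have := dual_le τ hlf (star_mem hT) (frameElt_mul_cP j) (frameElt_mul_cP i)
    rwa [star_star] at this
  separating T hT h := frame_separating τ hlf hns hT h
  finite x h := by
    refine (isGrading τ hlf).ext_apply fun k => ?_
    rw [map_zero]
    refine eq_zero_of_forall_cP τ hlf fun v => ?_
    exact h _ (cut_mem τ hlf v k) (cut_proj τ hlf v k)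
      ((trace_cut_le τ hlf hns v k).trans_lt (trace_P_lt_top τ v))

theorem isTrace_tildeTrace (hlf : LocallyFinite V) (hns : NoSources V) :
    IsFaithfulNormalSemifiniteTrace (gaugeN τ) (tildeTrace τ) :=
  (isTraceFrame τ hlf hns).isTrace.congr fun _ => tildeTrace_eq τ

end Frame

/-! ### Sums and matrix entries of iterated commutators. -/

theorem IterBound.sum {H : Type*} [NormedAddCommGroup H] [InnerProductSpace ℂ H] [CompleteSpace H]
    {Q : H →ₗ.[ℂ] H} {n : ℕ} {ι : Type*} (s : Finset ι) {A : ι → H →L[ℂ] H} {a : ι → ℝ}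
    (h : ∀ i ∈ s, IterBound Q n (a i) (A i)) : IterBound Q n (∑ i ∈ s, a i) (∑ i ∈ s, A i) := by
  classical
  induction s using Finset.induction_on with
  | empty => simpa using IterBound.zero le_rfl
  | insert i s hi ih =>
    rw [Finset.sum_insert hi, Finset.sum_insert hi]
    exact (h i (Finset.mem_insert_self i s)).add
      (ih fun j hj => h j (Finset.mem_insert_of_mem hj))

theorem IsDiagonal.isIteratedCommutator_apply {H : Type*} [NormedAddCommGroup H]
    [InnerProductSpace ℂ H] [CompleteSpace H] {Φ : ℤ → H →L[ℂ] H} {f : ℤ → ℝ} {D : H →ₗ.[ℂ] H}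
    (hΦ : IsGrading Φ) (hD : IsDiagonal Φ f D) {n : ℕ} {T : H →L[ℂ] H} :
    ∀ {R : H →L[ℂ] H}, IsIteratedCommutator D n T R → ∀ k j x,
      Φ k (R (Φ j x)) = (((f k - f j) ^ n : ℝ) : ℂ) • Φ k (T (Φ j x)) := by
  induction n with
  | zero => rintro R rfl k j x; simp
  | succ n ih =>
    intro R h k j x
    obtain ⟨B, hB, hR⟩ := h.exists_snoc
    rw [(hD.isCommutator_iff hΦ).1 hR, ih hB, smul_smul, pow_succ', Complex.ofReal_mul]

section Smooth

variable {V : Type u} [Quiver.{u + 1} V] (τ : GaugeTrace V)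

/-! ### Smoothness of the core -/

theorem abs_shift_le (j m : ℤ) : |(|((j + m : ℤ) : ℝ)| - |(j : ℝ)|)| ≤ |(m : ℝ)| := by
  push_cast
  have := abs_abs_sub_abs_le ((j : ℝ) + m) j
  rwa [add_sub_cancel_left] at this

theorem isCommutator_rep (hlf : LocallyFinite V) {m : ℤ} {a : core V} (ha : Homog m a) :
    IsCommutator (dirac τ) (rep τ a) (rep τ ((m : ℂ) • a)) := by
  have hΦ := isGrading τ hlf
  rw [(isDiagonal_dirac τ hlf).isCommutator_iff hΦ]
  intro k j x
  have h := congrArg (fun T : L2 τ →L[ℂ] L2 τ => T x) (Phi_rep τ hlf ha j)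
  simp only [mul_apply_eq_comp] at h
  rw [rep_smul, smul_apply, map_smul]
  by_cases hk : k = j + m
  · subst hk
    push_cast
    rw [add_sub_cancel_left]
  · rw [← h, hΦ.apply_ne hk, smul_zero, smul_zero]

/-- Since `a` carries degree `j` to `j + m`, each `δ` inserts the factor `|j + m| - |j|`. So `δⁿ(a)`
is `a` times a diagonal operator of norm at most `|m|ⁿ`. -/
theorem iterBound_rep (hlf : LocallyFinite V) {m : ℤ} {a : core V} (ha : Homog m a) (n : ℕ) :
    IterBound (absDirac τ) n (|(m : ℝ)| ^ n * ‖rep τ a‖) (rep τ a) := by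
  have hΦ := isGrading τ hlf
  have hQ := isDiagonal_absDirac τ hlf
  set f : ℤ → ℝ := fun j => |((j + m : ℤ) : ℝ)| - |(j : ℝ)|
  have hf : ∀ n j, ‖((f j ^ n : ℝ) : ℂ)‖ ≤ |(m : ℝ)| ^ n := fun n j => by
    rw [Complex.norm_real, norm_pow]
    exact pow_le_pow_left₀ (abs_nonneg _) (abs_shift_le j m) n
  choose g hg hgn using fun n => hΦ.exists_diag (fun j => ((f j ^ n : ℝ) : ℂ)) _ (hf n)
  have hc : ∀ n, IsIteratedCommutator (absDirac τ) n (rep τ a) (rep τ a * g n) := fun n => by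
    induction n with
    | zero =>
      have : g 0 = 1 := by
        ext x
        refine hΦ.ext_apply fun k => ?_
        rw [hg]
        simp
      rw [this, mul_one]
      rfl
    | succ n ih =>
      refine ih.snoc ((hQ.isCommutator_iff hΦ).2 fun k j x => ?_)
      have h := congrArg (fun T : L2 τ →L[ℂ] L2 τ => T x) (Phi_rep τ hlf ha j)
      simp only [mul_apply_eq_comp] at h
      rw [mul_apply_eq_comp, mul_apply_eq_comp, hΦ.diag_apply (hg _), hΦ.diag_apply (hg _),
        map_smul, map_smul, map_smul, map_smul, ← h]
      by_cases hk : k = j + m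
      · subst hk
        rw [smul_smul, pow_succ', Complex.ofReal_mul]
      · rw [hΦ.apply_ne hk, smul_zero, smul_zero, smul_zero]
  refine ⟨_, hc n, (norm_mul_le _ _).trans ?_⟩
  rw [mul_comm]
  gcongr
  exact hgn n

/-- The decomposition of an element of the core into homogeneous components. -/
theorem exists_components (hlf : LocallyFinite V) (x : core V) :
    ∃ (K : Finset ℤ) (c : ℤ → core V), (∀ m, Homog m (c m)) ∧ (∀ m ∉ K, c m = 0) ∧
      x = ∑ m ∈ K, c m := by
  classical
  induction x using core_ind hlf with
  | mem α β =>
    refine ⟨{(α.length : ℤ) - β.length},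
      fun m => if m = (α.length : ℤ) - β.length then cS α * star (cS β) else 0, fun m => ?_,
      fun m hm => ?_, ?_⟩
    · dsimp only
      split_ifs with h
      · rw [h]; exact homog_gen α β
      · exact Homog.zero m
    · exact if_neg (by simpa using hm)
    · simp
  | zero => exact ⟨∅, fun _ => 0, Homog.zero, fun _ _ => rfl, by simp⟩
  | add x y hx hy =>
    obtain ⟨K, c, h1, h2, rfl⟩ := hx
    obtain ⟨K', c', h1', h2', rfl⟩ := hy
    refine ⟨K ∪ K', fun m => c m + c' m, fun m => (h1 m).add (h1' m), fun m hm => ?_, ?_⟩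
    · rw [Finset.mem_union, not_or] at hm
      simp only [h2 m hm.1, h2' m hm.2, add_zero]
    · rw [Finset.sum_add_distrib]
      congr 1
      · exact Finset.sum_subset Finset.subset_union_left fun m _ hm => h2 m hm
      · exact Finset.sum_subset Finset.subset_union_right fun m _ hm => h2' m hm
  | smul r x hx =>
    obtain ⟨K, c, h1, h2, rfl⟩ := hx
    refine ⟨K, fun m => r • c m, fun m => (h1 m).smul r, fun m hm => ?_, ?_⟩
    · simp only [h2 m hm, smul_zero]
    · rw [Finset.smul_sum]

theorem rep_sum {ι : Type*} (s : Finset ι) (c : ι → core V) :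
    rep τ (∑ i ∈ s, c i) = ∑ i ∈ s, rep τ (c i) := map_sum (repHom τ) c s

theorem rep_sub (a b : core V) : rep τ (a - b) = rep τ a - rep τ b := map_sub (repHom τ) a b

theorem isCommutator_sum {H : Type*} [NormedAddCommGroup H] [InnerProductSpace ℂ H]
    [CompleteSpace H] {D : H →ₗ.[ℂ] H} {ι : Type*} (s : Finset ι) {A A' : ι → H →L[ℂ] H}
    (h : ∀ i, IsCommutator D (A i) (A' i)) : IsCommutator D (∑ i ∈ s, A i) (∑ i ∈ s, A' i) := by
  classical
  induction s using Finset.induction_on with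
  | empty => exact .zero
  | insert i s hi ih =>
    rw [Finset.sum_insert hi, Finset.sum_insert hi]
    exact (h i).add ih

/-- The commutator with `D` is a derivation of the core. -/
theorem exists_isCommutator_rep (hlf : LocallyFinite V) (x : core V) :
    ∃ y : core V, IsCommutator (dirac τ) (rep τ x) (rep τ y) := by
  obtain ⟨K, c, h1, -, rfl⟩ := exists_components hlf x
  refine ⟨∑ m ∈ K, (m : ℂ) • c m, ?_⟩
  rw [rep_sum, rep_sum]
  exact isCommutator_sum K fun m => isCommutator_rep τ hlf (h1 m)

theorem exists_iterBound_rep (hlf : LocallyFinite V) (x : core V) (n : ℕ) :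
    ∃ C, IterBound (absDirac τ) n C (rep τ x) := by
  obtain ⟨K, c, h1, -, rfl⟩ := exists_components hlf x
  rw [rep_sum]
  exact ⟨_, IterBound.sum K fun m _ => iterBound_rep τ hlf (h1 m) n⟩

theorem isSmooth_rep (hlf : LocallyFinite V) (x : core V) :
    IsSmooth (dirac τ) (absDirac τ) (rep τ x) := fun n => by
  obtain ⟨y, hy⟩ := exists_isCommutator_rep τ hlf x
  obtain ⟨C, hC⟩ := exists_iterBound_rep τ hlf x n
  obtain ⟨C', hC'⟩ := exists_iterBound_rep τ hlf y n
  exact ⟨max C C', hC.mono (le_max_left _ _), _, hy, hC'.mono (le_max_right _ _)⟩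

/-! ### Rapid decay of the homogeneous components -/

/-- Bounds on left multiplication propagate from low degrees to all degrees, because there
are no sources. -/
theorem norm_mul_le_of_shift (hlf : LocallyFinite V) (hns : NoSources V) {a : core V} {M : ℝ}
    {i : ℤ} (n : ℕ)
    (h : ∀ z : core V, Homog (i - n) z → ‖cvec τ (a * z)‖ ≤ M * ‖cvec τ z‖) {y : core V}
    (hy : Homog i y) : ‖cvec τ (a * y)‖ ≤ M * ‖cvec τ y‖ := by
  classical
  obtain ⟨F, -, hF⟩ := exists_support hlf y
  choose u ν hν using fun w => exists_path_to hns w n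
  -- One path of length `n` into each vertex of the right support of `y`, so that `s⋆ s = p_F`.
  -- Right multiplication by `s⋆` lowers the degree by `n`, is isometric on elements with right
  -- support `F`, and commutes with left multiplication by `a`.
  set s : core V := ∑ w ∈ F, cS (ν w) with hs
  have hs1 : star s * s = cPF F := by
    rw [hs, star_sum, Finset.sum_mul, cPF]
    refine Finset.sum_congr rfl fun w hw => ?_
    rw [Finset.mul_sum, Finset.sum_eq_single_of_mem w hw, star_cS_mul_cS hlf]
    intro w' _ hne
    refine star_cS_mul_cS_of_ne hlf _ _ (by rw [hν, hν]) fun h' => hne ?_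
    exact (congrArg (fun q : Pth V => q.2.1) h').symm
  have hs2 : Homog n s := by
    have : ∀ G : Finset V, Homog (n : ℤ) (∑ w ∈ G, cS (ν w)) := fun G => by
      induction G using Finset.induction_on with
      | empty => exact Homog.zero _
      | insert w G hw ih =>
        rw [Finset.sum_insert hw]
        have := homog_cS (ν w)
        rw [hν] at this
        exact this.add ih
    exact this F
  have key : ∀ x : core V, x * cPF F = x → ‖cvec τ (x * star s)‖ = ‖cvec τ x‖ := fun x hx => by
    rw [← sq_eq_sq₀ (norm_nonneg _) (norm_nonneg _), norm_cvec_sq', norm_cvec_sq']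
    have h1 : (x * star s) * star (x * star s) = x * star x := by
      rw [star_mul, star_star, mul_assoc, ← mul_assoc (star s), hs1, ← mul_assoc, hx]
    exact congrArg (fun z : core V => (τ (z : GraphCStar V)).toReal) h1
  have h1 := h (y * star s) (by rw [sub_eq_add_neg]; exact hy.mul hs2.star)
  rwa [← mul_assoc, key _ hF, key _ (by rw [mul_assoc, hF])] at h1

/-- The shift lemma extends the estimate to every degree. A homogeneous `a` maps orthogonal degrees
to orthogonal degrees, so its norm is the supremum over single degrees. -/
theorem norm_rep_le (hlf : LocallyFinite V) (hns : NoSources V) {m : ℤ} {a : core V}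
    (ha : Homog m a) {M : ℝ} (hM : 0 ≤ M) (I : ℤ)
    (h : ∀ i ≤ I, ∀ z : core V, Homog i z → ‖cvec τ (a * z)‖ ≤ M * ‖cvec τ z‖) :
    ‖rep τ a‖ ≤ M := by
  have hΦ := isGrading τ hlf
  have h1 : ∀ (i : ℤ) (z : core V), Homog i z → ‖cvec τ (a * z)‖ ≤ M * ‖cvec τ z‖ := fun i z hz =>
    norm_mul_le_of_shift τ hlf hns (i - I).toNat (fun w hw => h _ (by lia) w hw) hz
  have h2 : ∀ (k : ℤ) (x : L2 τ), ‖rep τ a (Phi τ k x)‖ ≤ M * ‖Phi τ k x‖ := fun k x => by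
    refine (denseRange_cvec τ).induction_on
      (p := fun x => ‖rep τ a (Phi τ k x)‖ ≤ M * ‖Phi τ k x‖) x
      (isClosed_le (by fun_prop) (by fun_prop)) fun f => ?_
    obtain ⟨y, hy, he⟩ := exists_Phi_cvec τ hlf k f
    rw [he, rep_cvec]
    exact h1 k y hy
  refine ContinuousLinearMap.opNorm_le_bound _ hM fun x => ?_
  rw [← sq_le_sq₀ (norm_nonneg _) (by positivity), mul_pow]
  refine hasSum_le (fun k => ?_)
    ((Equiv.addRight m).hasSum_iff.2 (hΦ.hasSum_norm_sq (rep τ a x)))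
    ((hΦ.hasSum_norm_sq x).mul_left (M ^ 2))
  have h3 := congrArg (fun T : L2 τ →L[ℂ] L2 τ => T x) (Phi_rep τ hlf ha k)
  simp only [mul_apply_eq_comp] at h3
  change ‖Phi τ (k + m) (rep τ a x)‖ ^ 2 ≤ _
  rw [h3, ← mul_pow]
  exact pow_le_pow_left₀ (norm_nonneg _) (h2 k x) 2

/-- For `i ≤ min 0 (-m)` both `i` and `i + m` are nonpositive, so `|i + m| - |i| = -m` and the `(i +
m, i)` entry of `δⁿ(x)` is exactly `(-m)ⁿ c_m`. Such degrees suffice to compute the norm of `c_m`.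
-/
theorem pow_mul_norm_component_le (hlf : LocallyFinite V) (hns : NoSources V) {K : Finset ℤ}
    {c : ℤ → core V} (h1 : ∀ m, Homog m (c m)) (h2 : ∀ m ∉ K, c m = 0) {n : ℕ} {ε : ℝ}
    (hb : IterBound (absDirac τ) n ε (rep τ (∑ m ∈ K, c m))) {m : ℤ} (hm : m ≠ 0) :
    |(m : ℝ)| ^ n * ‖rep τ (c m)‖ ≤ ε := by
  classical
  have hΦ := isGrading τ hlf
  have hε := hb.nonneg
  obtain ⟨R, hR, hn⟩ := hb
  have hm' : 0 < |(m : ℝ)| ^ n := by positivity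
  rw [← le_div_iff₀' hm']
  refine norm_rep_le τ hlf hns (h1 m) (by positivity) (min 0 (-m)) fun i hi z hz => ?_
  have e1 : Phi τ (i + m) (rep τ (∑ m ∈ K, c m) (cvec τ z)) = cvec τ (c m * z) := by
    rw [rep_cvec, Finset.sum_mul, map_sum, map_sum, Finset.sum_eq_single m]
    · rw [add_comm]; exact Phi_cvec τ ((h1 m).mul hz)
    · intro m' _ hne
      exact Phi_cvec_of_ne τ hlf (by lia) ((h1 m').mul hz)
    · intro h; rw [h2 m h, zero_mul, map_zero, map_zero]
  have e2 := (isDiagonal_absDirac τ hlf).isIteratedCommutator_apply hΦ hR (i + m) i (cvec τ z)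
  rw [Phi_cvec τ hz, e1] at e2
  have hi0 : (i : ℝ) ≤ 0 := by exact_mod_cast hi.trans (min_le_left _ _)
  have him : ((i + m : ℤ) : ℝ) ≤ 0 := by exact_mod_cast (by have := min_le_right 0 (-m); lia)
  have e3 : ‖Phi τ (i + m) (R (cvec τ z))‖ = |(m : ℝ)| ^ n * ‖cvec τ (c m * z)‖ := by
    rw [e2, norm_smul, Complex.norm_real, norm_pow, abs_of_nonpos hi0, abs_of_nonpos him,
      Real.norm_eq_abs]
    congr 2
    push_cast
    rw [show -((i : ℝ) + m) - -(i : ℝ) = -m by ring, abs_neg]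
  rw [div_mul_eq_mul_div, le_div_iff₀' hm', ← e3]
  exact (hΦ.norm_apply_le _ _).trans (R.le_of_opNorm_le hn _)

/-- Four orders are lost: two pay for the factor `m²` of the double commutator, and two make the sum
over `m` converge like `∑ 1 / m²`, which is the constant. -/
theorem exists_second_commutator_bound (hlf : LocallyFinite V) (hns : NoSources V) :
    ∃ C : ℝ, 0 ≤ C ∧ ∀ (n : ℕ) (ε : ℝ) (x : core V),
      IterBound (absDirac τ) (n + 4) ε (rep τ x) → ∃ y z : core V,
        IsCommutator (dirac τ) (rep τ x) (rep τ y) ∧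
        IsCommutator (dirac τ) (rep τ y) (rep τ z) ∧
        IterBound (absDirac τ) n (C * ε) (rep τ z) := by
  have hsum : Summable fun m : ℤ => 1 / |(m : ℝ)| ^ 2 := by
    have := Real.summable_one_div_int_pow (p := 2)
    simpa only [sq_abs] using this.2 one_lt_two
  refine ⟨∑' m : ℤ, 1 / |(m : ℝ)| ^ 2, tsum_nonneg fun m => by positivity, fun n ε x hb => ?_⟩
  obtain ⟨K, c, h1, h2, rfl⟩ := exists_components hlf x
  refine ⟨∑ m ∈ K, (m : ℂ) • c m, ∑ m ∈ K, (m : ℂ) • (m : ℂ) • c m, ?_, ?_, ?_⟩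
  · rw [rep_sum, rep_sum]
    exact isCommutator_sum K fun m => isCommutator_rep τ hlf (h1 m)
  · rw [rep_sum, rep_sum]
    exact isCommutator_sum K fun m => isCommutator_rep τ hlf ((h1 m).smul _)
  · rw [rep_sum]
    refine (IterBound.sum K fun m _ =>
      iterBound_rep τ hlf (((h1 m).smul (m : ℂ)).smul (m : ℂ)) n).mono ?_
    have hε := hb.nonneg
    refine le_trans (Finset.sum_le_sum (g := fun m : ℤ => 1 / |(m : ℝ)| ^ 2 * ε) fun m _ => ?_) ?_
    · rw [rep_smul, rep_smul, norm_smul, norm_smul]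
      rcases eq_or_ne m 0 with rfl | hm
      · simp
      · have h3 := pow_mul_norm_component_le τ hlf hns h1 h2 hb hm
        have h4 : 0 < |(m : ℝ)| := by positivity
        have h5 : ‖(m : ℂ)‖ = |(m : ℝ)| := by
          rw [← Complex.ofReal_intCast, Complex.norm_real, Real.norm_eq_abs]
        rw [h5, div_mul_eq_mul_div, one_mul, le_div_iff₀ (by positivity)]
        refine le_trans (le_of_eq ?_) h3
        ring
    · rw [← Finset.sum_mul]
      gcongr
      exact hsum.sum_le_tsum K fun m _ => by positivity

/-! ### The smooth algebra -/

/-- A norm limit of a `δ`-Cauchy sequence of smooth operators is its `δ`-limit, so the general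
results on `δ`-closures apply. -/
theorem smoothAlgebra_eq (hlf : LocallyFinite V) : smoothAlgebra τ =
    deltaClosure (dirac τ) (absDirac τ) (NonUnitalStarAlgHom.range (repHom τ) : Set _) := by
  ext T
  constructor
  · rintro ⟨a, h1, h2⟩
    exact ⟨fun i => rep τ (a i), fun i => ⟨a i, rfl⟩, h1.tendsto (isGrading τ hlf)
      (isDiagonal_dirac τ hlf) (isDiagonal_absDirac τ hlf) (fun i => isSmooth_rep τ hlf _) h2⟩
  · rintro ⟨a, h1, h2⟩
    choose x hx using h1
    obtain rfl : (fun i => rep τ (x i)) = a := funext hx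
    exact ⟨x, h2.cauchy, h2.tendsto⟩

theorem exists_deltaTendsto (hlf : LocallyFinite V) {T : L2 τ →L[ℂ] L2 τ}
    (hT : T ∈ smoothAlgebra τ) :
    ∃ x : ℕ → core V, DeltaTendsto (dirac τ) (absDirac τ) (fun i => rep τ (x i)) T := by
  obtain ⟨x, h1, h2⟩ := hT
  exact ⟨x, h1.tendsto (isGrading τ hlf) (isDiagonal_dirac τ hlf) (isDiagonal_absDirac τ hlf)
    (fun i => isSmooth_rep τ hlf _) h2⟩

theorem isSmooth_range (hlf : LocallyFinite V) :
    ∀ c ∈ NonUnitalStarAlgHom.range (repHom τ), IsSmooth (dirac τ) (absDirac τ) c := by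
  rintro _ ⟨x, rfl⟩
  exact isSmooth_rep τ hlf x

theorem isSmooth_of_mem (hlf : LocallyFinite V) {T : L2 τ →L[ℂ] L2 τ}
    (hT : T ∈ smoothAlgebra τ) : IsSmooth (dirac τ) (absDirac τ) T := by
  rw [smoothAlgebra_eq τ hlf] at hT
  exact deltaClosure.isSmooth (isSmooth_range τ hlf) hT

/-- The smooth algebra as a ⋆-algebra. -/
def smoothStarAlgebra (hlf : LocallyFinite V) : NonUnitalStarSubalgebra ℂ (L2 τ →L[ℂ] L2 τ) :=
  deltaClosure.toStarSubalgebra (isGrading τ hlf) (isDiagonal_dirac τ hlf)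
    (isDiagonal_absDirac τ hlf) (NonUnitalStarAlgHom.range (repHom τ)) (isSmooth_range τ hlf)

theorem mem_smoothStarAlgebra (hlf : LocallyFinite V) {T : L2 τ →L[ℂ] L2 τ} :
    T ∈ smoothStarAlgebra τ hlf ↔ T ∈ smoothAlgebra τ := by
  rw [smoothAlgebra_eq τ hlf]
  rfl

theorem rep_mem_smoothAlgebra (x : core V) : rep τ x ∈ smoothAlgebra τ :=
  ⟨fun _ => x, fun n ε hε => ⟨0, fun i _ j _ => by rw [sub_self]; exact .zero hε.le⟩,
    tendsto_const_nhds⟩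

/-- If `x_i → T` in the `δ`-topology, then `[D, x_i]` is `δ`-Cauchy: its own commutators with `|D|`
are among the seminorms, and those of `[D, [D, x_i]]` are controlled by four more orders. -/
theorem exists_isCommutator_mem (hlf : LocallyFinite V) (hns : NoSources V) {T : L2 τ →L[ℂ] L2 τ}
    (hT : T ∈ smoothAlgebra τ) : ∃ R ∈ smoothAlgebra τ, IsCommutator (dirac τ) T R := by
  have hΦ := isGrading τ hlf
  have hD := isDiagonal_dirac τ hlf
  obtain ⟨x, hx⟩ := exists_deltaTendsto τ hlf hT
  obtain ⟨-, -, R, hR, -⟩ := isSmooth_of_mem τ hlf hT 0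
  choose y hy using fun i => exists_isCommutator_rep τ hlf (x i)
  obtain ⟨C, hC, hbd⟩ := exists_second_commutator_bound τ hlf hns
  refine ⟨R, ⟨y, fun n ε hε => ?_, ?_⟩, hR⟩
  · obtain ⟨M, hM⟩ := hx.cauchy n ε hε
    obtain ⟨M', hM'⟩ := hx.cauchy (n + 4) (ε / (C + 1)) (by positivity)
    refine ⟨M + M', fun i hi j hj => ?_⟩
    obtain ⟨-, d, hd, hdb⟩ := hM i (by lia) j (by lia)
    have hb := (hM' i (by lia) j (by lia)).1
    rw [← rep_sub] at hb
    obtain ⟨y', z, h1, h2, h3⟩ := hbd n _ _ hb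
    have e1 := hD.isCommutator_unique hΦ hd ((hy i).sub (hy j))
    rw [rep_sub] at h1
    have e2 := hD.isCommutator_unique hΦ h1 ((hy i).sub (hy j))
    rw [e1] at hdb
    rw [e2] at h2
    refine ⟨hdb, _, h2, h3.mono ?_⟩
    rw [mul_div_assoc', div_le_iff₀ (by positivity)]
    nlinarith
  · rw [Metric.tendsto_atTop]
    intro ε hε
    obtain ⟨M, hM⟩ := hx 0 (ε / 2) (by positivity)
    refine ⟨M, fun i hi => ?_⟩
    obtain ⟨-, d, hd, _, rfl, hdb⟩ := hM i hi
    have e1 := hD.isCommutator_unique hΦ hd ((hy i).sub hR)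
    rw [dist_eq_norm, ← e1]
    exact hdb.trans_lt (by linarith)

end Smooth

section Triple

variable {V : Type u} [Quiver.{u + 1} V] (τ : GaugeTrace V)

/-! ### The spectral triple -/

theorem mem_gaugeN_of_tendsto {a : ℕ → L2 τ →L[ℂ] L2 τ} {T : L2 τ →L[ℂ] L2 τ}
    (ha : ∀ i, a i ∈ gaugeN τ) (h : Filter.Tendsto a Filter.atTop (nhds T)) : T ∈ gaugeN τ := by
  rw [mem_vonNeumann_iff]
  intro U hU
  refine tendsto_nhds_unique (h.const_mul U) ?_
  have h1 : (fun i => U * a i) = fun i => a i * U :=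
    funext fun i => mem_vonNeumann_iff.1 (ha i) U hU
  rw [h1]
  exact h.mul_const U

theorem smoothAlgebra_subset (hlf : LocallyFinite V) :
    smoothAlgebra τ ⊆ (gaugeN τ : Set (L2 τ →L[ℂ] L2 τ)) := by
  rintro T ⟨x, -, h⟩
  exact mem_gaugeN_of_tendsto τ (fun i => rep_mem τ hlf (x i)) h

theorem isAffiliated_dirac (hlf : LocallyFinite V) : IsAffiliated (gaugeN τ) (dirac τ) := by
  intro U hU _ x y h
  rw [isDiagonal_dirac τ hlf] at h ⊢
  intro k
  have h1 : ∀ z, Phi τ k (U z) = U (Phi τ k z) := fun z =>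
    congrArg (fun T : L2 τ →L[ℂ] L2 τ => T z) (commutant_Phi τ hlf hU k).symm
  rw [h1, h1, h, map_smul]

/-- The resolvent decays like `1 / (1 + |k|)`. -/
theorem exists_resolvent_bound {l : ℂ} (hl : l.im ≠ 0) :
    ∃ C : ℝ, 0 < C ∧ ∀ k : ℤ, ‖(l - (k : ℝ))⁻¹‖ ≤ C / (|(k : ℝ)| + 1) := by
  have h0 : 0 < |l.im| := abs_pos.2 hl
  -- `|k| + 1 ≤ |l - k| + (|l| + 1)`, and `|l - k| ≥ |Im l|` absorbs the constant.
  refine ⟨1 + (‖l‖ + 1) / |l.im|, by positivity, fun k => ?_⟩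
  have h1 : |l.im| ≤ ‖l - (k : ℝ)‖ := by
    have := Complex.abs_im_le_norm (l - (k : ℝ))
    simpa using this
  have h2 : |(k : ℝ)| ≤ ‖l - (k : ℝ)‖ + ‖l‖ := by
    have := norm_sub_le l (l - (k : ℝ))
    rw [sub_sub_cancel, Complex.norm_real, Real.norm_eq_abs] at this
    linarith
  have h3 : 0 < ‖l - (k : ℝ)‖ := h0.trans_le h1
  rw [norm_inv, le_div_iff₀ (by positivity), inv_mul_le_iff₀ h3, mul_add, mul_one, mul_div_assoc']
  have h4 : ‖l‖ + 1 ≤ ‖l - (k : ℝ)‖ * (‖l‖ + 1) / |l.im| := by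
    rw [le_div_iff₀ h0, mul_comm]
    gcongr
  linarith

/-- The projection onto the spectral subspaces of degree `|k| < n`. -/
def bandProj (n : ℕ) : L2 τ →L[ℂ] L2 τ := ∑ k ∈ Finset.Ioo (-(n : ℤ)) n, Phi τ k

theorem Phi_bandProj (hlf : LocallyFinite V) (n : ℕ) (k : ℤ) (x : L2 τ) :
    Phi τ k (bandProj τ n x) = (if |k| < n then 1 else 0 : ℂ) • Phi τ k x := by
  have hΦ := isGrading τ hlf
  rw [bandProj, sum_apply, map_sum]
  split_ifs with h
  · rw [Finset.sum_eq_single_of_mem k (Finset.mem_Ioo.2 (abs_lt.1 h)), hΦ.apply_self, one_smul]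
    exact fun j _ hj => hΦ.apply_ne hj.symm x
  · rw [zero_smul]
    refine Finset.sum_eq_zero fun j hj => hΦ.apply_ne (fun hkj => h ?_) x
    rw [hkj]
    exact abs_lt.2 (Finset.mem_Ioo.1 hj)

theorem norm_diag_mul_band_le (hlf : LocallyFinite V) {f : ℤ → ℂ} {R : L2 τ →L[ℂ] L2 τ}
    (hR : ∀ k x, Phi τ k (R x) = f k • Phi τ k x) (n : ℕ) {C : ℝ} (hC : 0 ≤ C)
    (h : ∀ k : ℤ, (n : ℤ) ≤ |k| → ‖f k‖ ≤ C) : ‖R * (1 - bandProj τ n)‖ ≤ C := by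
  refine ContinuousLinearMap.opNorm_le_bound _ hC fun x => ?_
  refine (isGrading τ hlf).norm_le_of_forall hC fun k => ?_
  rw [mul_apply_eq_comp, hR, show (1 - bandProj τ n) x = x - bandProj τ n x from rfl, map_sub, Phi_bandProj τ hlf]
  split_ifs with hk
  · rw [one_smul, sub_self, smul_zero, norm_zero]
    positivity
  · rw [zero_smul, sub_zero, norm_smul]
    gcongr
    exact h k (not_lt.1 hk)

theorem rep_mul_diag_comm (hlf : LocallyFinite V) {a : core V} (ha : Homog 0 a) {f : ℤ → ℂ}
    {R : L2 τ →L[ℂ] L2 τ} (hR : ∀ k x, Phi τ k (R x) = f k • Phi τ k x) :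
    rep τ a * R = R * rep τ a :=
  (isGrading τ hlf).commute_diag hR fun k => (Phi_rep_zero τ hlf ha k).symm

theorem tildeTrace_cut (hlf : LocallyFinite V) (v : V) (k : ℤ) :
    tildeTrace τ (rep τ (cP v) * Phi τ k) =
      vecTrace (fun i => cvec τ (frameElt i)) (rep τ (cP v) * Phi τ k) :=
  tildeTrace_eq τ (cut_proj τ hlf v k).nonneg

/-- The support projection `p_F` commutes with `R`. Cutting to `|k| < n` leaves finitely many terms
`x R (p_v Φ_k)` containing projections of finite trace, and the remainder is `O(1 / (n + 1))`. -/
theorem rep_mul_resolvent_compact (hlf : LocallyFinite V) (hns : NoSources V) {l : ℂ}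
    (hl : l.im ≠ 0) {R : L2 τ →L[ℂ] L2 τ}
    (hR : ∀ k x, Phi τ k (R x) = (l - (k : ℝ))⁻¹ • Phi τ k x) (x : core V) :
    rep τ x * R ∈ compacts (gaugeN τ) (tildeTrace τ) := by
  obtain ⟨C, hC, hb⟩ := exists_resolvent_bound hl
  obtain ⟨F, -, hF⟩ := exists_support hlf x
  have hRN : R ∈ gaugeN τ := diag_mem τ hlf hR
  have hlim : Filter.Tendsto (fun n => rep τ x * R * bandProj τ n) Filter.atTop
      (nhds (rep τ x * R)) := by
    rw [tendsto_iff_norm_sub_tendsto_zero]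
    have h1 : Filter.Tendsto (fun n : ℕ => ‖rep τ x‖ * (C * (1 / ((n : ℝ) + 1)))) Filter.atTop
        (nhds 0) := by
      simpa using (tendsto_one_div_add_atTop_nhds_zero_nat.const_mul C).const_mul ‖rep τ x‖
    refine squeeze_zero (fun n => norm_nonneg _) (fun n => ?_) h1
    rw [norm_sub_rev, show rep τ x * R - rep τ x * R * bandProj τ n =
      rep τ x * (R * (1 - bandProj τ n)) by noncomm_ring]
    refine (norm_mul_le _ _).trans ?_
    gcongr
    refine norm_diag_mul_band_le τ hlf hR n (by positivity) fun k hk => (hb k).trans ?_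
    have hk' : (n : ℝ) ≤ |(k : ℝ)| := by exact_mod_cast hk
    rw [mul_one_div]
    gcongr
  refine isClosed_closure.mem_of_tendsto hlim (Filter.Eventually.of_forall fun n =>
    subset_closure ?_)
  have h2 : rep τ x * R * bandProj τ n =
      ∑ k ∈ Finset.Ioo (-(n : ℤ)) n, ∑ v ∈ F, rep τ x * R * (rep τ (cP v) * Phi τ k) * 1 := by
    have h3 : rep τ x * R = rep τ x * R * ∑ v ∈ F, rep τ (cP v) := by
      rw [← rep_sum, ← cPF, mul_assoc, ← rep_mul_diag_comm τ hlf (homog_cPF F) hR, ← mul_assoc,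
        ← rep_mul, hF]
    conv_lhs => rw [h3, bandProj, Finset.mul_sum]
    refine Finset.sum_congr rfl fun k _ => ?_
    rw [Finset.mul_sum, Finset.sum_mul]
    refine Finset.sum_congr rfl fun v _ => ?_
    rw [mul_one, mul_assoc]
  rw [h2]
  refine sum_mem fun k _ => sum_mem fun v _ => Submodule.subset_span
    ⟨_, mul_mem (rep_mem τ hlf x) hRN, 1, one_mem _, _, cut_mem τ hlf v k, cut_proj τ hlf v k, ?_,
      rfl⟩
  rw [tildeTrace_cut τ hlf]
  exact (trace_cut_le τ hlf hns v k).trans_lt (trace_P_lt_top τ v)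

theorem exists_resolvent (hlf : LocallyFinite V) {l : ℂ} (hl : l.im ≠ 0) :
    ∃ R : L2 τ →L[ℂ] L2 τ, (∀ k x, Phi τ k (R x) = (l - (k : ℝ))⁻¹ • Phi τ k x) ∧
      IsResolvent (dirac τ) l R := by
  obtain ⟨C, hC, hb⟩ := exists_resolvent_bound hl
  obtain ⟨R, hR, -⟩ := (isGrading τ hlf).exists_diag (fun k => (l - (k : ℝ))⁻¹) C fun k =>
    (hb k).trans (div_le_self hC.le (by linarith [abs_nonneg (k : ℝ)]))
  exact ⟨R, hR, (isDiagonal_dirac τ hlf).isResolvent (isGrading τ hlf) hl hR⟩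

theorem isSemifiniteSpectralTriple (hlf : LocallyFinite V) (hns : NoSources V) :
    IsSemifiniteSpectralTriple (gaugeN τ) (tildeTrace τ) (smoothAlgebra τ) (dirac τ) where
  trace := isTrace_tildeTrace τ hlf hns
  starAlgebra := ⟨smoothStarAlgebra τ hlf, Set.ext fun _ => mem_smoothStarAlgebra τ hlf⟩
  subset := smoothAlgebra_subset τ hlf
  selfAdjoint := (isDiagonal_dirac τ hlf).isSelfAdjoint (isGrading τ hlf)
  affiliated := isAffiliated_dirac τ hlf
  commutator a ha := by
    obtain ⟨R, hR, h⟩ := exists_isCommutator_mem τ hlf hns ha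
    exact ⟨R, smoothAlgebra_subset τ hlf hR, h⟩
  compact l hl := by
    obtain ⟨R, hR, hres⟩ := exists_resolvent τ hlf hl
    refine ⟨R, hres, ?_⟩
    rintro T ⟨x, -, h⟩
    exact isClosed_closure.mem_of_tendsto (h.mul_const R) (Filter.Eventually.of_forall fun i =>
      rep_mul_resolvent_compact τ hlf hns hl hR (x i))

theorem isQCInfty (hlf : LocallyFinite V) :
    IsQCInfty (smoothAlgebra τ) (dirac τ) (absDirac τ) := by
  intro k _ a ha
  obtain ⟨C, ⟨R, hR, -⟩, d, hd, R', hR', -⟩ := isSmooth_of_mem τ hlf ha k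
  exact ⟨⟨R, hR⟩, d, hd, R', hR'⟩

/-- Anticommutation makes `Γ` send degree `k` to degree `-k`, so `Γ p_v` has degree `0`. For an edge
`μ` into `v`, `Γ S_μ = S_μ Γ p_v` then has degree `1`, but also degree `-1`; it vanishes, against
`Γ² = 1` and `S_μ ≠ 0`. -/
theorem isOdd [Nonempty V] (hlf : LocallyFinite V) (hns : NoSources V) :
    IsOdd (gaugeN τ) (smoothAlgebra τ) (dirac τ) := by
  rintro ⟨Γ, -, -, hsq, hcom, hanti⟩
  have hΦ := isGrading τ hlf
  have hD := isDiagonal_dirac τ hlf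
  have hdeg : ∀ (k j : ℤ) (x : L2 τ), j ≠ -k → Phi τ j (Γ (Phi τ k x)) = 0 := by
    intro k j x hj
    have h1 := (hD _ _).1 (hanti _ _ (hD.mem_graph_apply hΦ k x)) j
    rw [map_smul, map_neg, map_smul, ← sub_eq_zero, ← neg_add', neg_eq_zero, ← add_smul,
      smul_eq_zero] at h1
    refine h1.resolve_left fun h2 => hj ?_
    dsimp only at h2
    norm_cast at h2
    lia
  obtain ⟨v⟩ := ‹Nonempty V›
  obtain ⟨u, μ, hμ⟩ := exists_path_to hns v 1
  have hS : Homog 1 (cS μ) := by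
    have := homog_cS μ
    rwa [hμ] at this
  have h1 : Γ (cvec τ (cS μ)) = rep τ (cS μ) (Γ (cvec τ (cP v))) := by
    have := congrArg (fun T : L2 τ →L[ℂ] L2 τ => T (cvec τ (cP v)))
      (hcom _ (rep_mem_smoothAlgebra τ (cS μ)))
    simp only [mul_apply_eq_comp] at this
    rw [this, rep_cvec, cS_mul_cP]
  have h2 : Γ (cvec τ (cP v)) = Phi τ 0 (Γ (cvec τ (cP v))) := by
    refine hΦ.ext_apply fun k => ?_
    rcases eq_or_ne k 0 with rfl | hk
    · rw [hΦ.apply_self]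
    · rw [hΦ.apply_ne hk, ← Phi_cvec τ (homog_cP v)]
      exact hdeg 0 k _ (by simpa using hk)
  have h3 : Phi τ 1 (Γ (cvec τ (cS μ))) = Γ (cvec τ (cS μ)) := by
    have := congrArg (fun T : L2 τ →L[ℂ] L2 τ => T (Γ (cvec τ (cP v)))) (Phi_rep τ hlf hS 0)
    simp only [mul_apply_eq_comp, zero_add] at this
    rw [h1, this, ← h2]
  have h4 : Γ (cvec τ (cS μ)) = 0 := by
    rw [← h3, ← Phi_cvec τ hS]
    exact hdeg 1 1 _ (by norm_num)
  have h5 : cvec τ (cS μ) = 0 := by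
    have := congrArg (fun T : L2 τ →L[ℂ] L2 τ => T (cvec τ (cS μ))) hsq
    simp only [mul_apply_eq_comp, h4, map_zero] at this
    exact this.symm
  have h6 := ofReal_norm_cS τ hlf μ
  rw [h5, norm_zero, zero_pow two_ne_zero, ENNReal.ofReal_zero] at h6
  exact P_ne_zero hlf v (τ.faithful _ (isStarProjection_P v).nonneg h6.symm)

/-! ### Locality -/

theorem sum_repP (F : Finset V) : ∑ v ∈ F, repP τ v = rep τ (cPF F) := by
  rw [cPF, rep_sum]
  rfl

theorem cPF_mul_eq {F G : Finset V} (h : F ⊆ G) {T : L2 τ →L[ℂ] L2 τ}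
    (hT : rep τ (cPF F) * T = T) : rep τ (cPF G) * T = T := by
  rw [← hT, ← mul_assoc, ← rep_mul, cPF_mul_cPF h]

theorem mul_cPF_eq {F G : Finset V} (h : F ⊆ G) {T : L2 τ →L[ℂ] L2 τ}
    (hT : T * rep τ (cPF F) = T) : T * rep τ (cPF G) = T := by
  have h1 : cPF F * cPF G = cPF F := by
    have := congrArg star (cPF_mul_cPF h)
    rwa [star_mul, star_cPF, star_cPF] at this
  rw [← hT, mul_assoc, ← rep_mul, h1]

theorem mem_finitelySupported {T : L2 τ →L[ℂ] L2 τ} : T ∈ finitelySupported τ ↔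
    T ∈ smoothAlgebra τ ∧ ∃ F : Finset V, rep τ (cPF F) * T = T ∧ T * rep τ (cPF F) = T := by
  simp only [finitelySupported, sum_repP]
  rfl

theorem rep_mem_finitelySupported (hlf : LocallyFinite V) (x : core V) :
    rep τ x ∈ finitelySupported τ := by
  obtain ⟨F, h1, h2⟩ := exists_support hlf x
  exact (mem_finitelySupported τ).2 ⟨rep_mem_smoothAlgebra τ x, F, by rw [← rep_mul, h1],
    by rw [← rep_mul, h2]⟩

/-- The finitely supported elements as a ⋆-algebra. -/
def finitelySupportedAlgebra (hlf : LocallyFinite V) :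
    NonUnitalStarSubalgebra ℂ (L2 τ →L[ℂ] L2 τ) where
  carrier := finitelySupported τ
  add_mem' {S T} hS hT := by
    classical
    rw [mem_finitelySupported] at *
    obtain ⟨hS, F, h1, h2⟩ := hS
    obtain ⟨hT, G, h3, h4⟩ := hT
    refine ⟨?_, F ∪ G, ?_, ?_⟩
    · rw [← mem_smoothStarAlgebra τ hlf] at *
      exact add_mem hS hT
    · rw [mul_add, cPF_mul_eq τ Finset.subset_union_left h1,
        cPF_mul_eq τ Finset.subset_union_right h3]
    · rw [add_mul, mul_cPF_eq τ Finset.subset_union_left h2,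
        mul_cPF_eq τ Finset.subset_union_right h4]
  zero_mem' := by
    rw [← rep_zero]
    exact rep_mem_finitelySupported τ hlf 0
  mul_mem' {S T} hS hT := by
    classical
    rw [mem_finitelySupported] at *
    obtain ⟨hS, F, h1, h2⟩ := hS
    obtain ⟨hT, G, h3, h4⟩ := hT
    refine ⟨?_, F ∪ G, ?_, ?_⟩
    · rw [← mem_smoothStarAlgebra τ hlf] at *
      exact mul_mem hS hT
    · rw [← mul_assoc, cPF_mul_eq τ Finset.subset_union_left h1]
    · rw [mul_assoc, mul_cPF_eq τ Finset.subset_union_right h4]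
  smul_mem' c T hT := by
    rw [mem_finitelySupported] at *
    obtain ⟨hT, F, h1, h2⟩ := hT
    refine ⟨?_, F, ?_, ?_⟩
    · rw [← mem_smoothStarAlgebra τ hlf] at *
      exact SMulMemClass.smul_mem c hT
    · rw [mul_smul_comm, h1]
    · rw [smul_mul_assoc, h2]
  star_mem' {T} hT := by
    rw [mem_finitelySupported] at *
    obtain ⟨hT, F, h1, h2⟩ := hT
    have hs : star (rep τ (cPF F)) = rep τ (cPF F) := by rw [star_rep, star_cPF]
    refine ⟨?_, F, ?_, ?_⟩
    · rw [← mem_smoothStarAlgebra τ hlf] at *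
      exact star_mem hT
    · have := congrArg star h2
      rwa [star_mul, hs] at this
    · have := congrArg star h1
      rwa [star_mul, hs] at this

theorem isCommutator_cPF (hlf : LocallyFinite V) (f : ℤ → ℝ) (F : Finset V) :
    IsCommutator (gaugeOp τ f) (rep τ (cPF F)) 0 := by
  have hΦ := isGrading τ hlf
  rw [(isDiagonal_gaugeOp τ hlf f).isCommutator_iff hΦ]
  intro k j x
  have h := congrArg (fun T : L2 τ →L[ℂ] L2 τ => T x) (Phi_rep_zero τ hlf (homog_cPF F) j)
  simp only [mul_apply_eq_comp] at h
  rw [zero_apply, map_zero, ← h]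
  rcases eq_or_ne k j with rfl | hk
  · rw [sub_self, Complex.ofReal_zero, zero_smul]
  · rw [hΦ.apply_ne hk, smul_zero]

theorem isCommutator_cPF_mul (hlf : LocallyFinite V) {f : ℤ → ℝ} (F : Finset V)
    {T R : L2 τ →L[ℂ] L2 τ} (h : IsCommutator (gaugeOp τ f) T R) :
    IsCommutator (gaugeOp τ f) (rep τ (cPF F) * T) (rep τ (cPF F) * R) := by
  simpa using (isCommutator_cPF τ hlf f F).mul h

theorem isCommutator_mul_cPF (hlf : LocallyFinite V) {f : ℤ → ℝ} (F : Finset V)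
    {T R : L2 τ →L[ℂ] L2 τ} (h : IsCommutator (gaugeOp τ f) T R) :
    IsCommutator (gaugeOp τ f) (T * rep τ (cPF F)) (R * rep τ (cPF F)) := by
  simpa using h.mul (isCommutator_cPF τ hlf f F)

theorem rep_cPF_proj (F : Finset V) : IsStarProjection (rep τ (cPF F)) where
  isIdempotentElem := by
    change rep τ (cPF F) * rep τ (cPF F) = _
    rw [← rep_mul, cPF_mul_cPF (Finset.Subset.refl F)]
  isSelfAdjoint := by
    change star (rep τ (cPF F)) = _
    rw [star_rep, star_cPF]

theorem norm_cPF_le (F : Finset V) : ‖rep τ (cPF F)‖ ≤ 1 := norm_proj_le_one (rep_cPF_proj τ F)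

theorem iterBound_cPF_mul (hlf : LocallyFinite V) (F : Finset V) {n : ℕ} {ε : ℝ} :
    ∀ {T : L2 τ →L[ℂ] L2 τ}, IterBound (absDirac τ) n ε T →
      IterBound (absDirac τ) n ε (rep τ (cPF F) * T) := by
  induction n with
  | zero =>
    rintro T ⟨_, rfl, h⟩
    refine ⟨_, rfl, (norm_mul_le _ _).trans ?_⟩
    calc _ ≤ 1 * ‖T‖ := by gcongr; exact norm_cPF_le τ F
      _ ≤ ε := by rwa [one_mul]
  | succ n ih =>
    rintro T ⟨R, ⟨T', h1, h2⟩, h⟩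
    obtain ⟨R', h3, h4⟩ := ih ⟨R, h2, h⟩
    exact ⟨R', ⟨_, isCommutator_cPF_mul τ hlf F h1, h3⟩, h4⟩

theorem deltaBound_cPF_mul (hlf : LocallyFinite V) (F : Finset V) {n : ℕ} {ε : ℝ}
    {T : L2 τ →L[ℂ] L2 τ} (h : DeltaBound (dirac τ) (absDirac τ) n ε T) :
    DeltaBound (dirac τ) (absDirac τ) n ε (rep τ (cPF F) * T) := by
  obtain ⟨h1, d, hd, h2⟩ := DeltaBound.iff_iterBound.1 h
  exact DeltaBound.iff_iterBound.2 ⟨iterBound_cPF_mul τ hlf F h1, _,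
    isCommutator_cPF_mul τ hlf F hd, iterBound_cPF_mul τ hlf F h2⟩

/-- As `p_F` is a contraction commuting with `D` and `|D|`, multiplication by it increases no
seminorm. On the core `p_F x = x` once `F` is large, and approximation does the rest. -/
theorem deltaTendsto_cPF_mul (hlf : LocallyFinite V) {F : ℕ → Finset V}
    (hF : ∀ G : Finset V, ∃ n, ∀ m ≥ n, G ⊆ F m) {T : L2 τ →L[ℂ] L2 τ}
    (hT : T ∈ smoothAlgebra τ) :
    DeltaTendsto (dirac τ) (absDirac τ) (fun n => rep τ (cPF (F n)) * T) T := by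
  intro n ε hε
  rw [smoothAlgebra_eq τ hlf] at hT
  obtain ⟨_, ⟨x, rfl⟩, hc⟩ := deltaClosure.exists_approx hT n (half_pos hε)
  replace hc : ∀ m ≤ n, DeltaBound (dirac τ) (absDirac τ) m (ε / 2) (rep τ x - T) := hc
  obtain ⟨G, hG⟩ := exists_cPF_mul hlf x
  obtain ⟨M, hM⟩ := hF G
  refine ⟨M, fun i hi => ?_⟩
  have h1 : rep τ (cPF (F i)) * rep τ x = rep τ x := by
    rw [← rep_mul, cPF_mul_mono (hM i hi) hG]
  have h2 : rep τ (cPF (F i)) * T - T =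
      (rep τ x - T) - rep τ (cPF (F i)) * (rep τ x - T) := by
    rw [mul_sub, h1]
    abel
  rw [h2]
  exact ((hc n le_rfl).sub (deltaBound_cPF_mul τ hlf (F i) (hc n le_rfl))).mono
    (le_of_eq (add_halves ε))

/-- Both `𝒜` and its finitely supported part are stable under `[D, ·]`, so passing to `Ω` adds
nothing and the last locality condition becomes a comparison of supports. -/
theorem omega_eq {H : Type*} [NormedAddCommGroup H] [InnerProductSpace ℂ H] [CompleteSpace H]
    {D : H →ₗ.[ℂ] H} (𝒮 : NonUnitalStarSubalgebra ℂ (H →L[ℂ] H))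
    (h : ∀ a ∈ 𝒮, ∀ R, IsCommutator D a R → R ∈ 𝒮) :
    (Omega (𝒮 : Set (H →L[ℂ] H)) D : Set (H →L[ℂ] H)) = 𝒮 := by
  refine Set.Subset.antisymm ?_ fun a ha => NonUnitalAlgebra.subset_adjoin ℂ (Or.inl ha)
  have : Omega (𝒮 : Set (H →L[ℂ] H)) D ≤ 𝒮.toNonUnitalSubalgebra := by
    refine NonUnitalAlgebra.adjoin_le ?_
    rintro T (hT | ⟨a, ha, hR⟩)
    · exact hT
    · exact h a ha T hR
  exact this

theorem omega_smoothAlgebra (hlf : LocallyFinite V) (hns : NoSources V) :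
    (Omega (smoothAlgebra τ) (dirac τ) : Set (L2 τ →L[ℂ] L2 τ)) = smoothAlgebra τ := by
  have h0 : (smoothStarAlgebra τ hlf : Set (L2 τ →L[ℂ] L2 τ)) = smoothAlgebra τ :=
    Set.ext fun _ => mem_smoothStarAlgebra τ hlf
  have h := omega_eq (D := dirac τ) (smoothStarAlgebra τ hlf) fun a ha R hR => by
    rw [mem_smoothStarAlgebra] at ha ⊢
    obtain ⟨R', hR', h'⟩ := exists_isCommutator_mem τ hlf hns ha
    rwa [(isDiagonal_dirac τ hlf).isCommutator_unique (isGrading τ hlf) hR h']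
  rwa [h0] at h

theorem omega_finitelySupported (hlf : LocallyFinite V) (hns : NoSources V) :
    (Omega (finitelySupported τ) (dirac τ) : Set (L2 τ →L[ℂ] L2 τ)) = finitelySupported τ := by
  have hu := fun {T R R'} => (isDiagonal_dirac τ hlf).isCommutator_unique (T := T) (R := R)
    (R' := R') (isGrading τ hlf)
  refine omega_eq (D := dirac τ) (finitelySupportedAlgebra τ hlf) fun a ha R hR => ?_
  obtain ⟨h1, F, h2, h3⟩ := (mem_finitelySupported τ).1 ha
  refine (mem_finitelySupported τ).2 ⟨?_, F, ?_, ?_⟩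
  · obtain ⟨R', hR', h'⟩ := exists_isCommutator_mem τ hlf hns h1
    rwa [hu hR h']
  · have := isCommutator_cPF_mul τ hlf F hR
    rw [h2] at this
    exact hu this hR
  · have := isCommutator_mul_cPF τ hlf F hR
    rw [h3] at this
    exact hu this hR

theorem exists_exhaustion [Countable V] :
    ∃ F : ℕ → Finset V, ∀ G : Finset V, ∃ n, ∀ m ≥ n, G ⊆ F m := by
  classical
  rcases isEmpty_or_nonempty V with h | h
  · exact ⟨fun _ => ∅, fun G => ⟨0, fun m _ v _ => isEmptyElim v⟩⟩
  · obtain ⟨e, he⟩ := exists_surjective_nat V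
    choose g hg using he
    refine ⟨fun n => (Finset.range (n + 1)).image e, fun G => ⟨∑ v ∈ G, g v, fun m hm v hv => ?_⟩⟩
    refine Finset.mem_image.2 ⟨g v, Finset.mem_range.2 ?_, hg v⟩
    have := Finset.single_le_sum (f := g) (fun _ _ => Nat.zero_le _) hv
    lia

theorem isLocal [Countable V] (hlf : LocallyFinite V) (hns : NoSources V) :
    IsLocal (finitelySupported τ) (smoothAlgebra τ) (dirac τ) (absDirac τ) where
  complete a ha hc := by
    rw [smoothAlgebra_eq τ hlf] at *
    exact deltaClosure.complete (isGrading τ hlf) (isDiagonal_dirac τ hlf)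
      (isDiagonal_absDirac τ hlf) (isSmooth_range τ hlf) ha hc
  starAlgebra := ⟨finitelySupportedAlgebra τ hlf, rfl⟩
  subset _ hT := hT.1
  dense b hb := by
    obtain ⟨x, hx⟩ := exists_deltaTendsto τ hlf hb
    exact ⟨_, fun i => rep_mem_finitelySupported τ hlf (x i), hx⟩
  localUnits s hs := by
    classical
    have h1 : ∀ a : L2 τ →L[ℂ] L2 τ, ∃ F : Finset V, a ∈ s →
        rep τ (cPF F) * a = a ∧ a * rep τ (cPF F) = a := fun a => by
      by_cases ha : a ∈ s
      · obtain ⟨-, F, hF⟩ := (mem_finitelySupported τ).1 (hs ha)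
        exact ⟨F, fun _ => hF⟩
      · exact ⟨∅, fun h => absurd h ha⟩
    choose F hF using h1
    refine ⟨rep τ (cPF (s.biUnion F)), rep_mem_finitelySupported τ hlf _, fun a ha => ?_⟩
    have hsub := Finset.subset_biUnion_of_mem F ha
    exact ⟨cPF_mul_eq τ hsub (hF a ha).1, mul_cPF_eq τ hsub (hF a ha).2⟩
  approxUnit := by
    obtain ⟨F, hF⟩ := exists_exhaustion (V := V)
    refine ⟨fun n => rep τ (cPF (F n)), fun n => rep_mem_finitelySupported τ hlf _, fun a ha =>
      ⟨deltaTendsto_cPF_mul τ hlf hF ha, ?_⟩, ?_⟩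
    · have ha' : star a ∈ smoothAlgebra τ := by
        rw [← mem_smoothStarAlgebra τ hlf] at *
        exact star_mem ha
      have h := (deltaTendsto_cPF_mul τ hlf hF ha').star (isGrading τ hlf)
        (isDiagonal_dirac τ hlf) (isDiagonal_absDirac τ hlf)
      simpa only [star_mul, star_star, star_rep, star_cPF] using h
    · have hΩ : ∀ w, w ∈ Omega (smoothAlgebra τ) (dirac τ) ↔ w ∈ smoothAlgebra τ := fun w =>
        Set.ext_iff.1 (omega_smoothAlgebra τ hlf hns) w
      rw [omega_finitelySupported τ hlf hns]
      ext w
      simp only [Set.mem_iUnion]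
      constructor
      · intro hw
        obtain ⟨h1, G, h2, h3⟩ := (mem_finitelySupported τ).1 hw
        obtain ⟨n, hn⟩ := hF G
        exact ⟨n, (hΩ w).2 h1, cPF_mul_eq τ (hn n le_rfl) h2, mul_cPF_eq τ (hn n le_rfl) h3⟩
      · rintro ⟨n, h1, h2, h3⟩
        exact (mem_finitelySupported τ).2 ⟨(hΩ w).1 h1, F n, h2, h3⟩

end Triple

section Summability

variable {V : Type u} [Quiver.{u + 1} V] (τ : GaugeTrace V)

/-! ### Summability -/

theorem bandProj_proj (hlf : LocallyFinite V) (n : ℕ) : IsStarProjection (bandProj τ n) where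
  isIdempotentElem := by
    change bandProj τ n * bandProj τ n = _
    ext x
    refine (isGrading τ hlf).ext_apply fun k => ?_
    rw [mul_apply_eq_comp, Phi_bandProj τ hlf, Phi_bandProj τ hlf]
    split_ifs <;> simp
  isSelfAdjoint := by
    refine IsSelfAdjoint.of_nonneg ((isGrading τ hlf).diag_nonneg
      (f := fun k : ℤ => if |k| < n then 1 else 0) (fun k => ?_) fun k x => ?_)
    · split_ifs <;> norm_num
    · rw [Phi_bandProj τ hlf]
      split_ifs <;> simp

theorem bandProj_zero : bandProj τ 0 = 0 := by
  rw [bandProj]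
  simp

theorem bandProj_mem (hlf : LocallyFinite V) (n : ℕ) : bandProj τ n ∈ gaugeN τ :=
  diag_mem τ hlf (Phi_bandProj τ hlf n)

theorem rep_cPF_mul_band_comm (hlf : LocallyFinite V) (F : Finset V) (n : ℕ) :
    rep τ (cPF F) * bandProj τ n = bandProj τ n * rep τ (cPF F) :=
  rep_mul_diag_comm τ hlf (homog_cPF F) (Phi_bandProj τ hlf n)

theorem band_cut_proj (hlf : LocallyFinite V) (F : Finset V) (n : ℕ) :
    IsStarProjection (rep τ (cPF F) * bandProj τ n) where
  isIdempotentElem := (rep_cPF_proj τ F).isIdempotentElem.mul_of_commute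
    (rep_cPF_mul_band_comm τ hlf F n) (bandProj_proj τ hlf n).isIdempotentElem
  isSelfAdjoint := by
    change star (_ * _) = _
    rw [star_mul, (rep_cPF_proj τ F).isSelfAdjoint.star_eq,
      (bandProj_proj τ hlf n).isSelfAdjoint.star_eq, rep_cPF_mul_band_comm τ hlf]

theorem tildeTrace_band_cut (hlf : LocallyFinite V) (hns : NoSources V) (F : Finset V) (n : ℕ) :
    tildeTrace τ (rep τ (cPF F) * bandProj τ n) = ∑ v ∈ F, ∑ k ∈ Finset.Ioo (-(n : ℤ)) n,
      vecTrace (fun i => cvec τ (frameElt i)) (rep τ (cP v) * Phi τ k) := by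
  have ht := isTrace_tildeTrace τ hlf hns
  rw [cPF, rep_sum, bandProj, Finset.sum_mul]
  simp only [Finset.mul_sum]
  rw [ht.map_sum F (fun v => sum_mem fun k _ => cut_mem τ hlf v k)
    fun v => Finset.sum_nonneg fun k _ => (cut_proj τ hlf v k).nonneg]
  refine Finset.sum_congr rfl fun v _ => ?_
  rw [ht.map_sum _ (fun k => cut_mem τ hlf v k) fun k => (cut_proj τ hlf v k).nonneg]
  exact Finset.sum_congr rfl fun k _ => tildeTrace_cut τ hlf v k

/-- Off the cut-off projections, a finitely supported operator times a diagonal one only sees the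
spectral subspaces of high degree. -/
theorem mul_diag_mul_one_sub_cut (hlf : LocallyFinite V) {a R : L2 τ →L[ℂ] L2 τ} {F : Finset V}
    (ha : a * rep τ (cPF F) = a) {f : ℤ → ℂ} (hR : ∀ k x, Phi τ k (R x) = f k • Phi τ k x)
    (n : ℕ) :
    a * R * (1 - rep τ (cPF F) * bandProj τ n) = a * (R * (1 - bandProj τ n)) := by
  have hc := rep_mul_diag_comm τ hlf (homog_cPF F) hR
  have hi : rep τ (cPF F) * rep τ (cPF F) = rep τ (cPF F) :=
    (rep_cPF_proj τ F).isIdempotentElem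
  have h1 : a * R * rep τ (cPF F) = a * R := by rw [mul_assoc, ← hc, ← mul_assoc, ha]
  rw [mul_sub, mul_one, ← mul_assoc, h1, mul_sub, mul_one, mul_sub, mul_assoc]

theorem isOneInftySummable (hlf : LocallyFinite V) (hns : NoSources V) :
    IsOneInftySummable (gaugeN τ) (tildeTrace τ) (finitelySupported τ) (dirac τ) := by
  intro l hl
  obtain ⟨R, hR, hres⟩ := exists_resolvent τ hlf hl
  refine ⟨R, hres, fun a ha => ?_⟩
  obtain ⟨haS, F, -, haF⟩ := (mem_finitelySupported τ).1 ha
  obtain ⟨C, hC, hb⟩ := exists_resolvent_bound hl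
  have hN : a * R ∈ gaugeN τ := mul_mem (smoothAlgebra_subset τ hlf haS) (diag_mem τ hlf hR)
  set K : ℝ := ∑ v ∈ F, (τ (P v)).toReal with hK
  have hK0 : 0 ≤ K := Finset.sum_nonneg fun v _ => ENNReal.toReal_nonneg
  -- At most `2n` degrees satisfy `|k| < n`, each of trace at most `K` on `F`. The rate `2K + 1` is
  -- used because `dixmierFun_le` needs it positive even for empty `F`.
  refine ⟨hN, ‖a‖ * C * (2 * K + 1 + 1), fun s hs => dixmierFun_le
    (isTrace_tildeTrace τ hlf hns).map_zero (by positivity) (by positivity) (fun n => ?_) hs⟩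
  have hQ := band_cut_proj τ hlf F n
  refine ⟨1 - rep τ (cPF F) * bandProj τ n, sub_mem (one_mem _)
    (mul_mem (rep_mem τ hlf _) (bandProj_mem τ hlf n)), hQ.one_sub, ?_, ?_⟩
  · rw [sub_sub_cancel, tildeTrace_band_cut τ hlf hns]
    have hcard : ((Finset.Ioo (-(n : ℤ)) n).card : ℝ≥0∞) ≤ ENNReal.ofReal (2 * n) := by
      rw [← ENNReal.ofReal_natCast]
      refine ENNReal.ofReal_le_ofReal ?_
      rw [Int.card_Ioo]
      have : ((n : ℤ) - -(n : ℤ) - 1).toNat ≤ 2 * n := by lia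
      exact_mod_cast this
    calc _ ≤ ∑ v ∈ F, ∑ k ∈ Finset.Ioo (-(n : ℤ)) n, τ (P v) := by
          gcongr with v hv k hk
          exact trace_cut_le τ hlf hns v k
      _ = (Finset.Ioo (-(n : ℤ)) n).card * ENNReal.ofReal K := by
          simp only [Finset.sum_const, nsmul_eq_mul]
          rw [← Finset.mul_sum, hK, ENNReal.ofReal_sum_of_nonneg fun v _ => ENNReal.toReal_nonneg]
          refine congrArg _ (Finset.sum_congr rfl fun v _ => ?_)
          rw [ENNReal.ofReal_toReal (trace_P_lt_top τ v).ne]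
      _ ≤ ENNReal.ofReal (2 * n) * ENNReal.ofReal K := by gcongr
      _ ≤ ENNReal.ofReal ((2 * K + 1) * n) := by
          rw [← ENNReal.ofReal_mul (by positivity)]
          refine ENNReal.ofReal_le_ofReal ?_
          have : (0 : ℝ) ≤ n := n.cast_nonneg
          nlinarith
  · rw [mul_diag_mul_one_sub_cut τ hlf haF hR, mul_div_assoc]
    refine (norm_mul_le _ _).trans ?_
    gcongr
    refine norm_diag_mul_band_le τ hlf hR n (by positivity) fun k hk => (hb k).trans ?_
    have hk' : (n : ℝ) ≤ |(k : ℝ)| := by exact_mod_cast hk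
    gcongr

/-! ### The operator `(1 + D²)^(-1/2)` -/

theorem invSqrt_pos (k : ℝ) : 0 < (√(1 + k ^ 2))⁻¹ := by positivity

theorem invSqrt_anti {n k : ℝ} (hn : 0 ≤ n) (h : n ≤ |k|) :
    (√(1 + k ^ 2))⁻¹ ≤ (√(1 + n ^ 2))⁻¹ := by
  rw [← sq_abs k]
  gcongr

theorem isInvSqrtOneAddSq (hlf : LocallyFinite V) {B : L2 τ →L[ℂ] L2 τ}
    (hB : ∀ k x, Phi τ k (B x) = (((√(1 + (k : ℝ) ^ 2))⁻¹ : ℝ) : ℂ) • Phi τ k x) :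
    IsInvSqrtOneAddSq (dirac τ) B where
  nonneg := (isGrading τ hlf).diag_nonneg (fun k => (invSqrt_pos (k : ℤ)).le) hB
  sq x y := by
    have hΦ := isGrading τ hlf
    have hz : (∃ z, SqRel (dirac τ) y z ∧ y + z = x) ↔ SqRel (dirac τ) y (x - y) :=
      ⟨by rintro ⟨z, hz, rfl⟩; rwa [add_sub_cancel_left], fun h => ⟨_, h, add_sub_cancel y x⟩⟩
    rw [hz, (isDiagonal_dirac τ hlf).sqRel_iff hΦ fun k hk => one_le_abs_intCast hk]
    have hk : ∀ k : ℤ, Phi τ k (B (B x)) = ((1 + (k : ℝ) ^ 2 : ℝ) : ℂ)⁻¹ • Phi τ k x := fun k => by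
      rw [hB, hB, smul_smul, ← Complex.ofReal_mul, ← mul_inv,
        Real.mul_self_sqrt (by positivity), Complex.ofReal_inv]
    have hne : ∀ k : ℤ, ((1 + (k : ℝ) ^ 2 : ℝ) : ℂ) ≠ 0 := fun k => by
      have : (1 + (k : ℝ) ^ 2 : ℝ) ≠ 0 := by positivity
      exact_mod_cast this
    have h2 : ∀ k : ℤ, Phi τ k (x - y) = (((k : ℝ) ^ 2 : ℝ) : ℂ) • Phi τ k y ↔
        Phi τ k (B (B x)) = Phi τ k y := fun k => by
      rw [hk, inv_smul_eq_iff₀ (hne k), map_sub, sub_eq_iff_eq_add, Complex.ofReal_add, add_smul,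
        Complex.ofReal_one, one_smul, add_comm (Phi τ k y)]
    simp only [h2]
    exact ⟨fun h k => by rw [h], hΦ.ext_apply⟩

theorem exists_invSqrt (hlf : LocallyFinite V) : ∃ B : L2 τ →L[ℂ] L2 τ,
    ∀ k x, Phi τ k (B x) = (((√(1 + (k : ℝ) ^ 2))⁻¹ : ℝ) : ℂ) • Phi τ k x := by
  obtain ⟨B, hB, -⟩ := (isGrading τ hlf).exists_diag
    (fun k => (((√(1 + (k : ℝ) ^ 2))⁻¹ : ℝ) : ℂ)) 1 fun k => by
      rw [Complex.norm_real, Real.norm_of_nonneg (invSqrt_pos (k : ℝ)).le]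
      refine inv_le_one_of_one_le₀ (Real.one_le_sqrt.2 ?_)
      nlinarith [sq_nonneg (k : ℝ)]
  exact ⟨B, hB⟩

theorem cPF_singleton (v : V) : cPF {v} = cP v := by simp [cPF]

theorem repP_mul_nonneg (hlf : LocallyFinite V) {B : L2 τ →L[ℂ] L2 τ}
    (hB : ∀ k x, Phi τ k (B x) = (((√(1 + (k : ℝ) ^ 2))⁻¹ : ℝ) : ℂ) • Phi τ k x) (v : V) :
    0 ≤ rep τ (cP v) * B := by
  have hp := rep_cP_proj τ v
  have h : rep τ (cP v) * B = star (rep τ (cP v)) * B * rep τ (cP v) := by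
    rw [hp.isSelfAdjoint.star_eq, mul_assoc, ← rep_mul_diag_comm τ hlf (homog_cP v) hB, ← mul_assoc,
      hp.isIdempotentElem.eq]
  rw [h]
  exact star_left_conjugate_nonneg (isInvSqrtOneAddSq τ hlf hB).nonneg _

/-- Without sinks downstream each degree contributes exactly `τ(p_v)`, and `2n + 1` degrees satisfy
`|k| ≤ n`. Hence the cut-offs `p_v 1_{|k| < n}` have the traces required by
`dixmier_of_spectralProjections` with `c = τ(p_v)`. -/
theorem dixmier_repP (hlf : LocallyFinite V) (hns : NoSources V) {B : L2 τ →L[ℂ] L2 τ}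
    (hB : ∀ k x, Phi τ k (B x) = (((√(1 + (k : ℝ) ^ 2))⁻¹ : ℝ) : ℂ) • Phi τ k x) {v : V}
    (hv : NoSinksDownstream v) :
    rep τ (cP v) * B ∈ dixmierIdeal (gaugeN τ) (tildeTrace τ) ∧
      ∀ ω : MeasureTheory.Lp ℝ ∞ (MeasureTheory.volume.restrict (Set.Ioi (0 : ℝ))) →L[ℝ] ℝ,
        IsGeneralizedLimit ω →
        ∃ hF : MeasureTheory.MemLp (dixmierFun (gaugeN τ) (tildeTrace τ) (rep τ (cP v) * B)) ∞
            (MeasureTheory.volume.restrict (Set.Ioi (0 : ℝ))),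
          ω (hF.toLp _) = 2 * (τ (P v)).toReal := by
  have hfin := (trace_P_lt_top τ v).ne
  have hc : 0 < (τ (P v)).toReal := ENNReal.toReal_pos
    (fun h => P_ne_zero hlf v (τ.faithful _ (isStarProjection_P v).nonneg h)) hfin
  refine dixmier_of_spectralProjections (isTrace_tildeTrace τ hlf hns)
    (mul_mem (rep_mem τ hlf _) (diag_mem τ hlf hB)) hc
    (fun n => rep τ (cPF {v}) * bandProj τ n)
    (fun n => mul_mem (rep_mem τ hlf _) (bandProj_mem τ hlf n)) (band_cut_proj τ hlf {v})
    (by rw [bandProj_zero, mul_zero]) (fun n => ?_) (fun n => ?_) fun n x => ?_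
  · rw [tildeTrace_band_cut τ hlf hns, Finset.sum_singleton,
      Finset.sum_congr rfl fun k _ => trace_cut_eq τ hlf hns hv k, Finset.sum_const, nsmul_eq_mul,
      mul_comm (τ (P v)).toReal, ENNReal.ofReal_mul (by positivity), ENNReal.ofReal_toReal hfin,
      ← ENNReal.ofReal_natCast, Int.card_Ioo]
    have : (((n + 1 : ℕ) : ℤ) - -((n + 1 : ℕ) : ℤ) - 1).toNat = 2 * n + 1 := by lia
    rw [this]
    push_cast
    rfl
  · have ha : rep τ (cP v) * rep τ (cPF {v}) = rep τ (cP v) := by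
      rw [cPF_singleton, ← rep_mul, cP_mul_self]
    rw [mul_diag_mul_one_sub_cut τ hlf ha hB]
    refine (norm_mul_le _ _).trans ((mul_le_of_le_one_left (norm_nonneg _)
      (norm_proj_le_one (rep_cP_proj τ v))).trans ?_)
    refine norm_diag_mul_band_le τ hlf hB n (invSqrt_pos _).le fun k hk => ?_
    rw [Complex.norm_real, Real.norm_of_nonneg (invSqrt_pos (k : ℝ)).le]
    exact invSqrt_anti n.cast_nonneg (by exact_mod_cast hk)
  · rw [rep_cPF_mul_band_comm τ hlf, cPF_singleton, rep_mul_diag_comm τ hlf (homog_cP v) hB,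
      mul_apply_eq_comp, mul_apply_eq_comp, inv_mul_le_iff₀ (by positivity)]
    refine (isGrading τ hlf).norm_le_of_forall (by positivity) fun k => ?_
    rw [Phi_bandProj τ hlf, hB, norm_smul, norm_smul, ← mul_assoc]
    gcongr
    rw [Complex.norm_real, Real.norm_of_nonneg (invSqrt_pos (k : ℝ)).le]
    split_ifs with hk
    · rw [norm_one, ← div_eq_mul_inv, one_le_div (by positivity)]
      refine Real.sqrt_le_sqrt ?_
      have h1 : |(k : ℝ)| ≤ n := by
        have : |k| ≤ n := by push_cast at hk; lia
        exact_mod_cast this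
      have := sq_le_sq.2 (h1.trans (le_abs_self (n : ℝ)))
      linarith
    · rw [norm_zero]
      positivity

end Summability

section NotTraceClass

variable {V : Type u} [Quiver.{u + 1} V] (τ : GaugeTrace V)

/-! ### Failure of trace class -/

/-- In contrast to `rightMul_comm` for `N`, the degree of `f` is unrestricted: elements of `𝒜` are
norm limits of left multiplications. -/
theorem smoothAlgebra_rightMul {a : L2 τ →L[ℂ] L2 τ} (ha : a ∈ smoothAlgebra τ) (f : core V)
    (y : L2 τ) : a (rightMul τ f y) = rightMul τ f (a y) := by
  obtain ⟨x, -, h⟩ := ha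
  have h1 : (fun i => rightMul τ f * rep τ (x i)) = fun i => rep τ (x i) * rightMul τ f :=
    funext fun i => rightMul_rep τ f (x i)
  have h2 : rightMul τ f * a = a * rightMul τ f :=
    tendsto_nhds_unique (h.const_mul (rightMul τ f)) (h1 ▸ h.mul_const (rightMul τ f))
  exact congrArg (fun T : L2 τ →L[ℂ] L2 τ => T y) h2.symm

/-- Right multiplication by `S_μ⋆` is isometric on the vectors that it maps `a P_v` to. -/
theorem norm_smoothAlgebra_star_cS (hlf : LocallyFinite V) {a : L2 τ →L[ℂ] L2 τ}
    (ha : a ∈ smoothAlgebra τ) {u v : V} (μ : Quiver.Path u v) :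
    ‖a (cvec τ (star (cS μ)))‖ = ‖a (cvec τ (cP v))‖ := by
  have h1 : ∀ f x : core V, a (cvec τ (x * f)) = rightMul τ f (a (cvec τ x)) := fun f x => by
    rw [← rightMul_cvec, smoothAlgebra_rightMul τ ha]
  rw [← sq_eq_sq₀ (norm_nonneg _) (norm_nonneg _), ← cP_mul_star_cS, h1, ← re_inner_star_mul_self,
    mul_apply_eq_comp, star_rightMul, star_star, ← h1, ← h1, cP_mul_star_cS, star_cS_mul_cS hlf,
    inner_self_eq_norm_sq_to_K]
  norm_cast

theorem norm_inner_frameElt (hlf : LocallyFinite V) {a B : L2 τ →L[ℂ] L2 τ}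
    (ha : a ∈ smoothAlgebra τ)
    (hB : ∀ k x, Phi τ k (B x) = (((√(1 + (k : ℝ) ^ 2))⁻¹ : ℝ) : ℂ) • Phi τ k x) {u v : V}
    (μ : Quiver.Path u v) :
    ‖inner ℂ (cvec τ (frameElt (⟨u, v, μ⟩, false)))
      (star a ((a * B) (cvec τ (frameElt (⟨u, v, μ⟩, false)))))‖ =
      weight ⟨u, v, μ⟩ * ((√(1 + (μ.length : ℝ) ^ 2))⁻¹ * ‖a (cvec τ (cP v))‖ ^ 2) := by
  set w := cvec τ (star (cS μ)) with hw
  have hBw : B w = (((√(1 + (μ.length : ℝ) ^ 2))⁻¹ : ℝ) : ℂ) • w := by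
    have h := (isGrading τ hlf).diag_apply hB (-(μ.length : ℤ)) w
    rw [Phi_cvec τ (homog_cS μ).star] at h
    rw [h]
    push_cast
    rw [neg_sq]
  have h1 : inner ℂ w (star a (a w)) = ((‖a (cvec τ (cP v))‖ ^ 2 : ℝ) : ℂ) := by
    rw [ContinuousLinearMap.star_eq_adjoint, ContinuousLinearMap.adjoint_inner_right,
      inner_self_eq_norm_sq_to_K, hw, norm_smoothAlgebra_star_cS τ hlf ha]
    norm_cast
  have h2 : cvec τ (frameElt (⟨u, v, μ⟩, false)) = ((√(weight ⟨u, v, μ⟩) : ℝ) : ℂ) • w := by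
    rw [frameElt, map_smul]
  rw [h2, mul_apply_eq_comp]
  simp only [map_smul, hBw]
  rw [inner_smul_left, inner_smul_right, inner_smul_right, h1, Complex.conj_ofReal, ← mul_assoc,
    ← Complex.ofReal_mul, Real.mul_self_sqrt (weight_nonneg _), ← Complex.ofReal_mul,
    ← Complex.ofReal_mul, Complex.norm_real, Real.norm_of_nonneg]
  have := weight_nonneg (⟨u, v, μ⟩ : Pth V)
  positivity

theorem exists_cvec_cP_ne_zero (hlf : LocallyFinite V) {a : L2 τ →L[ℂ] L2 τ}
    (ha : a ∈ smoothAlgebra τ) (h0 : a ≠ 0) : ∃ v, a (cvec τ (cP v)) ≠ 0 := by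
  by_contra! h
  refine h0 (ext_cvec fun x => ?_)
  obtain ⟨F, hF⟩ := exists_cPF_mul hlf x
  rw [← hF, ← rightMul_cvec, smoothAlgebra_rightMul τ ha, cPF, map_sum, map_sum,
    Finset.sum_eq_zero fun v _ => h v, map_zero, zero_apply]

/-- Choose `v` with `a p_v ≠ 0`. The vectors `S_μ⋆` with `r(μ) = v` and `|μ| = n + 1` together
contribute `‖a p_v‖² / √(1 + (n + 1)²) ≥ ‖a p_v‖² / (2 (n + 1))` to the diagonal of `a⋆ (a B)`,
while trace class would bound all finite sums by `‖a⋆‖ ‖a B‖₁`. Negative degrees serve because sinks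
do not affect them. -/
theorem not_mem_traceClass (hlf : LocallyFinite V) (hns : NoSources V) {a B : L2 τ →L[ℂ] L2 τ}
    (ha : a ∈ smoothAlgebra τ) (h0 : a ≠ 0)
    (hB : ∀ k x, Phi τ k (B x) = (((√(1 + (k : ℝ) ^ 2))⁻¹ : ℝ) : ℂ) • Phi τ k x) :
    a * B ∉ traceClass (gaugeN τ) (tildeTrace τ) := by
  classical
  rintro ⟨hN, hfin⟩
  rw [tildeTrace_eq τ (CFC.abs_nonneg _)] at hfin
  obtain ⟨v, hv⟩ := exists_cvec_cP_ne_zero τ hlf ha h0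
  have hbound := (isTraceFrame τ hlf hns).sum_norm_inner_le
    (star_mem (smoothAlgebra_subset τ hlf ha)) hN hfin
  set c := ‖a (cvec τ (cP v))‖ ^ 2 with hc
  have hc0 : 0 < c := by positivity
  set K := ‖star a‖ * (vecTrace (fun i => cvec τ (frameElt i)) (CFC.abs (a * B))).toReal
  have key : ∀ M : ℕ, ∑ n ∈ Finset.range M, 1 / ((n : ℝ) + 1) ≤ 2 * K / c := fun M => by
    have hb := hbound ((Finset.range M).biUnion fun n =>
      (inPaths hlf v (n + 1)).map (inEmb v) ×ˢ {false})
    rw [Finset.sum_biUnion] at hb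
    · rw [le_div_iff₀ hc0, ← div_le_iff₀' two_pos, Finset.sum_mul, Finset.sum_div]
      refine le_trans (Finset.sum_le_sum fun n _ => ?_) hb
      have hp : (pathCount v (n + 1) : ℝ) ≠ 0 := by
        exact_mod_cast pathCount_ne_zero hlf hns v (n + 1)
      have hterm : ∀ q ∈ inPaths hlf v (n + 1),
          ‖inner ℂ (cvec τ (frameElt (inEmb v q, false)))
            (star a ((a * B) (cvec τ (frameElt (inEmb v q, false)))))‖ =
          1 / (pathCount v (n + 1) : ℝ) * ((√(1 + ((n + 1 : ℕ) : ℝ) ^ 2))⁻¹ * c) := by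
        rintro ⟨u, μ⟩ hμ
        have hl : μ.length = n + 1 := (mem_inPaths hlf).1 hμ
        have := norm_inner_frameElt τ hlf ha hB μ
        simp only [weight, hl, Nat.succ_ne_zero, if_false] at this
        exact this
      rw [Finset.sum_product, Finset.sum_map]
      simp only [Finset.sum_singleton]
      rw [Finset.sum_congr rfl hterm, Finset.sum_const, card_inPaths, nsmul_eq_mul, ← mul_assoc,
        mul_one_div_cancel hp, one_mul, mul_div_right_comm]
      gcongr
      rw [div_div, one_div]
      gcongr
      rw [Real.sqrt_le_left (by positivity)]
      push_cast
      nlinarith [(n.cast_nonneg : (0 : ℝ) ≤ n)]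
    · intro n _ m _ hnm
      refine Finset.disjoint_left.2 fun i hi hi' => hnm ?_
      have h1 := ((mem_map_inEmb hlf).1 (Finset.mem_product.1 hi).1).2
      have h2 := ((mem_map_inEmb hlf).1 (Finset.mem_product.1 hi').1).2
      lia
  obtain ⟨M, hM⟩ := (Real.tendsto_sum_range_one_div_nat_succ_atTop.eventually_gt_atTop
    (2 * K / c)).exists
  exact (key M).not_gt hM

end NotTraceClass

end GraphAlg

end

/-! ### Assembly of the theorem. -/

open GraphAlg in
theorem theorem5p8 {V : Type u} [Quiver.{u + 1} V] [Countable V] [Nonempty V]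
    (hlf : LocallyFinite V) (hns : NoSources V) (τ : GaugeTrace V) :
    IsAbsoluteValue (dirac τ) (absDirac τ) ∧
    IsSemifiniteSpectralTriple (gaugeN τ) (tildeTrace τ) (smoothAlgebra τ) (dirac τ) ∧
    IsQCInfty (smoothAlgebra τ) (dirac τ) (absDirac τ) ∧
    IsOdd (gaugeN τ) (smoothAlgebra τ) (dirac τ) ∧
    Set.range (rep τ) ⊆ finitelySupported τ ∧
    IsLocal (finitelySupported τ) (smoothAlgebra τ) (dirac τ) (absDirac τ) ∧
    IsOneInftySummable (gaugeN τ) (tildeTrace τ) (finitelySupported τ) (dirac τ) ∧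
    ∃ B : L2 τ →L[ℂ] L2 τ, IsInvSqrtOneAddSq (dirac τ) B ∧ B ∈ gaugeN τ ∧
      (∀ a ∈ smoothAlgebra τ, a ≠ 0 → a * B ∉ traceClass (gaugeN τ) (tildeTrace τ)) ∧
      ∀ v : V, NoSinksDownstream v →
        τ (P v) ≠ ∞ ∧
        0 ≤ repP τ v * B ∧
        repP τ v * B ∈ dixmierIdeal (gaugeN τ) (tildeTrace τ) ∧
        ∀ ω : MeasureTheory.Lp ℝ ∞ (MeasureTheory.volume.restrict (Set.Ioi (0 : ℝ))) →L[ℝ] ℝ,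
          IsGeneralizedLimit ω →
          ∃ hF : MeasureTheory.MemLp (dixmierFun (gaugeN τ) (tildeTrace τ) (repP τ v * B)) ∞
              (MeasureTheory.volume.restrict (Set.Ioi (0 : ℝ))),
            ω (hF.toLp _) = 2 * (τ (P v)).toReal := by
  obtain ⟨B, hB⟩ := exists_invSqrt τ hlf
  refine ⟨isAbsoluteValue_absDirac τ hlf, isSemifiniteSpectralTriple τ hlf hns, isQCInfty τ hlf,
    isOdd τ hlf hns, ?_, isLocal τ hlf hns, isOneInftySummable τ hlf hns, B,
    isInvSqrtOneAddSq τ hlf hB, diag_mem τ hlf hB,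
    fun a ha h0 => not_mem_traceClass τ hlf hns ha h0 hB, fun v hv =>
      ⟨(trace_P_lt_top τ v).ne, repP_mul_nonneg τ hlf hB v, dixmier_repP τ hlf hns hB hv⟩⟩
  rintro _ ⟨x, rfl⟩
  exact rep_mem_finitelySupported τ hlf x
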